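/- Setting. Let $\mathbb X$ be a Polish space, $\eta$ a non-atomic Borel probability measure on $\mathbb X$, and $x\mapsto\rho_x$ an (s-finite) kernel of measures on $\mathbb R^+=(0,\infty)$. Assume that $\int_{\mathbb X}\int_{\mathbb R^+}\min\{y,s\}\,\rho_x(\mathrm dy)\,\eta(\mathrm dx)<\infty$ for all $s>0$ and that $\nu(\mathrm dx,\mathrm ds)=\eta(\mathrm dx)\rho_x(\mathrm ds)$ has infinite total mass. Let $N$ be a Poisson process on $\mathbb X\times\mathbb R^+$ with intensity $\nu$, and let $\widetilde\mu(A)=\int_{A\times\mathbb R^+}s\,N(\mathrm dx,\mathrm ds)$ be the associated completely random measure, with law $\mathcal P_{\widetilde\mu}$; then $0<\widetilde\mu(\mathbb X)<\infty$ a.s. Let $q\ge0$, $\gamma\ge0$, $h(x)=e^{-\gamma x}x^{-q}$, and assume $E[h(\widetilde\mu(\mathbb X))]<\infty$. Let $\widetilde\mu_t$ be a random measure with the tilted law $\mathcal P_{\widetilde\mu_t}(A)=E[h(\widetilde\mu(\mathbb X))]^{-1}\int_A h(\mu(\mathbb X))\,\mathcal P_{\widetilde\mu}(\mathrm d\mu)$,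 and let $\widetilde G_t=\widetilde\mu_t/\widetilde\mu_t(\mathbb X)$. Let $X_1,X_2,\dots$ be, conditionally on $\widetilde\mu_t$, i.i.d. with law $\widetilde G_t$. Fix $n\ge1$ and write $\mathbf X_n=(X_1,\dots,X_n)$; let $Y_1,\dots,Y_{\aleph}$ (with $\aleph=\aleph(\mathbf p_n)$) be the distinct values of $\mathbf X_n$ and $n_k=\#\{i\le n:X_i=Y_k\}$. Let $U_n$ be a random variable which, conditionally on $\widetilde\mu_t$, is independent of $\mathbf X_n$ and has the gamma distribution with shape $n+q$ and rate $\widetilde\mu_t(\mathbb X)$. Put $\psi_a(b)=\int_{\mathbb X}\int_{\mathbb R^+}(1-e^{-bs})e^{-as}\rho_x(\mathrm ds)\eta(\mathrm dx)$, $\tau_{m,z}(a)=\int_{\mathbb R^+}s^me^{-sa}\rho_z(\mathrm ds)$, and for $u>0$ $$f_{U_n|\mathbf X_n}(u)=\frac{e^{-\psi_0(\gamma+u)}\prod_{k=1}^{\aleph}\tau_{n_k,Y_k}(\gamma+u)\,u^{n+q-1}}{\int_{\mathbb R^+}e^{-\psi_0(\gamma+v)}\prod_{k=1}^{\aleph}\tau_{n_k,Y_k}(\gamma+v)\,v^{n+q-1}\,\mathrm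 dv}.$$ Put further $$\omega_{n,\aleph+1}(u,x)=u\,\tau_{1,x}(\gamma+u),\qquad \omega_{n,k}(u,Y_k)=u\,\frac{\tau_{n_k+1,Y_k}(\gamma+u)}{\tau_{n_k,Y_k}(\gamma+u)},$$ $$\phi(u,\mathbf X_n)=\int_{\mathbb X}\omega_{n,\aleph+1}(u,x)\eta(\mathrm dx)+\sum_{k=1}^{\aleph}\omega_{n,k}(u,Y_k),$$ $$\omega_{n,\aleph+1}(x)=\int_{\mathbb R^+}u\,\tau_{1,x}(\gamma+u)f_{U_n|\mathbf X_n}(u)\,\mathrm du,\qquad \omega_{n,k}(Y_k)=\int_{\mathbb R^+}u\,\frac{\tau_{n_k+1,Y_k}(\gamma+u)}{\tau_{n_k,Y_k}(\gamma+u)}f_{U_n|\mathbf X_n}(u)\,\mathrm du,$$ $$\phi(\mathbf X_n)=\int_{\mathbb X}\omega_{n,\aleph+1}(x)\eta(\mathrm dx)+\sum_{k=1}^{\aleph}\omega_{n,k}(Y_k).$$ Proposition. Almost surely, $f_{U_n|\mathbf X_n}$ is the conditional density of $U_n$ given $\mathbf X_n$, and the following hold. 1. The predictive distribution is $$\mathbb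 P\{X_{n+1}\in\mathrm dx\mid\mathbf X_n\}=\frac{\omega_{n,\aleph+1}(x)}{\phi(\mathbf X_n)}\eta(\mathrm dx)+\sum_{k=1}^{\aleph}\frac{\omega_{n,k}(Y_k)}{\phi(\mathbf X_n)}\delta_{Y_k}(\mathrm dx).$$ 2. After an enlargement of the probability space (to its product with $\mathbb R$) there is a random variable $\widetilde U_n$ whose conditional density given $\mathbf X_n$ is $$f_{\widetilde U_n|\mathbf X_n}(u)=\frac{\phi(u,\mathbf X_n)}{\int_{\mathbb R^+}\phi(v,\mathbf X_n)f_{U_n|\mathbf X_n}(v)\,\mathrm dv}\,f_{U_n|\mathbf X_n}(u),\qquad u>0,$$ where the denominator equals $E[\phi(U_n,\mathbf X_n)\mid\mathbf X_n]$, and such that $$\mathbb P\{X_{n+1}\in\mathrm dx\mid\mathbf X_n,\widetilde U_n\}=\frac{\omega_{n,\aleph+1}(\widetilde U_n,x)}{\phi(\widetilde U_n,\mathbf X_n)}\eta(\mathrm dx)+\sum_{k=1}^{\aleph}\frac{\omega_{n,k}(\widetilde U_n,Y_k)}{\phi(\widetilde U_n,\mathbf X_n)}\delta_{Y_k}(\mathrm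 dx).$$ 3. In addition, $\phi(\mathbf X_n)=E[\phi(U_n,\mathbf X_n)\mid\mathbf X_n]=n+q$; $\omega_{n,\aleph+1}(x)=E[\omega_{n,\aleph+1}(U_n,x)\mid\mathbf X_n]$ for all $x\in\mathbb X$; and $\omega_{n,k}(Y_k)=E[\omega_{n,k}(U_n,Y_k)\mid\mathbf X_n]$ for $k=1,\dots,\aleph$. Here $E[g(U_n)\mid\mathbf X_n]$, for $g\ge 0$, is the integral in $[0,\infty]$ of $g$ against the regular conditional distribution of $U_n$ given $\mathbf X_n$. -/

import Mathlib

open MeasureTheory ProbabilityTheory Set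
open scoped ENNReal

namespace TiltedCRM

/-! ### Poisson processes and completely random measures -/

/-- `N` is a Poisson process (Poisson random measure) with intensity `ν` under `P`:
counts of measurable sets are Poisson with mean `ν B` (almost surely infinite if `ν B = ∞`), and
counts of pairwise disjoint measurable sets are independent. -/
structure IsPoissonProcess {Ω S : Type*} [MeasurableSpace Ω] [MeasurableSpace S]
    (N : Ω → Measure S) (ν : Measure S) (P : Measure Ω) : Prop where
  measurable : Measurable N
  hasLaw_count : ∀ B : Set S, MeasurableSet B → ν B ≠ ∞ →
    HasLaw (fun ω => N ω B)
      ((poissonMeasure (ν B).toNNReal).map (fun k : ℕ => (k : ℝ≥0∞))) P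
  count_eq_top : ∀ B : Set S, MeasurableSet B → ν B = ∞ → ∀ᵐ ω ∂P, N ω B = ∞
  indep : ∀ (k : ℕ) (B : Fin k → Set S), (∀ i, MeasurableSet (B i)) →
    Pairwise (fun i j => Disjoint (B i) (B j)) → iIndepFun (fun i ω => N ω (B i)) P

variable {𝕏 : Type*} [MeasurableSpace 𝕏]

/-- The measure `A ↦ ∫_{A × (0,∞)} s N(dx, ds)` on `𝕏` built from a measure `N` on `𝕏 × ℝ`. -/
noncomputable def toCRM (N : Measure (𝕏 × ℝ)) : Measure 𝕏 :=
  (N.withDensity (fun p => ENNReal.ofReal p.2)).map Prod.fst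

theorem toCRM_apply (N : Measure (𝕏 × ℝ)) {A : Set 𝕏} (hA : MeasurableSet A) :
    toCRM N A = ∫⁻ p in A ×ˢ univ, ENNReal.ofReal p.2 ∂N := by
  rw [toCRM, Measure.map_apply measurable_fst hA, withDensity_apply _ (measurable_fst hA)]
  congr 2
  ext p
  simp

theorem measurable_toCRM : Measurable (toCRM : Measure (𝕏 × ℝ) → Measure 𝕏) := by
  refine Measure.measurable_of_measurable_coe _ fun A hA => ?_
  have hm : Measurable ((A ×ˢ (univ : Set ℝ)).indicator fun p : 𝕏 × ℝ => ENNReal.ofReal p.2) :=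
    (ENNReal.measurable_ofReal.comp measurable_snd).indicator (hA.prod MeasurableSet.univ)
  have h := Measure.measurable_lintegral hm
  simp_rw [lintegral_indicator (hA.prod MeasurableSet.univ)] at h
  simpa only [toCRM_apply _ hA] using h

/-! ### Tilting, normalization, sampling -/

/-- The tilting function `h(x) = e^{-γ x} x^{-q}` (relevant for `x > 0`). -/
noncomputable def tilt (γ q x : ℝ) : ℝ := Real.exp (-γ * x) * x ^ (-q)

/-- `E[h(μ(𝕏))]` for `μ` distributed according to `Q`. -/
noncomputable def tiltConst (Q : Measure (Measure 𝕏)) (γ q : ℝ) : ℝ≥0∞ :=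
  ∫⁻ m, ENNReal.ofReal (tilt γ q (m univ).toReal) ∂Q

/-- The tilted law `A ↦ (E[h(μ(𝕏))])⁻¹ ∫_A h(μ(𝕏)) Q(dμ)`. -/
noncomputable def tiltedLaw (Q : Measure (Measure 𝕏)) (γ q : ℝ) : Measure (Measure 𝕏) :=
  (tiltConst Q γ q)⁻¹ • Q.withDensity (fun m => ENNReal.ofReal (tilt γ q (m univ).toReal))

/-- The normalization `m / m(𝕏)`. -/
noncomputable def normalize (m : Measure 𝕏) : Measure 𝕏 := (m univ)⁻¹ • m

/-- Given the random measure `μ`, the `X i` are i.i.d. with law `μ / μ(𝕏)`. -/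
def IsSampleFrom {Ω : Type*} [MeasurableSpace Ω] (X : ℕ → Ω → 𝕏) (μ : Ω → Measure 𝕏)
    (P : Measure Ω) : Prop :=
  ∀ (m : ℕ) (A : Set (Measure 𝕏)) (B : Fin m → Set 𝕏), MeasurableSet A →
    (∀ i, MeasurableSet (B i)) →
    P {ω | μ ω ∈ A ∧ ∀ i : Fin m, X i ω ∈ B i} =
      ∫⁻ ω in {ω | μ ω ∈ A}, ∏ i, normalize (μ ω) (B i) ∂P

/-- Given `μ`, the variable `U` has the gamma distribution with shape `n + q` and rate `μ(𝕏)`, and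
is independent of the first `n` observations `X 0, …, X (n - 1)`, which are i.i.d. with law
`μ / μ(𝕏)`. -/
def IsGammaAugmentation {Ω : Type*} [MeasurableSpace Ω] (U : Ω → ℝ) (n : ℕ) (q : ℝ)
    (X : ℕ → Ω → 𝕏) (μ : Ω → Measure 𝕏) (P : Measure Ω) : Prop :=
  ∀ (A : Set (Measure 𝕏)) (B : Fin n → Set 𝕏) (C : Set ℝ), MeasurableSet A →
    (∀ i, MeasurableSet (B i)) → MeasurableSet C →
    P {ω | μ ω ∈ A ∧ (∀ i : Fin n, X i ω ∈ B i) ∧ U ω ∈ C} =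
      ∫⁻ ω in {ω | μ ω ∈ A},
        (∏ i, normalize (μ ω) (B i)) * gammaMeasure (n + q) (μ ω univ).toReal C ∂P

/-- The first `n` observations `𝐗ₙ`, as one random vector. -/
def firstObs {Ω : Type*} (X : ℕ → Ω → 𝕏) (n : ℕ) (ω : Ω) : Fin n → 𝕏 := fun i => X i ω

/-! ### The quantities of the urn scheme

All of them are nonnegative and are taken in `[0, ∞]`, so that no integrability convention enters.
The vector `x : Fin n → 𝕏` is the value of `𝐗ₙ`; its clusters are indexed by the distinct values. -/

open Classical in
/-- The set of distinct values `Y_1, …, Y_ℵ` of `x`. -/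
noncomputable def values {n : ℕ} (x : Fin n → 𝕏) : Finset 𝕏 := Finset.univ.image x

/-- The size of the cluster of the value `y` in `x`. -/
noncomputable def mult {n : ℕ} (x : Fin n → 𝕏) (y : 𝕏) : ℕ := Nat.card {i : Fin n // x i = y}

/-- `τ_{m,z}(a) = ∫ s^m e^{-sa} ρ_z(ds)`. -/
noncomputable def tau (ρ : Kernel 𝕏 ℝ) (m : ℕ) (z : 𝕏) (a : ℝ) : ℝ≥0∞ :=
  ∫⁻ s in Ioi 0, ENNReal.ofReal (s ^ m * Real.exp (-s * a)) ∂(ρ z)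

/-- `ψ_a(b) = ∫∫ (1 - e^{-bs}) e^{-as} ρ_x(ds) η(dx)`. -/
noncomputable def psi (η : Measure 𝕏) (ρ : Kernel 𝕏 ℝ) (a b : ℝ) : ℝ≥0∞ :=
  ∫⁻ x, ∫⁻ s in Ioi 0,
    ENNReal.ofReal ((1 - Real.exp (-b * s)) * Real.exp (-a * s)) ∂(ρ x) ∂η

section Urn

variable (η : Measure 𝕏) (ρ : Kernel 𝕏 ℝ) (γ q : ℝ) {n : ℕ}

/-- `e^{-ψ_0(γ+u)} ∏_k τ_{n_k,Y_k}(γ+u) u^{n+q-1}`. -/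
noncomputable def unnormDensityU (x : Fin n → 𝕏) (u : ℝ) : ℝ≥0∞ :=
  ENNReal.ofReal (Real.exp (-(psi η ρ 0 (γ + u)).toReal)) *
    (∏ y ∈ values x, tau ρ (mult x y) y (γ + u)) * ENNReal.ofReal (u ^ ((n : ℝ) + q - 1))

/-- The density `f_{Uₙ|𝐗ₙ}(u)`, for `u > 0`. -/
noncomputable def densityU (x : Fin n → 𝕏) (u : ℝ) : ℝ≥0∞ :=
  unnormDensityU η ρ γ q x u / ∫⁻ v in Ioi 0, unnormDensityU η ρ γ q x v

/-- The conditional weight `ω_{n,ℵ+1}(u, z) = u τ_{1,z}(γ+u)` of a new value `z`. -/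
noncomputable def condWeightNew (u : ℝ) (z : 𝕏) : ℝ≥0∞ :=
  ENNReal.ofReal u * tau ρ 1 z (γ + u)

/-- The conditional weight `ω_{n,k}(u, Y_k)` of the old value `y = Y_k`. -/
noncomputable def condWeightOld (x : Fin n → 𝕏) (u : ℝ) (y : 𝕏) : ℝ≥0∞ :=
  ENNReal.ofReal u * (tau ρ (mult x y + 1) y (γ + u) / tau ρ (mult x y) y (γ + u))

/-- `φ(u, 𝐗ₙ)`. -/
noncomputable def condTotal (u : ℝ) (x : Fin n → 𝕏) : ℝ≥0∞ :=
  ∫⁻ z, condWeightNew ρ γ u z ∂η + ∑ y ∈ values x, condWeightOld ρ γ x u y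

/-- The weight `ω_{n,ℵ+1}(z)` of a new value `z`. -/
noncomputable def weightNew (x : Fin n → 𝕏) (z : 𝕏) : ℝ≥0∞ :=
  ∫⁻ u in Ioi 0, ENNReal.ofReal u * tau ρ 1 z (γ + u) * densityU η ρ γ q x u

/-- The weight `ω_{n,k}(Y_k)` of the old value `y = Y_k`. -/
noncomputable def weightOld (x : Fin n → 𝕏) (y : 𝕏) : ℝ≥0∞ :=
  ∫⁻ u in Ioi 0, ENNReal.ofReal u *
    (tau ρ (mult x y + 1) y (γ + u) / tau ρ (mult x y) y (γ + u)) * densityU η ρ γ q x u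

/-- `φ(𝐗ₙ)`. -/
noncomputable def total (x : Fin n → 𝕏) : ℝ≥0∞ :=
  ∫⁻ z, weightNew η ρ γ q x z ∂η + ∑ y ∈ values x, weightOld η ρ γ q x y

/-- The density `f_{Ũₙ|𝐗ₙ}(u)`, for `u > 0`. -/
noncomputable def densityUTilde (x : Fin n → 𝕏) (u : ℝ) : ℝ≥0∞ :=
  condTotal η ρ γ u x / (∫⁻ v in Ioi 0, condTotal η ρ γ v x * densityU η ρ γ q x v) *
    densityU η ρ γ q x u

/-- The unconditional urn. -/
noncomputable def urn (x : Fin n → 𝕏) : Measure 𝕏 :=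
  η.withDensity (fun z => weightNew η ρ γ q x z / total η ρ γ q x) +
    ∑ y ∈ values x, (weightOld η ρ γ q x y / total η ρ γ q x) • Measure.dirac y

/-- The conditional urn, given the value `u` of the augmenting variable. -/
noncomputable def condUrn (x : Fin n → 𝕏) (u : ℝ) : Measure 𝕏 :=
  η.withDensity (fun z => condWeightNew ρ γ u z / condTotal η ρ γ u x) +
    ∑ y ∈ values x, (condWeightOld ρ γ x u y / condTotal η ρ γ u x) • Measure.dirac y

end Urn

end TiltedCRM

/-! The core is a moment formula for the untilted measure μ = `toCRM N` under an exponential weight.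
Let Ψ be `laplaceExp` and R_n be `refMeasure`. For f bounded below by a positive constant, E[e^{-∫f
dμ} μ(B_1)⋯μ(B_n)] = e^{-Ψ(f)} ∫_{B_1×⋯×B_n} ∏_k τ_{n_k,y_k}(f(y_k)) dR_n. For n = 0 this is the
Laplace functional of a Poisson process. To pass from n to n + 1, replace f by f + t 1_B and
differentiate at t = 0 (`lintegral_expNeg_mul_prod_mul_toCRM_of`). On the left a factor μ(B) comes
down. On the right, the derivative of e^{-Ψ} opens a new cluster z with weight τ_{1,z}, and the
derivative of a factor τ_{m,y} enlarges an old cluster to τ_{m+1,y}. Since η has no atoms, a new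
point a.s. differs from the old ones. As functions of t, all terms are Laplace transforms of finite
measures, so their dyadic difference quotients at 0 increase and differentiation under the integral
is monotone convergence in [0, ∞].

The gamma variable removes the normalization. With T the total mass, the gamma density carries
T^{n+q}, which cancels T^{-q} from the tilt and T^{-n} from the normalized masses; what is left is
e^{-(γ+u)T} u^{n+q-1} / Γ(n+q) (`tilt_mul_prod_normalize_mul_gammaMeasure`). The moment formula with
f = γ + u then shows that the observations and U have joint density proportional to
`unnormDensityU`, and `eq_compProd_kernelU` disintegrates it.

For the next observation, insert a gamma variable of shape n + 1 + q and integrate it out. The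
integrand of order n + 1 is that of order n times the urn weights at u, and Γ(n+q+1) = (n+q) Γ(n+q)
leaves a factor 1/(n+q). The predictive law is therefore (averaged weights)/(n+q), and its total
mass 1 forces φ = n + q (`total_eq_and_eq_compProd_urnKernel`).

Finally, mixing the conditional urns over the density proportional to φ(u) f(u) gives back the
unconditional urn. The three-variable law built from these kernels has the correct marginal for the
observations and the next one, so Ũ can be drawn from its conditional law given them
(`exists_augmented`). -/

namespace TiltedCRM

open Filter Topology NNReal

/-! ### The function `e^{-x}` on `[0, ∞]` -/

/-- The function `x ↦ e^{-x}` on `[0, ∞]`. -/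
noncomputable def expNeg (x : ℝ≥0∞) : ℝ≥0∞ := EReal.exp (-(x : EReal))

theorem expNeg_eq_inv (x : ℝ≥0∞) : expNeg x = (EReal.exp x)⁻¹ := EReal.exp_neg _

theorem expNeg_coe (x : ℝ≥0) : expNeg x = ENNReal.ofReal (Real.exp (-x)) := by
  have h : (((x : ℝ≥0∞) : EReal)) = ((x : ℝ) : EReal) := rfl
  rw [expNeg, h, ← EReal.coe_neg, EReal.exp_coe]

theorem expNeg_ofReal {x : ℝ} (hx : 0 ≤ x) :
    expNeg (ENNReal.ofReal x) = ENNReal.ofReal (Real.exp (-x)) := by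
  rw [ENNReal.ofReal, expNeg_coe, Real.coe_toNNReal x hx]

theorem expNeg_of_ne_top {x : ℝ≥0∞} (hx : x ≠ ∞) :
    expNeg x = ENNReal.ofReal (Real.exp (-x.toReal)) := by
  lift x to ℝ≥0 using hx
  simp [expNeg_coe]

@[simp] theorem expNeg_zero : expNeg 0 = 1 := by simp [expNeg]

@[simp] theorem expNeg_top : expNeg ∞ = 0 := by simp [expNeg]

theorem expNeg_add (x y : ℝ≥0∞) : expNeg (x + y) = expNeg x * expNeg y := by
  rw [expNeg_eq_inv, expNeg_eq_inv, expNeg_eq_inv, EReal.coe_ennreal_add, EReal.exp_add,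
    ENNReal.mul_inv]
  · left; simp
  · right; simp

theorem expNeg_sum {ι : Type*} (s : Finset ι) (f : ι → ℝ≥0∞) :
    expNeg (∑ i ∈ s, f i) = ∏ i ∈ s, expNeg (f i) := by
  classical
  induction s using Finset.induction_on with
  | empty => simp
  | insert a s ha ih => rw [Finset.sum_insert ha, Finset.prod_insert ha, expNeg_add, ih]

theorem expNeg_antitone : Antitone expNeg := fun x y h => by
  refine EReal.exp_monotone ?_
  simpa using h

theorem expNeg_le_one (x : ℝ≥0∞) : expNeg x ≤ 1 := by
  simpa using expNeg_antitone (zero_le (a := x))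

theorem expNeg_ne_top (x : ℝ≥0∞) : expNeg x ≠ ∞ :=
  ((expNeg_le_one x).trans_lt ENNReal.one_lt_top).ne

theorem continuous_expNeg : Continuous expNeg := by
  unfold expNeg
  exact ENNReal.continuous_exp.comp (continuous_neg.comp continuous_coe_ennreal_ereal)

@[fun_prop]
theorem measurable_expNeg : Measurable expNeg := continuous_expNeg.measurable

theorem one_sub_expNeg_le (x : ℝ≥0∞) : 1 - expNeg x ≤ x := by
  induction x with
  | top => simp
  | coe x =>
    rw [expNeg_coe, ← ENNReal.ofReal_one, ← ENNReal.ofReal_sub _ (Real.exp_pos _).le,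
      ← ENNReal.ofReal_coe_nnreal]
    refine ENNReal.ofReal_le_ofReal ?_
    linarith [Real.add_one_le_exp (-(x : ℝ))]

/-- Equivalent to 1 + x ≤ e^x. With the upper bound x it traps (1 - e^{-x})/x between e^{-x} and 1.
-/
theorem mul_expNeg_le_one_sub (x : ℝ≥0∞) : x * expNeg x ≤ 1 - expNeg x := by
  induction x with
  | top => simp
  | coe x =>
    rw [expNeg_coe, ← ENNReal.ofReal_one, ← ENNReal.ofReal_sub _ (Real.exp_pos _).le,
      ← ENNReal.ofReal_coe_nnreal, ← ENNReal.ofReal_mul x.coe_nonneg]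
    refine ENNReal.ofReal_le_ofReal ?_
    have h1 : Real.exp (x : ℝ) * Real.exp (-(x : ℝ)) = 1 := by rw [← Real.exp_add]; simp
    nlinarith [Real.add_one_le_exp (x : ℝ), Real.exp_pos (-(x : ℝ))]

/-! ### Difference quotients at zero -/

/-- The difference quotient of a decreasing function at `0`, with step `2⁻ᵏ`. -/
noncomputable def slopeAt (r : ℝ≥0 → ℝ≥0∞) (k : ℕ) : ℝ≥0∞ := 2 ^ k * (r 0 - r ((2⁻¹) ^ k))

theorem coe_half_pow (k : ℕ) : (((2⁻¹ : ℝ≥0) ^ k : ℝ≥0) : ℝ≥0∞) = (2 ^ k)⁻¹ := by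
  rw [ENNReal.coe_pow, ENNReal.coe_inv two_ne_zero, ENNReal.inv_pow]
  simp

theorem two_pow_mul_half_pow (k : ℕ) (z : ℝ≥0∞) :
    2 ^ k * ((((2⁻¹ : ℝ≥0) ^ k : ℝ≥0) : ℝ≥0∞) * z) = z := by
  rw [coe_half_pow, ← mul_assoc, ENNReal.mul_inv_cancel (by simp) (by simp), one_mul]

/-- Halving the step: with a = e^{-z/2^{k+1}} the claim is 1 - a² ≤ 2(1 - a), that is (1 - a)² ≥ 0.
Dyadic steps are chosen so that the quotients form an increasing sequence and no domination is
needed later. -/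
theorem monotone_slopeAt_expNeg (z : ℝ≥0∞) : Monotone (slopeAt fun t => expNeg (t * z)) := by
  refine monotone_nat_of_le_succ fun k => ?_
  simp only [slopeAt, ENNReal.coe_zero, zero_mul, expNeg_zero]
  have h : (((2⁻¹ : ℝ≥0) ^ k : ℝ≥0) : ℝ≥0∞) * z =
      (((2⁻¹ : ℝ≥0) ^ (k + 1) : ℝ≥0) : ℝ≥0∞) * z + (((2⁻¹ : ℝ≥0) ^ (k + 1) : ℝ≥0) : ℝ≥0∞) * z := by
    rw [← add_mul, ← ENNReal.coe_add, pow_succ]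
    congr 2
    rw [← mul_add]
    ext; push_cast; norm_num
  rw [h, expNeg_add, pow_succ (2 : ℝ≥0∞), mul_assoc]
  gcongr
  generalize hE : expNeg _ = a
  have ha : a ≤ 1 := hE ▸ expNeg_le_one _
  lift a to ℝ≥0 using (ha.trans_lt ENNReal.one_lt_top).ne
  norm_cast at ha ⊢
  rw [tsub_le_iff_right]
  have : ((1 - a : ℝ≥0) : ℝ) = 1 - a := NNReal.coe_sub ha
  rw [← NNReal.coe_le_coe]
  push_cast [this]
  nlinarith [sq_nonneg (1 - (a : ℝ))]

theorem tendsto_half_pow_mul {z : ℝ≥0∞} (hz : z ≠ ∞) :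
    Tendsto (fun k : ℕ => (((2⁻¹ : ℝ≥0) ^ k : ℝ≥0) : ℝ≥0∞) * z) atTop (𝓝 0) := by
  have h1 : Tendsto (fun k : ℕ => (((2⁻¹ : ℝ≥0) ^ k : ℝ≥0) : ℝ≥0∞)) atTop (𝓝 0) := by
    rw [← ENNReal.coe_zero]
    exact ENNReal.tendsto_coe.2 (tendsto_pow_atTop_nhds_zero_of_lt_one (by simp) (by
      rw [← NNReal.coe_lt_coe]; push_cast; norm_num))
  simpa using ENNReal.Tendsto.mul_const (b := z) h1 (Or.inr hz)

/-- If `2ᵏ c_k → c < ∞` then `2ᵏ (1 - e^{-c_k}) → c`. -/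
theorem tendsto_two_pow_mul_one_sub_expNeg {c : ℕ → ℝ≥0∞} {d : ℝ≥0∞} (hd : d ≠ ∞)
    (h : Tendsto (fun k => 2 ^ k * c k) atTop (𝓝 d)) :
    Tendsto (fun k => 2 ^ k * (1 - expNeg (c k))) atTop (𝓝 d) := by
  -- c_k is the product of 2⁻ᵏ → 0 and 2ᵏ c_k → d, with d finite.
  have hc : Tendsto c atTop (𝓝 0) := by
    have h1 : Tendsto (fun k : ℕ => (((2⁻¹ : ℝ≥0) ^ k : ℝ≥0) : ℝ≥0∞)) atTop (𝓝 0) := by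
      simpa using tendsto_half_pow_mul ENNReal.one_ne_top
    have := ENNReal.Tendsto.mul h1 (Or.inr hd) h (Or.inr ENNReal.zero_ne_top)
    rw [zero_mul] at this
    refine this.congr fun k => ?_
    rw [mul_left_comm, two_pow_mul_half_pow]
  have he : Tendsto (fun k => 2 ^ k * c k * expNeg (c k)) atTop (𝓝 d) := by
    have h2 := (continuous_expNeg.tendsto 0).comp hc
    simpa using ENNReal.Tendsto.mul h (by simp) h2 (Or.inr hd)
  refine tendsto_of_tendsto_of_tendsto_of_le_of_le he h (fun k => ?_) (fun k => ?_)
  · simp only [mul_assoc]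
    gcongr
    exact mul_expNeg_le_one_sub _
  · simp only
    gcongr
    exact one_sub_expNeg_le _

theorem iSup_slopeAt_expNeg (z : ℝ≥0∞) : ⨆ k, slopeAt (fun t => expNeg (t * z)) k = z := by
  refine iSup_eq_of_tendsto (monotone_slopeAt_expNeg z) ?_
  simp only [slopeAt, ENNReal.coe_zero, zero_mul, expNeg_zero]
  by_cases hz : z = ∞
  · subst hz
    have : ∀ k : ℕ, (2 : ℝ≥0∞) ^ k * (1 - expNeg ((((2⁻¹ : ℝ≥0) ^ k : ℝ≥0) : ℝ≥0∞) * ∞)) = 2 ^ k := by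
      intro k
      rw [ENNReal.mul_top (by simp)]
      simp
    simp_rw [this]
    exact ENNReal.tendsto_pow_atTop_nhds_top_iff.2 (by norm_num)
  · refine tendsto_two_pow_mul_one_sub_expNeg hz ?_
    simp_rw [two_pow_mul_half_pow]
    exact tendsto_const_nhds

/-! ### Laplace transforms of finite measures -/

/-- `r` is the Laplace transform of a finite measure on `[0, ∞]`, of first moment `d`. -/
def IsLaplace (r : ℝ≥0 → ℝ≥0∞) (d : ℝ≥0∞) : Prop :=
  ∃ M : Measure ℝ≥0∞, IsFiniteMeasure M ∧ (∀ t, r t = ∫⁻ z, expNeg (t * z) ∂M) ∧ d = ∫⁻ z, z ∂M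

namespace IsLaplace

theorem of_lintegral {E : Type*} [MeasurableSpace E] (m : Measure E) [IsFiniteMeasure m]
    {Z : E → ℝ≥0∞} (hZ : Measurable Z) :
    IsLaplace (fun t => ∫⁻ x, expNeg (t * Z x) ∂m) (∫⁻ x, Z x ∂m) :=
  ⟨m.map Z, inferInstance, fun t => by rw [lintegral_map (by fun_prop) hZ],
    by rw [lintegral_map measurable_id' hZ]⟩

/-- The Laplace transform of a random variable weighted by an integrable density. -/
theorem of_lintegral_mul {E : Type*} [MeasurableSpace E] (m : Measure E)
    {w Z : E → ℝ≥0∞} (hw : Measurable w) (hZ : Measurable Z) (h : ∫⁻ x, w x ∂m ≠ ∞) :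
    IsLaplace (fun t => ∫⁻ x, w x * expNeg (t * Z x) ∂m) (∫⁻ x, w x * Z x ∂m) := by
  have := isFiniteMeasure_withDensity h
  convert of_lintegral (m.withDensity w) hZ using 1
  · ext t
    rw [lintegral_withDensity_eq_lintegral_mul _ hw (by fun_prop)]
    rfl
  · rw [lintegral_withDensity_eq_lintegral_mul _ hw hZ]
    rfl

variable {r r₁ r₂ : ℝ≥0 → ℝ≥0∞} {d d₁ d₂ : ℝ≥0∞}

theorem zero_ne_top (h : IsLaplace r d) : r 0 ≠ ∞ := by
  obtain ⟨M, hM, hr, -⟩ := h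
  simp [hr]

theorem apply_le (h : IsLaplace r d) (t : ℝ≥0) : r t ≤ r 0 := by
  obtain ⟨M, hM, hr, -⟩ := h
  rw [hr, hr]
  exact lintegral_mono fun z => by simpa using expNeg_le_one _

/-- Integrate the pointwise statements for e^{-tz} and use monotone convergence. The first moment d,
possibly infinite, is thus determined by the function r alone: two representations of one transform
have the same d. -/
theorem monotone_and_iSup_slopeAt (h : IsLaplace r d) :
    Monotone (slopeAt r) ∧ ⨆ k, slopeAt r k = d := by
  obtain ⟨M, hM, hr, rfl⟩ := h
  have key : ∀ k, slopeAt r k = ∫⁻ z, slopeAt (fun t => expNeg (t * z)) k ∂M := by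
    intro k
    simp only [slopeAt]
    rw [lintegral_const_mul _ (by fun_prop), lintegral_sub (by fun_prop), hr, hr]
    · rw [← hr]
      refine ne_top_of_le_ne_top (?_ : r 0 ≠ ∞) ?_
      · simp [hr]
      · rw [hr, hr]
        exact lintegral_mono fun z => by simpa using expNeg_le_one _
    · exact ae_of_all _ fun z => by simpa using expNeg_le_one _
  refine ⟨fun i j hij => ?_, ?_⟩
  · rw [key, key]
    exact lintegral_mono fun z => monotone_slopeAt_expNeg z hij
  · simp_rw [key]
    rw [← lintegral_iSup (fun k => by unfold slopeAt; fun_prop)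
      (fun i j hij z => monotone_slopeAt_expNeg z hij)]
    simp_rw [iSup_slopeAt_expNeg]

theorem monotone_slopeAt (h : IsLaplace r d) : Monotone (slopeAt r) :=
  h.monotone_and_iSup_slopeAt.1

theorem iSup_slopeAt (h : IsLaplace r d) : ⨆ k, slopeAt r k = d :=
  h.monotone_and_iSup_slopeAt.2

theorem one : IsLaplace (fun _ => 1) 0 :=
  ⟨Measure.dirac 0, inferInstance, fun t => by simp, by simp⟩

/-- The product is the transform of z₁ + z₂ under the product measure, so the product rule is
additivity of the mean. -/
theorem mul (h₁ : IsLaplace r₁ d₁) (h₂ : IsLaplace r₂ d₂) :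
    IsLaplace (fun t => r₁ t * r₂ t) (d₁ * r₂ 0 + r₁ 0 * d₂) := by
  obtain ⟨M₁, hM₁, hr₁, rfl⟩ := h₁
  obtain ⟨M₂, hM₂, hr₂, rfl⟩ := h₂
  have h := of_lintegral (M₁.prod M₂) (Z := fun p => p.1 + p.2) (by fun_prop)
  convert h using 1
  · ext t
    simp_rw [mul_add, expNeg_add]
    rw [hr₁, hr₂, lintegral_prod_mul (f := fun z => expNeg (t * z)) (g := fun z => expNeg (t * z))
      (by fun_prop) (by fun_prop)]
  · rw [lintegral_add_left (by fun_prop), lintegral_prod _ (by fun_prop),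
      lintegral_prod _ (by fun_prop)]
    simp [hr₁, hr₂, lintegral_mul_const _ measurable_id', mul_comm]

theorem prod {ι : Type*} [DecidableEq ι] (s : Finset ι) {r : ι → ℝ≥0 → ℝ≥0∞} {d : ι → ℝ≥0∞}
    (h : ∀ i ∈ s, IsLaplace (r i) (d i)) :
    IsLaplace (fun t => ∏ i ∈ s, r i t) (∑ i ∈ s, d i * ∏ j ∈ s.erase i, r j 0) := by
  induction s using Finset.induction_on with
  | empty => simpa using one
  | insert a s ha ih =>
    have h' := (h a (by simp)).mul (ih fun i hi => h i (by simp [hi]))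
    simp_rw [Finset.prod_insert ha, Finset.sum_insert ha, Finset.erase_insert ha]
    convert h' using 2
    rw [Finset.mul_sum]
    refine Finset.sum_congr rfl fun i hi => ?_
    have hai : a ≠ i := fun h => ha (h ▸ hi)
    rw [Finset.erase_insert_of_ne hai, Finset.prod_insert (by simp [ha])]
    ring

end IsLaplace

/-! ### The Laplace functional of a Poisson process -/

/-- The exponential series, with a = e^{-c} allowed to be 0 when c = ∞. -/
theorem lintegral_expNeg_poissonMeasure (r : ℝ≥0) (c : ℝ≥0∞) :
    ∫⁻ k : ℕ, expNeg (c * k) ∂(poissonMeasure r) = expNeg ((1 - expNeg c) * r) := by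
  have hk : ∀ k : ℕ, expNeg (c * k) = expNeg c ^ k := by
    intro k
    have := expNeg_sum (Finset.range k) (fun _ => c)
    simpa [mul_comm] using this
  obtain ⟨a, ha⟩ : ∃ a : ℝ≥0, expNeg c = a := ⟨(expNeg c).toNNReal, by simp [expNeg_ne_top]⟩
  have ha1 : a ≤ 1 := by exact_mod_cast ha ▸ expNeg_le_one c
  have hs : ((1 - a : ℝ≥0) : ℝ) = 1 - a := NNReal.coe_sub ha1
  have h1 : (1 : ℝ≥0∞) - a = ((1 - a : ℝ≥0) : ℝ≥0∞) := by simp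
  simp_rw [hk]
  rw [ha, h1, ← ENNReal.coe_mul, expNeg_coe, poissonMeasure, lintegral_sum_measure]
  simp_rw [lintegral_smul_measure, lintegral_dirac, smul_eq_mul]
  have hsum : HasSum (fun n : ℕ => Real.exp (-r) * ((r * a : ℝ) ^ n / n.factorial))
      (Real.exp (-r) * Real.exp (r * a)) := by
    refine HasSum.mul_left _ ?_
    rw [Real.exp_eq_exp_ℝ]
    exact NormedSpace.expSeries_div_hasSum_exp (r * a : ℝ)
  have hterm : ∀ n : ℕ, ENNReal.ofReal (Real.exp (-r) * r ^ n / n.factorial) * (a : ℝ≥0∞) ^ n =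
      ENNReal.ofReal (Real.exp (-r) * ((r * a : ℝ) ^ n / n.factorial)) := by
    intro n
    rw [← ENNReal.ofReal_coe_nnreal, ← ENNReal.ofReal_pow (by positivity),
      ← ENNReal.ofReal_mul (by positivity)]
    congr 1
    rw [mul_pow]; ring
  simp_rw [hterm]
  rw [← ENNReal.ofReal_tsum_of_nonneg (fun n => by positivity) hsum.summable, hsum.tsum_eq,
    ← Real.exp_add]
  congr 2
  push_cast [hs]
  ring

namespace IsPoissonProcess

variable {Ω S : Type*} [MeasurableSpace Ω] [MeasurableSpace S] {N : Ω → Measure S}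
  {ν : Measure S} {P : Measure Ω}

theorem measurable_apply (hN : IsPoissonProcess N ν P) {B : Set S} (hB : MeasurableSet B) :
    Measurable fun ω => N ω B :=
  (Measure.measurable_coe hB).comp hN.measurable

theorem lintegral_expNeg_mul_apply [IsProbabilityMeasure P] (hN : IsPoissonProcess N ν P)
    {B : Set S} (hB : MeasurableSet B) (c : ℝ≥0∞) :
    ∫⁻ ω, expNeg (c * N ω B) ∂P = expNeg ((1 - expNeg c) * ν B) := by
  by_cases hν : ν B = ∞
  -- For infinite intensity the count is a.s. infinite. Both sides are 1 if c = 0 and 0 otherwise;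
  -- the latter needs 1 - e^{-c} ≠ 0, which follows from c e^{-c} ≤ 1 - e^{-c}.
  · have h := hN.count_eq_top B hB hν
    rw [lintegral_congr_ae (g := fun _ => expNeg (c * ∞)) (h.mono fun ω hω => by simp only [hω])]
    by_cases hc : c = 0
    · simp [hc]
    · have h1 : 1 - expNeg c ≠ 0 := by
        intro h0
        have h2 := mul_expNeg_le_one_sub c
        rw [h0, nonpos_iff_eq_zero, mul_eq_zero] at h2
        rcases h2 with h2 | h2
        · exact hc h2
        · simp [h2] at h0
      rw [hν, ENNReal.mul_top hc, ENNReal.mul_top h1]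
      simp
  · rw [(hN.hasLaw_count B hB hν).lintegral_comp (f := fun z => expNeg (c * z)) (by fun_prop),
      lintegral_map (by fun_prop) (by fun_prop), lintegral_expNeg_poissonMeasure,
      ENNReal.coe_toNNReal hν]

/-- The fibres of a simple function are disjoint, so their counts are independent and the
expectation of the product factors. -/
theorem laplace_simpleFunc [IsProbabilityMeasure P] (hN : IsPoissonProcess N ν P)
    (g : SimpleFunc S ℝ≥0∞) :
    ∫⁻ ω, expNeg (∫⁻ p, g p ∂(N ω)) ∂P = expNeg (∫⁻ p, (1 - expNeg (g p)) ∂ν) := by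
  have h1 : ∀ ω, expNeg (∫⁻ p, g p ∂(N ω)) = ∏ c ∈ g.range, expNeg (c * N ω (g ⁻¹' {c})) := by
    intro ω
    rw [SimpleFunc.lintegral_eq_lintegral, SimpleFunc.lintegral, expNeg_sum]
  have h2 : ∫⁻ p, (1 - expNeg (g p)) ∂ν = ∑ c ∈ g.range, (1 - expNeg c) * ν (g ⁻¹' {c}) := by
    rw [← SimpleFunc.map_lintegral (fun c => 1 - expNeg c) g, ← SimpleFunc.lintegral_eq_lintegral]
    rfl
  have hm : ∀ c, MeasurableSet (g ⁻¹' {c}) := fun c => g.measurableSet_fiber c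
  simp_rw [h1]
  rw [h2, expNeg_sum]
  -- Independence is assumed for families indexed by `Fin k`, hence the enumeration of the range.
  let e := g.range.equivFin
  have h3 : ∀ F : ℝ≥0∞ → ℝ≥0∞, ∏ c ∈ g.range, F c = ∏ i, F (e.symm i) := by
    intro F
    rw [← Finset.prod_coe_sort, ← e.symm.prod_comp]
  simp_rw [h3]
  have hind := hN.indep _ (fun i => g ⁻¹' {(e.symm i : ℝ≥0∞)}) (fun i => hm _) (fun i j hij => by
    refine Disjoint.preimage _ ?_
    simpa using fun h => hij (e.symm.injective (Subtype.ext h)))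
  have hind' := hind.comp (fun i z => expNeg ((e.symm i : ℝ≥0∞) * z)) (fun i => by fun_prop)
  have := lintegral_prod_eq_prod_lintegral_of_indepFun Finset.univ _ hind'
    (fun i => (by fun_prop : Measurable fun z => expNeg ((e.symm i : ℝ≥0∞) * z)).comp
      (hN.measurable_apply (hm _)))
  simp only [Function.comp_def] at this
  rw [this]
  exact Finset.prod_congr rfl fun i _ => hN.lintegral_expNeg_mul_apply (hm _) _

/-- The Laplace functional of a Poisson process. -/
theorem laplace [IsProbabilityMeasure P] (hN : IsPoissonProcess N ν P)
    {g : S → ℝ≥0∞} (hg : Measurable g) :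
    ∫⁻ ω, expNeg (∫⁻ p, g p ∂(N ω)) ∂P = expNeg (∫⁻ p, (1 - expNeg (g p)) ∂ν) := by
  have hsup : ∀ p, Tendsto (fun k => SimpleFunc.eapprox g k p) atTop (𝓝 (g p)) := fun p => by
    rw [← SimpleFunc.iSup_eapprox_apply hg p]
    exact tendsto_atTop_iSup fun i j hij => SimpleFunc.monotone_eapprox g hij p
  have hl : Tendsto (fun k => ∫⁻ ω, expNeg (∫⁻ p, SimpleFunc.eapprox g k p ∂(N ω)) ∂P) atTop
      (𝓝 (∫⁻ ω, expNeg (∫⁻ p, g p ∂(N ω)) ∂P)) := by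
    refine tendsto_lintegral_of_dominated_convergence (fun _ => 1)
      (fun k => measurable_expNeg.comp
        ((Measure.measurable_lintegral (SimpleFunc.measurable _)).comp hN.measurable))
      (fun k => ae_of_all _ fun ω => expNeg_le_one _) (by simp) (ae_of_all _ fun ω => ?_)
    refine (continuous_expNeg.tendsto _).comp ?_
    exact lintegral_tendsto_of_tendsto_of_monotone (fun k => (SimpleFunc.measurable _).aemeasurable)
      (ae_of_all _ fun p i j hij => SimpleFunc.monotone_eapprox g hij p) (ae_of_all _ hsup)
  -- The exponent may diverge; monotone convergence and continuity of e^{-x} on the whole of [0, ∞]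
  -- cover that case.
  have hr : Tendsto (fun k => expNeg (∫⁻ p, (1 - expNeg (SimpleFunc.eapprox g k p)) ∂ν)) atTop
      (𝓝 (expNeg (∫⁻ p, (1 - expNeg (g p)) ∂ν))) := by
    refine (continuous_expNeg.tendsto _).comp ?_
    refine lintegral_tendsto_of_tendsto_of_monotone (fun k => by fun_prop)
      (ae_of_all _ fun p i j hij => ?_) (ae_of_all _ fun p => ?_)
    · exact tsub_le_tsub_left (expNeg_antitone (SimpleFunc.monotone_eapprox g hij p)) _
    · exact ENNReal.Tendsto.sub tendsto_const_nhds ((continuous_expNeg.tendsto _).comp (hsup p))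
        (Or.inl ENNReal.one_ne_top)
  refine tendsto_nhds_unique hl (hr.congr fun k => ?_)
  exact (hN.laplace_simpleFunc _).symm

end IsPoissonProcess

/-! ### Completely random measures -/

section CRM
variable {𝕏 : Type*} [MeasurableSpace 𝕏]

theorem lintegral_toCRM (N : Measure (𝕏 × ℝ)) {f : 𝕏 → ℝ≥0∞} (hf : Measurable f) :
    ∫⁻ x, f x ∂(toCRM N) = ∫⁻ p, f p.1 * ENNReal.ofReal p.2 ∂N := by
  rw [toCRM, lintegral_map hf measurable_fst,
    lintegral_withDensity_eq_lintegral_mul _ (by fun_prop) (by fun_prop)]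
  simp [mul_comm]

/-- The Laplace exponent `∫∫ (1 - e^{-f(x) s}) ρ_x(ds) η(dx)` of a completely random measure. -/
noncomputable def laplaceExp (η : Measure 𝕏) (ρ : Kernel 𝕏 ℝ) (f : 𝕏 → ℝ≥0∞) : ℝ≥0∞ :=
  ∫⁻ x, ∫⁻ s in Ioi 0, (1 - expNeg (f x * ENNReal.ofReal s)) ∂(ρ x) ∂η

variable {η : Measure 𝕏} [SFinite η] {ρ : Kernel 𝕏 ℝ} [IsSFiniteKernel ρ]
  {Ω : Type*} [MeasurableSpace Ω] {P : Measure Ω} [IsProbabilityMeasure P]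
  {N : Ω → Measure (𝕏 × ℝ)}

theorem setLIntegral_Ioi_zero (m : Measure ℝ) {g : ℝ → ℝ≥0∞} (hg : ∀ s ≤ 0, g s = 0) :
    ∫⁻ s in Ioi 0, g s ∂m = ∫⁻ s, g s ∂m := by
  rw [← lintegral_indicator measurableSet_Ioi]
  congr 1
  ext s
  by_cases hs : 0 < s
  · simp [hs]
  · simp [hs, hg s (not_lt.1 hs)]

theorem IsPoissonProcess.laplace_toCRM (hN : IsPoissonProcess N (η ⊗ₘ ρ) P)
    {f : 𝕏 → ℝ≥0∞} (hf : Measurable f) :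
    ∫⁻ ω, expNeg (∫⁻ x, f x ∂(toCRM (N ω))) ∂P = expNeg (laplaceExp η ρ f) := by
  simp_rw [lintegral_toCRM _ hf]
  rw [hN.laplace (by fun_prop), Measure.lintegral_compProd (by fun_prop), laplaceExp]
  congr 2
  ext x
  rw [setLIntegral_Ioi_zero]
  intro s hs
  simp [ENNReal.ofReal_of_nonpos hs]

end CRM

/-! ### Clusters of a finite sequence -/

section Clusters
variable {𝕏 : Type*} {n : ℕ}

theorem mem_values {x : Fin n → 𝕏} {y : 𝕏} : y ∈ values x ↔ ∃ i, x i = y := by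
  simp [values]

open Classical in
theorem mult_eq_sum (x : Fin n → 𝕏) (y : 𝕏) : mult x y = ∑ i, if x i = y then 1 else 0 := by
  rw [mult, Nat.card_eq_fintype_card, Fintype.card_subtype, Finset.card_filter]

theorem one_le_mult {x : Fin n → 𝕏} {y : 𝕏} (h : y ∈ values x) : 1 ≤ mult x y := by
  obtain ⟨i, hi⟩ := mem_values.1 h
  have : Nonempty {i : Fin n // x i = y} := ⟨⟨i, hi⟩⟩
  exact Nat.card_pos

theorem mult_eq_zero {x : Fin n → 𝕏} {y : 𝕏} (h : y ∉ values x) : mult x y = 0 := by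
  have : IsEmpty {i : Fin n // x i = y} := ⟨fun i => h (mem_values.2 ⟨i, i.2⟩)⟩
  exact Nat.card_of_isEmpty

open Classical in
theorem values_snoc (x : Fin n → 𝕏) (z : 𝕏) :
    values (Fin.snoc x z : Fin (n + 1) → 𝕏) = insert z (values x) := by
  ext y
  simp only [mem_values, Finset.mem_insert]
  constructor
  · rintro ⟨i, rfl⟩
    refine Fin.lastCases ?_ (fun j => ?_) i
    · simp
    · right; exact ⟨j, by simp⟩
  · rintro (rfl | ⟨i, rfl⟩)
    · exact ⟨Fin.last n, by simp⟩
    · exact ⟨i.castSucc, by simp⟩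

open Classical in
theorem mult_snoc (x : Fin n → 𝕏) (z y : 𝕏) :
    mult (Fin.snoc x z : Fin (n + 1) → 𝕏) y = mult x y + if z = y then 1 else 0 := by
  rw [mult_eq_sum, mult_eq_sum, Fin.sum_univ_castSucc]
  simp

/-- With the next lemma, the two ways in which an observation changes a product over clusters: a new
cluster of size one, or an old cluster enlarged by one. -/
theorem prod_values_snoc_of_notMem (g : ℕ → 𝕏 → ℝ≥0∞) {x : Fin n → 𝕏} {z : 𝕏}
    (hz : z ∉ values x) :
    ∏ y ∈ values (Fin.snoc x z : Fin (n + 1) → 𝕏),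
        g (mult (Fin.snoc x z : Fin (n + 1) → 𝕏) y) y =
      (∏ y ∈ values x, g (mult x y) y) * g 1 z := by
  classical
  rw [values_snoc, Finset.prod_insert hz, mult_snoc, mult_eq_zero hz, mul_comm]
  congr 1
  · refine Finset.prod_congr rfl fun y hy => ?_
    have : z ≠ y := fun h => hz (h ▸ hy)
    rw [mult_snoc, if_neg this, add_zero]
  · simp

open Classical in
theorem prod_values_snoc_of_mem (g : ℕ → 𝕏 → ℝ≥0∞) {x : Fin n → 𝕏} {z : 𝕏} (hz : z ∈ values x) :
    ∏ y ∈ values (Fin.snoc x z : Fin (n + 1) → 𝕏),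
        g (mult (Fin.snoc x z : Fin (n + 1) → 𝕏) y) y =
      g (mult x z + 1) z * ∏ y ∈ (values x).erase z, g (mult x y) y := by
  rw [values_snoc, Finset.insert_eq_of_mem hz, ← Finset.mul_prod_erase _ _ hz, mult_snoc,
    if_pos rfl]
  congr 1
  refine Finset.prod_congr rfl fun y hy => ?_
  rw [mult_snoc, if_neg (Finset.ne_of_mem_erase hy).symm, add_zero]

/-- `x i` is the first occurrence of its value in `x`. -/
def IsFirst (x : Fin n → 𝕏) (i : Fin n) : Prop := ∀ j < i, x j ≠ x i

open Classical in
theorem values_eq_image_isFirst (x : Fin n → 𝕏) :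
    values x = (Finset.univ.filter (IsFirst x)).image x := by
  ext y
  simp only [mem_values, Finset.mem_image, Finset.mem_filter, Finset.mem_univ, true_and]
  refine ⟨fun ⟨i, hi⟩ => ?_, fun ⟨i, _, hi⟩ => ⟨i, hi⟩⟩
  -- The least index carrying the value y is its first occurrence.
  have hne : (Finset.univ.filter fun i => x i = y).Nonempty := ⟨i, by simp [hi]⟩
  have hm := Finset.min'_mem _ hne
  simp only [Finset.mem_filter, Finset.mem_univ, true_and] at hm
  refine ⟨_, fun j hj hxj => ?_, hm⟩
  exact absurd (Finset.min'_le _ j (by simp [hxj, hm])) (not_le.2 hj)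

theorem injOn_isFirst (x : Fin n → 𝕏) : Set.InjOn x {i | IsFirst x i} := by
  intro i hi j hj hij
  by_contra hne
  rcases lt_or_gt_of_ne hne with h | h
  · exact hj i h hij
  · exact hi j h hij.symm

open Classical in
-- The index set `values x` varies with x; summing over first occurrences gives a fixed index set
-- with measurable conditions, which is how measurability in x is obtained.
theorem sum_values (x : Fin n → 𝕏) (g : 𝕏 → ℝ≥0∞) :
    ∑ y ∈ values x, g y = ∑ i, if IsFirst x i then g (x i) else 0 := by
  rw [values_eq_image_isFirst, Finset.sum_image fun i hi j hj => injOn_isFirst x (by simpa using hi) (by simpa using hj),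
    Finset.sum_filter]

open Classical in
theorem prod_values (x : Fin n → 𝕏) (g : 𝕏 → ℝ≥0∞) :
    ∏ y ∈ values x, g y = ∏ i, if IsFirst x i then g (x i) else 1 := by
  rw [values_eq_image_isFirst, Finset.prod_image fun i hi j hj => injOn_isFirst x (by simpa using hi) (by simpa using hj),
    Finset.prod_filter]

variable [MeasurableSpace 𝕏] [MeasurableEq 𝕏] {α : Type*} [MeasurableSpace α]
  {x : α → Fin n → 𝕏}

theorem measurableSet_isFirst (hx : Measurable x) (i : Fin n) :
    MeasurableSet {p | IsFirst (x p) i} := by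
  simp only [IsFirst, Set.ofPred_forall]
  refine MeasurableSet.iInter fun j => MeasurableSet.iInter fun _ => ?_
  exact (measurableSet_eq_fun (by fun_prop) (by fun_prop)).compl

theorem measurable_mult (hx : Measurable x) {y : α → 𝕏} (hy : Measurable y) :
    Measurable fun p => mult (x p) (y p) := by
  classical
  simp_rw [mult_eq_sum]
  refine Finset.measurable_sum _ fun i _ => ?_
  exact Measurable.ite (measurableSet_eq_fun (by fun_prop) hy) measurable_const measurable_const

theorem measurable_sum_values (hx : Measurable x) {g : α → 𝕏 → ℝ≥0∞}
    (hg : ∀ i, Measurable fun p => g p (x p i)) :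
    Measurable fun p => ∑ y ∈ values (x p), g p y := by
  classical
  simp_rw [sum_values]
  refine Finset.measurable_sum _ fun i _ => ?_
  exact Measurable.ite (measurableSet_isFirst hx i) (hg i) measurable_const

theorem measurable_prod_values (hx : Measurable x) {g : α → 𝕏 → ℝ≥0∞}
    (hg : ∀ i, Measurable fun p => g p (x p i)) :
    Measurable fun p => ∏ y ∈ values (x p), g p y := by
  classical
  simp_rw [prod_values]
  refine Finset.measurable_prod _ fun i _ => ?_
  exact Measurable.ite (measurableSet_isFirst hx i) (hg i) measurable_const

end Clusters

theorem measurable_finSnoc {𝕏 : Type*} [MeasurableSpace 𝕏] {n : ℕ} :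
    Measurable fun p : (Fin n → 𝕏) × 𝕏 => (Fin.snoc p.1 p.2 : Fin (n + 1) → 𝕏) := by
  refine measurable_pi_iff.2 fun i => ?_
  refine Fin.lastCases ?_ (fun j => ?_) i
  · simpa using measurable_snd
  · simp only [Fin.snoc_castSucc]; fun_prop

/-! ### Mixtures of a diffuse measure and of atoms at the observed values -/

section Mixture
variable {𝕏 : Type*} [MeasurableSpace 𝕏] {n : ℕ}

/-- The measure of density `a` with respect to `η`, plus atoms of weight `b y` at the values `y`
of `x`. -/
noncomputable def mixture (η : Measure 𝕏) (x : Fin n → 𝕏) (a b : 𝕏 → ℝ≥0∞) : Measure 𝕏 :=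
  η.withDensity a + ∑ y ∈ values x, b y • Measure.dirac y

theorem lintegral_mixture (η : Measure 𝕏) (x : Fin n → 𝕏) {a : 𝕏 → ℝ≥0∞} (b : 𝕏 → ℝ≥0∞)
    (ha : Measurable a) {g : 𝕏 → ℝ≥0∞} (hg : Measurable g) :
    ∫⁻ z, g z ∂(mixture η x a b) = ∫⁻ z, a z * g z ∂η + ∑ y ∈ values x, b y * g y := by
  rw [mixture, lintegral_add_measure, lintegral_finsetSum_measure,
    lintegral_withDensity_eq_lintegral_mul _ ha hg]
  congr 1
  refine Finset.sum_congr rfl fun y _ => ?_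
  rw [lintegral_smul_measure, lintegral_dirac' _ hg, smul_eq_mul]

theorem mixture_apply (η : Measure 𝕏) (x : Fin n → 𝕏) {a : 𝕏 → ℝ≥0∞} (b : 𝕏 → ℝ≥0∞)
    (ha : Measurable a) {A : Set 𝕏} (hA : MeasurableSet A) :
    mixture η x a b A = ∫⁻ z, a z * A.indicator 1 z ∂η + ∑ y ∈ values x, b y * A.indicator 1 y := by
  rw [← lintegral_mixture η x b ha (measurable_one.indicator hA), lintegral_indicator_one hA]

theorem measurable_mixture [MeasurableEq 𝕏] (η : Measure 𝕏) [SFinite η]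
    {α : Type*} [MeasurableSpace α] {x : α → Fin n → 𝕏} {a b : α → 𝕏 → ℝ≥0∞} (hx : Measurable x)
    (ha : Measurable (Function.uncurry a)) (hb : ∀ i, Measurable fun p => b p (x p i)) :
    Measurable fun p => mixture η (x p) (a p) (b p) := by
  refine Measure.measurable_of_measurable_coe _ fun A hA => ?_
  simp_rw [mixture_apply η _ _ ha.of_uncurry_left hA]
  refine Measurable.add ?_ (measurable_sum_values hx fun i => (hb i).mul ?_)
  · refine Measurable.lintegral_prod_right' (f := fun p : α × 𝕏 => a p.1 p.2 * A.indicator 1 p.2) ?_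
    exact ha.mul ((measurable_one.indicator hA).comp measurable_snd)
  · exact (measurable_one.indicator hA).comp (by fun_prop)

end Mixture

/-! ### The reference measure of the sample -/

section Reference
variable {𝕏 : Type*} [MeasurableSpace 𝕏] [MeasurableEq 𝕏] (η : Measure 𝕏) [IsFiniteMeasure η]

/-- The kernel `x ↦ η + ∑ δ_y` (sum over the values of `x`). -/
noncomputable def growthKernel (n : ℕ) : Kernel (Fin n → 𝕏) 𝕏 :=
  ⟨fun x => mixture η x (fun _ => 1) (fun _ => 1),
    measurable_mixture η measurable_id measurable_const fun _ => measurable_const⟩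

theorem lintegral_growthKernel {n : ℕ} (x : Fin n → 𝕏) {g : 𝕏 → ℝ≥0∞} (hg : Measurable g) :
    ∫⁻ z, g z ∂(growthKernel η n x) = ∫⁻ z, g z ∂η + ∑ y ∈ values x, g y := by
  have := lintegral_mixture η x (fun _ => 1) measurable_const hg (a := fun _ => 1)
  simpa using! this

instance (n : ℕ) : IsFiniteKernel (growthKernel η n) := by
  refine ⟨⟨η univ + n, ENNReal.add_lt_top.2 ⟨measure_lt_top _ _, ENNReal.natCast_lt_top _⟩,
    fun x => ?_⟩⟩
  have h := lintegral_growthKernel η x (measurable_const (a := (1 : ℝ≥0∞)))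
  simp only [lintegral_const, one_mul, Finset.sum_const, nsmul_eq_mul, mul_one] at h
  rw [h]
  gcongr
  classical
  rw [values]
  exact_mod_cast Finset.card_image_le.trans (by simp)

/-- The reference measure for samples of size `n`: the sum over the partitions of the sample of the
image of the corresponding power of `η`. -/
noncomputable def refMeasure : (n : ℕ) → Measure (Fin n → 𝕏)
  | 0 => Measure.dirac Fin.elim0
  | n + 1 => (refMeasure n ⊗ₘ growthKernel η n).map fun p => Fin.snoc p.1 p.2

instance (n : ℕ) : IsFiniteMeasure (refMeasure η n) := by
  induction n with
  | zero => unfold refMeasure; infer_instance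
  | succ n ih => unfold refMeasure; infer_instance

theorem lintegral_refMeasure_succ (n : ℕ) {g : (Fin (n + 1) → 𝕏) → ℝ≥0∞} (hg : Measurable g) :
    ∫⁻ x, g x ∂(refMeasure η (n + 1)) = ∫⁻ x, (∫⁻ z, g (Fin.snoc x z) ∂η +
      ∑ y ∈ values x, g (Fin.snoc x y)) ∂(refMeasure η n) := by
  have hg' : Measurable fun p : (Fin n → 𝕏) × 𝕏 => g (Fin.snoc p.1 p.2) :=
    hg.comp measurable_finSnoc
  rw [refMeasure, lintegral_map hg measurable_finSnoc, Measure.lintegral_compProd hg']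
  refine lintegral_congr fun x => ?_
  rw [lintegral_growthKernel]
  exact hg'.comp (by fun_prop : Measurable fun z => (x, z))

/-- A further coordinate is either drawn from η or copied from an earlier one, so an η-full set
stays full in every coordinate. -/
theorem ae_refMeasure {G : Set 𝕏} (hGm : MeasurableSet G) (hG : ∀ᵐ y ∂η, y ∈ G) (n : ℕ) :
    ∀ᵐ x ∂(refMeasure η n), ∀ i, x i ∈ G := by
  induction n with
  | zero => exact ae_of_all _ fun x i => i.elim0
  | succ n ih =>
    have hS : MeasurableSet {x : Fin (n + 1) → 𝕏 | ∀ i, x i ∈ G} := by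
      simp only [Set.ofPred_forall]
      exact MeasurableSet.iInter fun i => hGm.preimage (measurable_pi_apply i)
    rw [refMeasure, ae_map_iff measurable_finSnoc.aemeasurable hS]
    refine Measure.ae_compProd_of_ae_ae (measurable_finSnoc hS) ?_
    filter_upwards [ih] with x hx
    have hz : ∀ᵐ z ∂(growthKernel η n x), z ∈ G := by
      rw [ae_iff]
      have h := lintegral_growthKernel η x (measurable_one.indicator hGm.compl)
      rw [lintegral_indicator_one hGm.compl, lintegral_indicator_one hGm.compl] at h
      change growthKernel η n x Gᶜ = 0
      rw [h, show η Gᶜ = 0 from ae_iff.1 hG, zero_add]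
      refine Finset.sum_eq_zero fun y hy => ?_
      obtain ⟨i, rfl⟩ := mem_values.1 hy
      simp [hx i]
    filter_upwards [hz] with z hz i
    refine Fin.lastCases ?_ (fun j => ?_) i
    · simpa using hz
    · simpa using hx j

end Reference

/-! ### Perturbing the argument of the Laplace functional in the direction of an indicator -/

section Bump
variable {𝕏 : Type*}

/-- The function `f + t 1_B`. -/
noncomputable def bump (f : 𝕏 → ℝ≥0) (B : Set 𝕏) (t : ℝ≥0) (x : 𝕏) : ℝ≥0 :=
  f x + t * B.indicator 1 x

theorem coe_bump (f : 𝕏 → ℝ≥0) (B : Set 𝕏) (t : ℝ≥0) (x : 𝕏) :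
    (bump f B t x : ℝ≥0∞) = f x + t * B.indicator 1 x := by
  by_cases hx : x ∈ B <;> simp [bump, hx]

@[simp] theorem bump_zero (f : 𝕏 → ℝ≥0) (B : Set 𝕏) : bump f B 0 = f := by
  ext; simp [bump]

theorem le_bump (f : 𝕏 → ℝ≥0) (B : Set 𝕏) (t : ℝ≥0) (x : 𝕏) : f x ≤ bump f B t x :=
  le_self_add

end Bump

/-! ### Exponential moments of the jumps -/

section Tau
variable {𝕏 : Type*} [MeasurableSpace 𝕏] (ρ : Kernel 𝕏 ℝ)

theorem pow_mul_exp_neg_le {a s : ℝ} (ha : 0 < a) (hs : 0 ≤ s) (m : ℕ) :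
    s ^ m * Real.exp (-(a * s)) ≤ m.factorial / a ^ m := by
  have h := Real.pow_div_factorial_le_exp (a * s) (by positivity) m
  rw [Real.exp_neg, le_div_iff₀ (by positivity)]
  rw [div_le_iff₀ (by positivity), mul_pow] at h
  have : s ^ m * (Real.exp (a * s))⁻¹ * a ^ m = (a ^ m * s ^ m) / Real.exp (a * s) := by
    field_simp
  rw [this, div_le_iff₀ (Real.exp_pos _)]
  linarith

/-- Exponential decay beats powers, also at z = ∞, where the left side is 0. This bounds all
weighted moments of the random measure without knowing that its mass is finite. -/
theorem expNeg_mul_mul_pow_le {a : ℝ≥0} (ha : 0 < a) (z : ℝ≥0∞) (m : ℕ) :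
    expNeg (a * z) * z ^ m ≤ ENNReal.ofReal (m.factorial / (a : ℝ) ^ m) := by
  induction z with
  | top => simp [ENNReal.mul_top, ha.ne']
  | coe z =>
    rw [← ENNReal.coe_mul, expNeg_coe, ← ENNReal.coe_pow, ← ENNReal.ofReal_coe_nnreal (p := z ^ m),
      ← ENNReal.ofReal_mul (by positivity)]
    refine ENNReal.ofReal_le_ofReal ?_
    have := pow_mul_exp_neg_le (a := a) (by exact_mod_cast ha) z.coe_nonneg m
    push_cast
    rwa [mul_comm]

theorem tau_coe (m : ℕ) (z : 𝕏) (a : ℝ≥0) :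
    tau ρ m z a =
      ∫⁻ s in Ioi 0, ENNReal.ofReal s ^ m * expNeg (a * ENNReal.ofReal s) ∂(ρ z) := by
  refine setLIntegral_congr_fun measurableSet_Ioi fun s hs => ?_
  have hs : 0 ≤ s := le_of_lt hs
  rw [← ENNReal.ofReal_pow hs, ← ENNReal.ofReal_coe_nnreal (p := a), ← ENNReal.ofReal_mul a.coe_nonneg,
    expNeg_ofReal (by positivity), ← ENNReal.ofReal_mul (by positivity)]
  ring_nf

theorem measurable_tau [IsSFiniteKernel ρ] {α : Type*} [MeasurableSpace α] {m : α → ℕ} {z : α → 𝕏}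
    {a : α → ℝ} (hm : Measurable m) (hz : Measurable z) (ha : Measurable a) :
    Measurable fun p => tau ρ (m p) (z p) (a p) := by
  have h : Measurable fun p : ℕ × (𝕏 × ℝ) => tau ρ p.1 p.2.1 p.2.2 := by
    refine measurable_from_prod_countable_right fun k => ?_
    simp only [tau]
    simp_rw [← lintegral_indicator measurableSet_Ioi]
    refine Measurable.lintegral_kernel_prod_right'
      (κ := ρ.comap Prod.fst measurable_fst) (f := fun p : (𝕏 × ℝ) × ℝ =>
        (Ioi 0).indicator (fun s => ENNReal.ofReal (s ^ k * Real.exp (-s * p.1.2))) p.2) ?_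
    refine Measurable.ite (measurableSet_Ioi.preimage measurable_snd) ?_ measurable_const
    fun_prop
  exact h.comp (hm.prodMk (hz.prodMk ha))

/-- The points at which the Lévy measure integrates `min s 1`. -/
def levySet : Set 𝕏 := {z | ∫⁻ s in Ioi 0, ENNReal.ofReal (min s 1) ∂(ρ z) ≠ ∞}

theorem measurable_lintegral_min : Measurable fun z =>
    ∫⁻ s in Ioi 0, ENNReal.ofReal (min s 1) ∂(ρ z) := by
  simp_rw [← lintegral_indicator measurableSet_Ioi]
  exact (Measure.measurable_lintegral
    (Measurable.indicator (by fun_prop) measurableSet_Ioi)).comp ρ.measurable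

theorem measurableSet_levySet : MeasurableSet (levySet ρ) :=
  (measurable_lintegral_min ρ) (measurableSet_singleton _).compl

/-- Near 0 one power of s suffices, and for large s the exponential bounds the integrand. Hence all
τ of order at least one are finite as soon as min(s, 1) is integrable. -/
theorem tau_le (m : ℕ) (z : 𝕏) {a : ℝ} (ha : 0 < a) :
    tau ρ (m + 1) z a ≤ ENNReal.ofReal (1 + (m + 1).factorial / a ^ (m + 1)) *
      ∫⁻ s in Ioi 0, ENNReal.ofReal (min s 1) ∂(ρ z) := by
  rw [← lintegral_const_mul _ (by fun_prop)]
  refine setLIntegral_mono (by fun_prop) fun s hs => ?_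
  have hs : 0 < s := hs
  rw [← ENNReal.ofReal_mul (by positivity)]
  refine ENNReal.ofReal_le_ofReal ?_
  have h0 : (0 : ℝ) ≤ (m + 1).factorial / a ^ (m + 1) := by positivity
  have h1 : s ^ (m + 1) * Real.exp (-s * a) ≤ (m + 1).factorial / a ^ (m + 1) := by
    have := pow_mul_exp_neg_le ha hs.le (m + 1)
    rwa [neg_mul, mul_comm s a]
  rcases le_total s 1 with h | h
  · rw [min_eq_left h]
    have h2 : s ^ (m + 1) ≤ s := pow_le_of_le_one hs.le h (by simp)
    have h3 : Real.exp (-s * a) ≤ 1 := Real.exp_le_one_iff.2 (by nlinarith)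
    nlinarith [Real.exp_pos (-s * a), pow_pos hs (m + 1)]
  · rw [min_eq_right h]
    linarith

theorem tau_antitone (m : ℕ) (z : 𝕏) : Antitone (tau ρ m z) := fun a b hab => by
  refine setLIntegral_mono' measurableSet_Ioi fun s hs => ENNReal.ofReal_le_ofReal ?_
  have hs : 0 < s := hs
  gcongr ?_ * ?_
  rw [Real.exp_le_exp]
  nlinarith

variable {ρ} in
theorem tau_ne_top {m : ℕ} (hm : 1 ≤ m) {z : 𝕏} (hz : z ∈ levySet ρ) {a : ℝ} (ha : 0 < a) :
    tau ρ m z a ≠ ∞ := by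
  obtain ⟨m, rfl⟩ := Nat.exists_eq_add_of_le' hm
  exact ne_top_of_le_ne_top (ENNReal.mul_ne_top ENNReal.ofReal_ne_top hz) (tau_le ρ m z ha)

/-- The integrand is strictly positive on (0, ∞), so τ vanishes only if ρ_z does not charge (0, ∞).
This settles the quotients 0/0 in the weights of old values. -/
theorem tau_eq_zero_of_tau_eq_zero {m : ℕ} {z : 𝕏} {a : ℝ} (h : tau ρ m z a = 0) (k : ℕ) (b : ℝ) :
    tau ρ k z b = 0 := by
  rw [tau, lintegral_eq_zero_iff (by fun_prop)] at h ⊢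
  filter_upwards [h, ae_restrict_mem measurableSet_Ioi] with s hs hs0
  have hs0 : 0 < s := hs0
  exfalso
  have : 0 < s ^ m * Real.exp (-s * a) := by positivity
  simp only [Pi.zero_apply, ENNReal.ofReal_eq_zero] at hs
  linarith

variable {ρ} in
theorem ae_mem_levySet {η : Measure 𝕏}
    (hρ : ∫⁻ x, ∫⁻ y in Ioi 0, ENNReal.ofReal (min y 1) ∂(ρ x) ∂η < ∞) :
    ∀ᵐ y ∂η, y ∈ levySet ρ := by
  filter_upwards [ae_lt_top (measurable_lintegral_min ρ) hρ.ne] with y hy using hy.ne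

/-- The product `∏ₖ τ_{nₖ,Yₖ}(f(Yₖ))` over the clusters of `x`. -/
noncomputable def clusterProd {n : ℕ} (f : 𝕏 → ℝ≥0) (x : Fin n → 𝕏) : ℝ≥0∞ :=
  ∏ y ∈ values x, tau ρ (mult x y) y (f y)

theorem measurable_clusterProd [MeasurableEq 𝕏] [IsSFiniteKernel ρ] {n : ℕ} {f : 𝕏 → ℝ≥0}
    (hf : Measurable f) : Measurable (clusterProd ρ f : (Fin n → 𝕏) → ℝ≥0∞) := by
  refine measurable_prod_values measurable_id fun i => ?_
  exact measurable_tau ρ (measurable_mult measurable_id (by fun_prop)) (by fun_prop) (by fun_prop)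

theorem measurable_bump {f : 𝕏 → ℝ≥0} (hf : Measurable f) {B : Set 𝕏} (hB : MeasurableSet B)
    (t : ℝ≥0) : Measurable (bump f B t) :=
  hf.add ((measurable_one.indicator hB).const_mul t)

/-- The parameter t enters only through e^{-t 1_B(z) s}; the remaining factor s^m e^{-f(z)s} is an
integrable density by the hypothesis at t = 0. -/
theorem isLaplace_tau {m : ℕ} (z : 𝕏) {f : 𝕏 → ℝ≥0} (B : Set 𝕏) (h : tau ρ m z (f z) ≠ ∞) :
    IsLaplace (fun t => tau ρ m z (bump f B t z)) (B.indicator 1 z * tau ρ (m + 1) z (f z)) := by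
  rw [tau_coe] at h
  have := IsLaplace.of_lintegral_mul ((ρ z).restrict (Ioi 0))
    (w := fun s => ENNReal.ofReal s ^ m * expNeg (f z * ENNReal.ofReal s))
    (Z := fun s => B.indicator 1 z * ENNReal.ofReal s) (by fun_prop) (by fun_prop) h
  convert this using 1
  · ext t
    rw [tau_coe]
    refine lintegral_congr fun s => ?_
    rw [coe_bump, add_mul, expNeg_add, mul_assoc, mul_assoc]
  · rw [tau_coe, ← lintegral_const_mul _ (by fun_prop)]
    refine lintegral_congr fun s => ?_
    ring

end Tau

/-! ### The Laplace exponent -/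

section Exponent
variable {𝕏 : Type*} [MeasurableSpace 𝕏] {η : Measure 𝕏} {ρ : Kernel 𝕏 ℝ}
  {Ω : Type*} [MeasurableSpace Ω] {P : Measure Ω} {N : Ω → Measure (𝕏 × ℝ)}

theorem lintegral_indicator_tau_one_ne_top
    (hρ : ∫⁻ x, ∫⁻ y in Ioi 0, ENNReal.ofReal (min y 1) ∂(ρ x) ∂η < ∞)
    {f : 𝕏 → ℝ≥0} {ε : ℝ≥0} (hε : 0 < ε) (hf : ∀ x, ε ≤ f x) (B : Set 𝕏) :
    ∫⁻ z, B.indicator 1 z * tau ρ 1 z (f z) ∂η ≠ ∞ := by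
  have hε' : (0 : ℝ) < ε := hε
  refine ne_top_of_le_ne_top (ENNReal.mul_ne_top (a :=
    ENNReal.ofReal (1 + (0 + 1).factorial / (ε : ℝ) ^ (0 + 1))) ENNReal.ofReal_ne_top hρ.ne) ?_
  rw [← lintegral_const_mul _ (measurable_lintegral_min ρ)]
  refine lintegral_mono fun z => ?_
  calc B.indicator 1 z * tau ρ 1 z (f z) ≤ 1 * tau ρ 1 z (f z) := by
        gcongr
        exact Set.indicator_le_self' (by simp) z
    _ ≤ tau ρ (0 + 1) z ε := by
        rw [one_mul]
        exact tau_antitone ρ _ z (by exact_mod_cast hf z)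
    _ ≤ _ := tau_le ρ 0 z hε'

theorem measurable_apply_toCRM (hN : IsPoissonProcess N (η ⊗ₘ ρ) P) {B : Set 𝕏}
    (hB : MeasurableSet B) : Measurable fun ω => toCRM (N ω) B :=
  (Measure.measurable_coe hB).comp (measurable_toCRM.comp hN.measurable)

theorem measurable_lintegral_toCRM (hN : IsPoissonProcess N (η ⊗ₘ ρ) P) {f : 𝕏 → ℝ≥0∞}
    (hf : Measurable f) : Measurable fun ω => ∫⁻ x, f x ∂(toCRM (N ω)) :=
  (Measure.measurable_lintegral hf).comp (measurable_toCRM.comp hN.measurable)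

theorem lintegral_bump (m : Measure 𝕏) {f : 𝕏 → ℝ≥0} (hf : Measurable f) {B : Set 𝕏}
    (hB : MeasurableSet B) (t : ℝ≥0) :
    ∫⁻ x, bump f B t x ∂m = ∫⁻ x, f x ∂m + t * m B := by
  simp_rw [coe_bump]
  rw [lintegral_add_left (by fun_prop), lintegral_const_mul _ (measurable_one.indicator hB),
    lintegral_indicator_one hB]

variable [IsSFiniteKernel ρ]

/-- Pointwise 1 - ab = (1 - a) + a(1 - b). Writing the increment additively avoids subtracting
exponents, and makes e^{-Ψ} factor along the perturbation. -/
theorem laplaceExp_bump {f : 𝕏 → ℝ≥0} (hf : Measurable f) (B : Set 𝕏) (t : ℝ≥0) :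
    laplaceExp η ρ (fun x => bump f B t x) = laplaceExp η ρ (fun x => f x) +
      ∫⁻ x, ∫⁻ s in Ioi 0, expNeg (f x * ENNReal.ofReal s) *
        (1 - expNeg (t * (B.indicator 1 x * ENNReal.ofReal s))) ∂(ρ x) ∂η := by
  have hm : Measurable fun x => ∫⁻ s in Ioi 0, (1 - expNeg (f x * ENNReal.ofReal s)) ∂(ρ x) := by
    simp_rw [← lintegral_indicator measurableSet_Ioi]
    refine Measurable.lintegral_kernel_prod_right' (κ := ρ) (f := fun p : 𝕏 × ℝ =>
        (Ioi 0).indicator (fun s => 1 - expNeg (f p.1 * ENNReal.ofReal s)) p.2) ?_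
    exact Measurable.ite (measurableSet_Ioi.preimage measurable_snd) (by fun_prop) measurable_const
  rw [laplaceExp, laplaceExp, ← lintegral_add_left hm]
  refine lintegral_congr fun x => ?_
  rw [← lintegral_add_left (by fun_prop)]
  refine lintegral_congr fun s => ?_
  rw [coe_bump, add_mul, expNeg_add, mul_assoc]
  generalize hE : expNeg _ = a
  generalize hF : expNeg _ = b
  have ha : a ≤ 1 := hE ▸ expNeg_le_one _
  have hb : b ≤ 1 := hF ▸ expNeg_le_one _
  have hat : a ≠ ∞ := (ha.trans_lt ENNReal.one_lt_top).ne
  rw [ENNReal.mul_sub fun _ _ => hat, mul_one, tsub_add_tsub_cancel ha (mul_le_of_le_one_right' hb)]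

variable [SFinite η] [IsProbabilityMeasure P]

/-- The Laplace functional at f + t 1_B carries the factor e^{-tμ(B)}. The first moment is here left
as an expectation; its value comes from differentiating the exponent instead. -/
theorem isLaplace_expNeg_laplaceExp (hN : IsPoissonProcess N (η ⊗ₘ ρ) P) {f : 𝕏 → ℝ≥0}
    (hf : Measurable f) {B : Set 𝕏} (hB : MeasurableSet B) :
    IsLaplace (fun t => expNeg (laplaceExp η ρ fun x => bump f B t x))
      (∫⁻ ω, expNeg (∫⁻ x, f x ∂(toCRM (N ω))) * toCRM (N ω) B ∂P) := by
  have hw : Measurable fun ω => expNeg (∫⁻ x, f x ∂(toCRM (N ω))) :=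
    measurable_expNeg.comp (measurable_lintegral_toCRM hN (by fun_prop))
  have := IsLaplace.of_lintegral_mul P hw (measurable_apply_toCRM hN hB)
    (ne_top_of_le_ne_top ENNReal.one_ne_top
      ((lintegral_mono fun ω => expNeg_le_one _).trans (by simp)))
  convert this using 1
  ext t
  rw [← hN.laplace_toCRM (measurable_bump hf hB t).coe_nnreal_ennreal]
  refine lintegral_congr fun ω => ?_
  rw [lintegral_bump _ hf hB, expNeg_add]

/-- The Palm formula of order one for exponential functionals. -/
theorem lintegral_expNeg_mul_toCRM (hN : IsPoissonProcess N (η ⊗ₘ ρ) P)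
    (hρ : ∫⁻ x, ∫⁻ y in Ioi 0, ENNReal.ofReal (min y 1) ∂(ρ x) ∂η < ∞)
    {f : 𝕏 → ℝ≥0} (hfm : Measurable f) {ε : ℝ≥0} (hε : 0 < ε) (hf : ∀ x, ε ≤ f x)
    {B : Set 𝕏} (hB : MeasurableSet B) :
    ∫⁻ ω, expNeg (∫⁻ x, f x ∂(toCRM (N ω))) * toCRM (N ω) B ∂P =
      expNeg (laplaceExp η ρ fun x => f x) * ∫⁻ z, B.indicator 1 z * tau ρ 1 z (f z) ∂η := by
  have hL := isLaplace_expNeg_laplaceExp hN hfm hB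
  have h1 := tendsto_atTop_iSup hL.monotone_slopeAt
  rw [hL.iSup_slopeAt] at h1
  refine tendsto_nhds_unique h1 ?_
  -- ξ_k is the increment of the exponent for t = 2⁻ᵏ. Its scaled limit is finite because f ≥ ε, so
  -- 2ᵏ(1 - e^{-ξ_k}) and 2ᵏ ξ_k have the same limit, and the latter is a monotone limit.
  set ξ : ℕ → ℝ≥0∞ := fun k => ∫⁻ x, ∫⁻ s in Ioi 0, expNeg (f x * ENNReal.ofReal s) *
        (1 - expNeg (((2⁻¹ ^ k : ℝ≥0) : ℝ≥0∞) * (B.indicator 1 x * ENNReal.ofReal s))) ∂(ρ x) ∂η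
    with hξ
  have h2 : ∀ k, slopeAt (fun t => expNeg (laplaceExp η ρ fun x => bump f B t x)) k =
      expNeg (laplaceExp η ρ fun x => f x) * (2 ^ k * (1 - expNeg (ξ k))) := by
    intro k
    simp only [slopeAt, bump_zero]
    rw [laplaceExp_bump hfm B, expNeg_add, mul_left_comm,
      ENNReal.mul_sub (fun _ _ => expNeg_ne_top _), mul_one]
  refine Tendsto.congr (fun k => (h2 k).symm) ?_
  refine ENNReal.Tendsto.const_mul ?_ (Or.inr (expNeg_ne_top _))
  refine tendsto_two_pow_mul_one_sub_expNeg (lintegral_indicator_tau_one_ne_top hρ hε hf B) ?_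
  set Z : 𝕏 → ℝ → ℝ≥0∞ := fun x s => B.indicator 1 x * ENNReal.ofReal s with hZ
  have hZm : Measurable fun p : 𝕏 × ℝ => Z p.1 p.2 :=
    ((measurable_one.indicator hB).comp measurable_fst).mul (by fun_prop)
  set F : ℕ → 𝕏 → ℝ → ℝ≥0∞ := fun k x s =>
    expNeg (f x * ENNReal.ofReal s) * slopeAt (fun t => expNeg (t * Z x s)) k with hF
  have hFm : ∀ k, Measurable fun p : 𝕏 × ℝ => F k p.1 p.2 := by
    intro k
    simp only [hF, slopeAt]
    exact Measurable.mul (by fun_prop) (by fun_prop)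
  have hmono : ∀ x s, Monotone fun k => F k x s := fun x s i j hij => by
    simp only [hF]
    gcongr
    exact monotone_slopeAt_expNeg _ hij
  have h3 : ∀ k, 2 ^ k * ξ k = ∫⁻ x, ∫⁻ s in Ioi 0, F k x s ∂(ρ x) ∂η := by
    intro k
    have hm0 : Measurable fun p : 𝕏 × ℝ => expNeg (f p.1 * ENNReal.ofReal p.2) *
        (1 - expNeg (((2⁻¹ ^ k : ℝ≥0) : ℝ≥0∞) * Z p.1 p.2)) := by fun_prop
    have hm : Measurable fun x => ∫⁻ s in Ioi 0, expNeg (f x * ENNReal.ofReal s) *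
        (1 - expNeg (((2⁻¹ ^ k : ℝ≥0) : ℝ≥0∞) * Z x s)) ∂(ρ x) := by
      simp_rw [← lintegral_indicator measurableSet_Ioi]
      refine Measurable.lintegral_kernel_prod_right' (κ := ρ) (f := fun p : 𝕏 × ℝ =>
          (Ioi 0).indicator (fun s => expNeg (f p.1 * ENNReal.ofReal s) *
        (1 - expNeg (((2⁻¹ ^ k : ℝ≥0) : ℝ≥0∞) * Z p.1 s))) p.2) ?_
      exact Measurable.ite (measurableSet_Ioi.preimage measurable_snd) hm0 measurable_const
    rw [hξ, ← lintegral_const_mul _ hm]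
    refine lintegral_congr fun x => ?_
    have hZx : Measurable (Z x) := hZm.of_uncurry_left (f := Z)
    rw [← lintegral_const_mul _ (by fun_prop)]
    refine lintegral_congr fun s => ?_
    simp only [hF, slopeAt, ENNReal.coe_zero, zero_mul, expNeg_zero]
    rw [mul_left_comm]
  have h4 : ∫⁻ z, B.indicator 1 z * tau ρ 1 z (f z) ∂η =
      ⨆ k, ∫⁻ x, ∫⁻ s in Ioi 0, F k x s ∂(ρ x) ∂η := by
    rw [← lintegral_iSup]
    · refine lintegral_congr fun x => ?_
      rw [← lintegral_iSup]
      · rw [tau_coe, ← lintegral_const_mul _ (by fun_prop)]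
        refine lintegral_congr fun s => ?_
        simp only [hF]
        rw [← ENNReal.mul_iSup, iSup_slopeAt_expNeg]
        simp only [hZ, pow_one]
        ring
      · exact fun k => (hFm k).comp (by fun_prop : Measurable fun s => (x, s))
      · exact fun i j hij s => hmono x s hij
    · intro k
      simp_rw [← lintegral_indicator measurableSet_Ioi]
      refine Measurable.lintegral_kernel_prod_right' (κ := ρ) (f := fun p : 𝕏 × ℝ =>
          (Ioi 0).indicator (fun s => F k p.1 s) p.2) ?_
      exact Measurable.ite (measurableSet_Ioi.preimage measurable_snd) (hFm k) measurable_const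
    · exact fun i j hij x => lintegral_mono fun s => hmono x s hij
  simp_rw [h3]
  rw [h4]
  exact tendsto_atTop_iSup fun i j hij => lintegral_mono fun x => lintegral_mono fun s =>
    hmono x s hij

end Exponent

/-! ### Moments of a tilted completely random measure -/

section Moments
variable {𝕏 : Type*} [MeasurableSpace 𝕏] {ρ : Kernel 𝕏 ℝ}

open Classical in
/-- The sum over the values `y` of `x` of the products obtained from `clusterProd` by adding a further
observation `y ∈ B`. -/
noncomputable def clusterDeriv (ρ : Kernel 𝕏 ℝ) {n : ℕ} (f : 𝕏 → ℝ≥0) (B : Set 𝕏) (x : Fin n → 𝕏) :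
    ℝ≥0∞ :=
  ∑ y ∈ values x, B.indicator 1 y * tau ρ (mult x y + 1) y (f y) *
    ∏ y' ∈ (values x).erase y, tau ρ (mult x y') y' (f y')

variable (ρ) in
-- The Leibniz rule over the clusters: each term enlarges one of them. Points in `levySet` guarantee
-- that every factor is finite.
theorem isLaplace_clusterProd {n : ℕ} {f : 𝕏 → ℝ≥0} (hf : ∀ x, 0 < f x) (B : Set 𝕏)
    {x : Fin n → 𝕏} (hx : ∀ i, x i ∈ levySet ρ) :
    IsLaplace (fun t => clusterProd ρ (bump f B t) x) (clusterDeriv ρ f B x) := by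
  classical
  have := IsLaplace.prod (values x) (r := fun y t => tau ρ (mult x y) y (bump f B t y))
    (d := fun y => B.indicator 1 y * tau ρ (mult x y + 1) y (f y)) (fun y hy => by
      refine isLaplace_tau ρ y B ?_
      obtain ⟨i, hi⟩ := mem_values.1 hy
      exact tau_ne_top (one_le_mult hy) (hi ▸ hx i) (by exact_mod_cast hf y))
  simp only [bump_zero] at this
  exact this

theorem clusterProd_snoc_of_notMem {n : ℕ} (f : 𝕏 → ℝ≥0) {x : Fin n → 𝕏} {z : 𝕏}
    (hz : z ∉ values x) :
    clusterProd ρ f (Fin.snoc x z : Fin (n + 1) → 𝕏) = clusterProd ρ f x * tau ρ 1 z (f z) :=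
  prod_values_snoc_of_notMem (fun m y => tau ρ m y (f y)) hz

theorem clusterDeriv_eq {n : ℕ} {f : 𝕏 → ℝ≥0} (hf : ∀ x, 0 < f x) (B : Set 𝕏)
    {x : Fin n → 𝕏} (hx : ∀ i, x i ∈ levySet ρ) :
    clusterDeriv ρ f B x = (∑ y ∈ values x, B.indicator 1 y *
      (tau ρ (mult x y + 1) y (f y) / tau ρ (mult x y) y (f y))) * clusterProd ρ f x := by
  classical
  rw [clusterDeriv, Finset.sum_mul]
  refine Finset.sum_congr rfl fun y hy => ?_
  rw [clusterProd, ← Finset.mul_prod_erase _ _ hy]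
  have hfin : tau ρ (mult x y) y (f y) ≠ ∞ := by
    obtain ⟨i, hi⟩ := mem_values.1 hy
    exact tau_ne_top (one_le_mult hy) (hi ▸ hx i) (by exact_mod_cast hf y)
  -- If τ of order n_k vanishes, so does τ of order n_k + 1, and both sides are 0.
  by_cases h0 : tau ρ (mult x y) y (f y) = 0
  · simp [tau_eq_zero_of_tau_eq_zero ρ h0]
  · rw [mul_assoc, mul_assoc, ← mul_assoc (tau ρ (mult x y + 1) y (f y) / _),
      ENNReal.div_mul_cancel h0 hfin]

variable {Ω : Type*} [MeasurableSpace Ω] {P : Measure Ω} [IsProbabilityMeasure P]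
  {N : Ω → Measure (𝕏 × ℝ)}

theorem lintegral_expNeg_mul_prod_toCRM_ne_top {n : ℕ} {f : 𝕏 → ℝ≥0} {ε : ℝ≥0} (hε : 0 < ε)
    (hf : ∀ x, ε ≤ f x) (B : Fin n → Set 𝕏) :
    ∫⁻ ω, expNeg (∫⁻ x, f x ∂(toCRM (N ω))) * ∏ i, toCRM (N ω) (B i) ∂P ≠ ∞ := by
  refine ne_top_of_le_ne_top (b := ENNReal.ofReal (n.factorial / (ε : ℝ) ^ n))
    ENNReal.ofReal_ne_top ?_
  rw [← mul_one (ENNReal.ofReal _), ← measure_univ (μ := P), ← lintegral_const]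
  refine lintegral_mono fun ω => ?_
  refine le_trans ?_ (expNeg_mul_mul_pow_le hε (toCRM (N ω) univ) n)
  gcongr ?_ * ?_
  · refine expNeg_antitone ?_
    rw [← lintegral_const]
    exact lintegral_mono fun x => ENNReal.coe_le_coe.2 (hf x)
  · calc ∏ i, toCRM (N ω) (B i) ≤ ∏ _i : Fin n, toCRM (N ω) univ :=
        Finset.prod_le_prod' fun i _ => measure_mono (subset_univ _)
      _ = _ := by simp

variable [MeasurableEq 𝕏] [IsSFiniteKernel ρ] {η : Measure 𝕏} [IsProbabilityMeasure η]

/-- Unfolds one step of the reference measure: the η part opens a new cluster, the atoms enlarge an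
old one. -/
theorem lintegral_clusterProd_refMeasure_succ [NullSingletonClass η] {n : ℕ} {f : 𝕏 → ℝ≥0}
    (hf : Measurable f) {B : Fin (n + 1) → Set 𝕏} (hB : ∀ i, MeasurableSet (B i)) :
    ∫⁻ x in pi univ B, clusterProd ρ f x ∂(refMeasure η (n + 1)) =
      ∫⁻ x in pi univ (fun i : Fin n => B i.castSucc),
        ((∫⁻ z, (B (Fin.last n)).indicator 1 z * tau ρ 1 z (f z) ∂η) * clusterProd ρ f x +
          clusterDeriv ρ f (B (Fin.last n)) x) ∂(refMeasure η n) := by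
  have hBm : MeasurableSet (pi univ B) := MeasurableSet.univ_pi hB
  have hBm' : MeasurableSet (pi univ fun i : Fin n => B i.castSucc) :=
    MeasurableSet.univ_pi fun i => hB _
  have hcm := measurable_clusterProd ρ hf (n := n + 1)
  rw [← lintegral_indicator hBm, ← lintegral_indicator hBm',
    lintegral_refMeasure_succ _ _ (hcm.indicator hBm)]
  refine lintegral_congr fun x => ?_
  have hg : ∀ z, (pi univ B).indicator (clusterProd ρ f) (Fin.snoc x z : Fin (n + 1) → 𝕏) =
      (pi univ fun i : Fin n => B i.castSucc).indicator (fun _ => (B (Fin.last n)).indicator 1 z *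
        clusterProd ρ f (Fin.snoc x z : Fin (n + 1) → 𝕏)) x := by
    intro z
    have hiff : (Fin.snoc x z : Fin (n + 1) → 𝕏) ∈ pi univ B ↔
        x ∈ pi univ (fun i : Fin n => B i.castSucc) ∧ z ∈ B (Fin.last n) := by
      simp [Set.mem_pi, Fin.forall_fin_succ']
    by_cases h1 : x ∈ pi univ (fun i : Fin n => B i.castSucc)
    · by_cases h2 : z ∈ B (Fin.last n)
      · simp [-Set.mem_pi, Set.indicator, hiff, h1, h2]
      · simp [-Set.mem_pi, Set.indicator, hiff, h1, h2]
    · simp [-Set.mem_pi, Set.indicator, hiff, h1]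
  simp_rw [hg]
  by_cases hx : x ∈ pi univ (fun i : Fin n => B i.castSucc)
  swap; · simp [-Set.mem_pi, hx]
  simp only [Set.indicator_of_mem hx]
  congr 1
  -- Non-atomicity enters here: a draw from η a.s. misses the finitely many old values.
  · have hae : ∀ᵐ z ∂η, z ∉ values x := by
      rw [ae_iff]
      simpa using (values x).finite_toSet.measure_zero η
    rw [← lintegral_mul_const]
    · refine lintegral_congr_ae (hae.mono fun z hz => ?_)
      simp only
      rw [clusterProd_snoc_of_notMem f hz]
      ring
    · exact (measurable_one.indicator (hB _)).mul
        (measurable_tau ρ measurable_const measurable_id (by fun_prop))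
  · refine Finset.sum_congr rfl fun y hy => ?_
    rw [clusterProd, prod_values_snoc_of_mem (fun m y => tau ρ m y (f y)) hy, mul_assoc]

/-- The inductive step. The order-n identity holds for every f ≥ ε, hence along f + t 1_{B'}. Both
sides are Laplace transforms in t, and equating first moments differentiates the identity at t = 0.
-/
theorem lintegral_expNeg_mul_prod_mul_toCRM_of (hN : IsPoissonProcess N (η ⊗ₘ ρ) P)
    (hρ : ∫⁻ x, ∫⁻ y in Ioi 0, ENNReal.ofReal (min y 1) ∂(ρ x) ∂η < ∞)
    {n : ℕ} {B : Fin n → Set 𝕏} (hB : ∀ i, MeasurableSet (B i)) {ε : ℝ≥0} (hε : 0 < ε)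
    (hA : ∀ f : 𝕏 → ℝ≥0, Measurable f → (∀ x, ε ≤ f x) →
      ∫⁻ ω, expNeg (∫⁻ x, f x ∂(toCRM (N ω))) * ∏ i, toCRM (N ω) (B i) ∂P =
        expNeg (laplaceExp η ρ fun x => f x) *
          ∫⁻ x in pi univ B, clusterProd ρ f x ∂(refMeasure η n))
    {f : 𝕏 → ℝ≥0} (hfm : Measurable f) (hf : ∀ x, ε ≤ f x) {B' : Set 𝕏} (hB' : MeasurableSet B') :
    ∫⁻ ω, expNeg (∫⁻ x, f x ∂(toCRM (N ω))) * (∏ i, toCRM (N ω) (B i)) * toCRM (N ω) B' ∂P =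
      expNeg (laplaceExp η ρ fun x => f x) * ∫⁻ x in pi univ B,
        ((∫⁻ z, B'.indicator 1 z * tau ρ 1 z (f z) ∂η) * clusterProd ρ f x +
          clusterDeriv ρ f B' x) ∂(refMeasure η n) := by
  have hfpos : ∀ x, 0 < f x := fun x => hε.trans_le (hf x)
  have hfin := lintegral_expNeg_mul_prod_toCRM_ne_top (P := P) (N := N) hε hf B
  have hw : Measurable fun ω => expNeg (∫⁻ x, f x ∂(toCRM (N ω))) * ∏ i, toCRM (N ω) (B i) :=
    (measurable_expNeg.comp (measurable_lintegral_toCRM hN (by fun_prop))).mul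
      (Finset.measurable_prod _ fun i _ => measurable_apply_toCRM hN (hB i))
  have hL := IsLaplace.of_lintegral_mul P hw (measurable_apply_toCRM hN hB') hfin
  set m := (refMeasure η n).restrict (pi univ B) with hm
  set r : (Fin n → 𝕏) → ℝ≥0 → ℝ≥0∞ := fun x t =>
    expNeg (laplaceExp η ρ fun x => bump f B' t x) * clusterProd ρ (bump f B' t) x with hr
  have hrm : ∀ t, Measurable fun x => r x t := fun t =>
    (measurable_clusterProd ρ (measurable_bump hfm hB' t)).const_mul _
  have hLr : ∀ t : ℝ≥0, ∫⁻ ω, expNeg (∫⁻ x, f x ∂(toCRM (N ω))) * (∏ i, toCRM (N ω) (B i)) *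
      expNeg (t * toCRM (N ω) B') ∂P = ∫⁻ x, r x t ∂m := by
    intro t
    rw [lintegral_const_mul _ (measurable_clusterProd ρ (measurable_bump hfm hB' t)),
      ← hA _ (measurable_bump hfm hB' t) fun x => (hf x).trans (le_bump f B' t x)]
    refine lintegral_congr fun ω => ?_
    rw [lintegral_bump _ hfm hB', expNeg_add]
    ring
  simp_rw [hLr] at hL
  have hrL : ∀ᵐ x ∂m, IsLaplace (r x) (expNeg (laplaceExp η ρ fun x => f x) *
      ((∫⁻ z, B'.indicator 1 z * tau ρ 1 z (f z) ∂η) * clusterProd ρ f x +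
        clusterDeriv ρ f B' x)) := by
    filter_upwards [ae_restrict_of_ae
      (ae_refMeasure η (measurableSet_levySet ρ) (ae_mem_levySet hρ) n)] with x hx
    have h1 := isLaplace_expNeg_laplaceExp hN hfm hB'
    rw [lintegral_expNeg_mul_toCRM hN hρ hfm hε hf hB'] at h1
    have h2 := h1.mul (isLaplace_clusterProd ρ hfpos B' hx)
    simp only [bump_zero] at h2
    convert h2 using 1
    ring
  have hsm : ∀ k, Measurable fun x => slopeAt (r x) k := fun k =>
    ((hrm 0).sub (hrm _)).const_mul _
  -- Subtraction commutes with the integral because the subtracted integral is finite, being equal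
  -- to a weighted moment of the random measure.
  have hslope : ∀ k, slopeAt (fun t => ∫⁻ x, r x t ∂m) k = ∫⁻ x, slopeAt (r x) k ∂m := by
    intro k
    simp only [slopeAt]
    have hsub : Measurable fun x => r x 0 - r x (2⁻¹ ^ k) := (hrm _).sub (hrm _)
    rw [lintegral_const_mul _ hsub, lintegral_sub (hrm _)]
    · exact ne_top_of_le_ne_top hL.zero_ne_top (hL.apply_le _)
    · exact hrL.mono fun x hx => hx.apply_le _
  rw [← hL.iSup_slopeAt]
  simp_rw [hslope]
  rw [← lintegral_iSup' (fun k => (hsm k).aemeasurable)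
    (hrL.mono fun x hx => hx.monotone_slopeAt),
    lintegral_congr_ae (hrL.mono fun x hx => hx.iSup_slopeAt), lintegral_const_mul' _ _ (expNeg_ne_top _)]

variable [NullSingletonClass η]

/-- The moments of a completely random measure, tilted by `e^{-∫ f dμ}`. -/
theorem lintegral_expNeg_mul_prod_toCRM (hN : IsPoissonProcess N (η ⊗ₘ ρ) P)
    (hρ : ∫⁻ x, ∫⁻ y in Ioi 0, ENNReal.ofReal (min y 1) ∂(ρ x) ∂η < ∞)
    {ε : ℝ≥0} (hε : 0 < ε) {n : ℕ} {B : Fin n → Set 𝕏} (hB : ∀ i, MeasurableSet (B i))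
    (f : 𝕏 → ℝ≥0) (hfm : Measurable f) (hf : ∀ x, ε ≤ f x) :
    ∫⁻ ω, expNeg (∫⁻ x, f x ∂(toCRM (N ω))) * ∏ i, toCRM (N ω) (B i) ∂P =
      expNeg (laplaceExp η ρ fun x => f x) *
        ∫⁻ x in pi univ B, clusterProd ρ f x ∂(refMeasure η n) := by
  -- The induction hypothesis is needed for all perturbations of f, not just for f.
  induction n generalizing f with
  | zero =>
    simp only [Finset.univ_eq_empty, Finset.prod_empty, mul_one]
    rw [hN.laplace_toCRM (by fun_prop)]
    simp [refMeasure, clusterProd, values]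
  | succ n ih =>
    simp_rw [Fin.prod_univ_castSucc, ← mul_assoc]
    rw [lintegral_expNeg_mul_prod_mul_toCRM_of hN hρ (fun i => hB _) hε
      (fun f hfm hf => ih (fun i => hB _) f hfm hf) hfm hf (hB _),
      lintegral_clusterProd_refMeasure_succ hfm hB]

/-- The moments of order `n + 1` in terms of those of order `n`, with the weights of the urn. -/
theorem lintegral_expNeg_mul_prod_mul_toCRM (hN : IsPoissonProcess N (η ⊗ₘ ρ) P)
    (hρ : ∫⁻ x, ∫⁻ y in Ioi 0, ENNReal.ofReal (min y 1) ∂(ρ x) ∂η < ∞)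
    {ε : ℝ≥0} (hε : 0 < ε) {n : ℕ} {B : Fin n → Set 𝕏} (hB : ∀ i, MeasurableSet (B i))
    (f : 𝕏 → ℝ≥0) (hfm : Measurable f) (hf : ∀ x, ε ≤ f x) {B' : Set 𝕏} (hB' : MeasurableSet B') :
    ∫⁻ ω, expNeg (∫⁻ x, f x ∂(toCRM (N ω))) * (∏ i, toCRM (N ω) (B i)) * toCRM (N ω) B' ∂P =
      expNeg (laplaceExp η ρ fun x => f x) * ∫⁻ x in pi univ B,
        (∫⁻ z, B'.indicator 1 z * tau ρ 1 z (f z) ∂η + ∑ y ∈ values x, B'.indicator 1 y *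
          (tau ρ (mult x y + 1) y (f y) / tau ρ (mult x y) y (f y))) * clusterProd ρ f x
        ∂(refMeasure η n) := by
  rw [lintegral_expNeg_mul_prod_mul_toCRM_of hN hρ hB hε
    (fun f hfm hf => lintegral_expNeg_mul_prod_toCRM hN hρ hε hB f hfm hf) hfm hf hB']
  congr 1
  refine lintegral_congr_ae ?_
  filter_upwards [ae_restrict_of_ae
    (ae_refMeasure η (measurableSet_levySet ρ) (ae_mem_levySet hρ) n)] with x hx
  rw [clusterDeriv_eq (fun x => hε.trans_le (hf x)) B' hx, add_mul]

end Moments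

section TotalMass
variable {𝕏 : Type*} [MeasurableSpace 𝕏] {η : Measure 𝕏} {ρ : Kernel 𝕏 ℝ}

/-! ### The total mass is positive and finite -/

theorem one_sub_expNeg_mul_le {a s : ℝ} (ha : 0 ≤ a) (hs : 0 ≤ s) :
    1 - expNeg (ENNReal.ofReal a * ENNReal.ofReal s) ≤
      ENNReal.ofReal (max a 1) * ENNReal.ofReal (min s 1) := by
  rw [← ENNReal.ofReal_mul ha, ← ENNReal.ofReal_mul (by positivity)]
  rcases le_total s 1 with h | h
  · refine (one_sub_expNeg_le _).trans (ENNReal.ofReal_le_ofReal ?_)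
    rw [min_eq_left h]
    gcongr
    exact le_max_left _ _
  · refine tsub_le_self.trans ?_
    rw [min_eq_right h, mul_one, ← ENNReal.ofReal_one]
    exact ENNReal.ofReal_le_ofReal (le_max_right _ _)

theorem laplaceExp_const_ne_top
    (hρ : ∫⁻ x, ∫⁻ y in Ioi 0, ENNReal.ofReal (min y 1) ∂(ρ x) ∂η < ∞) {a : ℝ} (ha : 0 ≤ a) :
    laplaceExp η ρ (fun _ => ENNReal.ofReal a) ≠ ∞ := by
  refine ne_top_of_le_ne_top (ENNReal.mul_ne_top (a := ENNReal.ofReal (max a 1))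
    ENNReal.ofReal_ne_top hρ.ne) ?_
  rw [← lintegral_const_mul _ (measurable_lintegral_min ρ)]
  refine lintegral_mono fun x => ?_
  rw [← lintegral_const_mul _ (by fun_prop)]
  exact setLIntegral_mono' measurableSet_Ioi fun s hs => one_sub_expNeg_mul_le ha (le_of_lt hs)

theorem psi_zero_eq {b : ℝ} (hb : 0 ≤ b) :
    psi η ρ 0 b = laplaceExp η ρ (fun _ => ENNReal.ofReal b) := by
  refine lintegral_congr fun x => setLIntegral_congr_fun measurableSet_Ioi fun s hs => ?_
  have hs : 0 ≤ s := le_of_lt hs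
  simp only [neg_zero, zero_mul, Real.exp_zero, mul_one]
  rw [← ENNReal.ofReal_mul hb, expNeg_ofReal (by positivity),
    ENNReal.ofReal_sub _ (Real.exp_pos _).le, ENNReal.ofReal_one, neg_mul]

theorem tendsto_laplaceExp_const [IsSFiniteKernel ρ]
    (hρ : ∫⁻ x, ∫⁻ y in Ioi 0, ENNReal.ofReal (min y 1) ∂(ρ x) ∂η < ∞) :
    Tendsto (fun k : ℕ => laplaceExp η ρ fun _ => ((2⁻¹ ^ k : ℝ≥0) : ℝ≥0∞)) atTop (𝓝 0) := by
  have hle : ∀ (k : ℕ) (s : ℝ), 0 ≤ s → 1 - expNeg (((2⁻¹ ^ k : ℝ≥0) : ℝ≥0∞) * ENNReal.ofReal s) ≤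
      ENNReal.ofReal (min s 1) := by
    intro k s hs
    have h1 : (2⁻¹ ^ k : ℝ≥0) ≤ 1 := pow_le_one₀ (by simp) (by
      rw [← NNReal.coe_le_coe]; push_cast; norm_num)
    have h := one_sub_expNeg_mul_le (a := 1) zero_le_one hs
    rw [max_self, ENNReal.ofReal_one, one_mul, one_mul] at h
    refine le_trans (tsub_le_tsub_left (expNeg_antitone ?_) _) h
    exact mul_le_of_le_one_left' (by exact_mod_cast h1)
  have hm : ∀ k : ℕ, Measurable fun x => ∫⁻ s in Ioi 0,
      (1 - expNeg (((2⁻¹ ^ k : ℝ≥0) : ℝ≥0∞) * ENNReal.ofReal s)) ∂(ρ x) := by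
    intro k
    simp_rw [← lintegral_indicator measurableSet_Ioi]
    exact (Measure.measurable_lintegral
      (Measurable.indicator (by fun_prop) measurableSet_Ioi)).comp ρ.measurable
  rw [← lintegral_zero (α := 𝕏) (μ := η)]
  refine tendsto_lintegral_of_dominated_convergence _ hm
    (fun k => ae_of_all _ fun x => setLIntegral_mono' measurableSet_Ioi
      fun s hs => hle k s (le_of_lt hs)) hρ.ne ?_
  filter_upwards [ae_lt_top (measurable_lintegral_min ρ) hρ.ne] with x hx
  rw [← lintegral_zero (μ := (ρ x).restrict (Ioi 0))]
  refine tendsto_lintegral_of_dominated_convergence _ (fun k => by fun_prop)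
    (fun k => (ae_restrict_mem measurableSet_Ioi).mono fun s hs => hle k s (le_of_lt hs)) hx.ne
    (ae_of_all _ fun s => ?_)
  have h1 := (continuous_expNeg.tendsto 0).comp
    (tendsto_half_pow_mul (z := ENNReal.ofReal s) ENNReal.ofReal_ne_top)
  have h2 := ENNReal.Tendsto.sub (tendsto_const_nhds (x := (1 : ℝ≥0∞))) h1 (Or.inl ENNReal.one_ne_top)
  simpa using h2

variable [SFinite η] [IsSFiniteKernel ρ] {Ω : Type*} [MeasurableSpace Ω] {P : Measure Ω}
  [IsProbabilityMeasure P] {N : Ω → Measure (𝕏 × ℝ)}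

/-- As t → 0, e^{-tT} tends to the indicator of T < ∞, while the Laplace transform tends to 1. -/
theorem ae_toCRM_univ_ne_top (hN : IsPoissonProcess N (η ⊗ₘ ρ) P)
    (hρ : ∫⁻ x, ∫⁻ y in Ioi 0, ENNReal.ofReal (min y 1) ∂(ρ x) ∂η < ∞) :
    ∀ᵐ ω ∂P, toCRM (N ω) univ ≠ ∞ := by
  have hm := measurable_apply_toCRM hN MeasurableSet.univ
  have hS : MeasurableSet {ω | toCRM (N ω) univ ≠ ∞} := hm (measurableSet_singleton ∞).compl
  have h1 : Tendsto (fun k : ℕ => ∫⁻ ω, expNeg (((2⁻¹ ^ k : ℝ≥0) : ℝ≥0∞) * toCRM (N ω) univ) ∂P)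
      atTop (𝓝 (∫⁻ ω, {ω | toCRM (N ω) univ ≠ ∞}.indicator 1 ω ∂P)) := by
    refine tendsto_lintegral_of_dominated_convergence (fun _ => 1) (fun k => by fun_prop)
      (fun k => ae_of_all _ fun ω => expNeg_le_one _) (by simp) (ae_of_all _ fun ω => ?_)
    by_cases h : toCRM (N ω) univ = ∞
    · have : ω ∉ {ω | toCRM (N ω) univ ≠ ∞} := by simpa using h
      rw [Set.indicator_of_notMem this, h]
      refine tendsto_const_nhds.congr fun k => ?_
      rw [ENNReal.mul_top (by simp), expNeg_top]
    · have : ω ∈ {ω | toCRM (N ω) univ ≠ ∞} := h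
      rw [Set.indicator_of_mem this]
      simpa using! (continuous_expNeg.tendsto 0).comp (tendsto_half_pow_mul h)
  have h2 : ∀ k : ℕ, ∫⁻ ω, expNeg (((2⁻¹ ^ k : ℝ≥0) : ℝ≥0∞) * toCRM (N ω) univ) ∂P =
      expNeg (laplaceExp η ρ fun _ => ((2⁻¹ ^ k : ℝ≥0) : ℝ≥0∞)) := by
    intro k
    rw [← hN.laplace_toCRM measurable_const]
    simp
  simp_rw [h2] at h1
  have h3 := (continuous_expNeg.tendsto 0).comp (tendsto_laplaceExp_const hρ)
  have h4 := tendsto_nhds_unique h1 h3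
  rw [lintegral_indicator_one hS, expNeg_zero] at h4
  exact (prob_compl_eq_zero_iff hS).2 h4

/-- With f = ∞, the variable e^{-∞·T} is the indicator of T = 0, and the exponent is the total mass
of the intensity, which is infinite. -/
theorem ae_toCRM_univ_ne_zero (hN : IsPoissonProcess N (η ⊗ₘ ρ) P)
    (hρ_pos : ∀ x, ρ x (Iic 0) = 0) (hρ_inf : (η ⊗ₘ ρ) univ = ∞) :
    ∀ᵐ ω ∂P, toCRM (N ω) univ ≠ 0 := by
  have h := hN.laplace_toCRM (f := fun _ => ∞) measurable_const
  have h0 : laplaceExp η ρ (fun _ => ∞) = ∞ := by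
    refine Eq.trans ?_ hρ_inf
    rw [Measure.compProd_apply MeasurableSet.univ, laplaceExp]
    refine lintegral_congr fun x => ?_
    rw [setLIntegral_congr_fun (g := fun _ => 1) measurableSet_Ioi]
    · rw [preimage_univ, setLIntegral_one, ← Iic_union_Ioi (a := (0 : ℝ)),
        measure_union (Iic_disjoint_Ioi le_rfl) measurableSet_Ioi, hρ_pos, zero_add]
    · intro s hs
      have hs : 0 < s := hs
      simp [ENNReal.top_mul, hs]
  rw [h0, expNeg_top, lintegral_eq_zero_iff] at h
  · filter_upwards [h] with ω hω h1
    simp [h1] at hω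
  · exact measurable_expNeg.comp (measurable_lintegral_toCRM hN measurable_const)

end TotalMass

/-! ### Moments of the normalized tilted random measure -/

theorem measurable_gammaPDF_uncurry (a : ℝ) : Measurable fun p : ℝ × ℝ => gammaPDF a p.1 p.2 := by
  unfold gammaPDF gammaPDFReal
  refine ENNReal.measurable_ofReal.comp (Measurable.ite ?_ ?_ measurable_const)
  · exact measurableSet_Ici.preimage measurable_snd
  · fun_prop

theorem measurable_gammaMeasure_apply (a : ℝ) {C : Set ℝ} (hC : MeasurableSet C) :
    Measurable fun r => gammaMeasure a r C := by
  simp_rw [gammaMeasure, withDensity_apply _ hC]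
  exact (measurable_gammaPDF_uncurry a).lintegral_prod_right'

theorem gammaMeasure_apply (a r : ℝ) {C : Set ℝ} (hC : MeasurableSet C) :
    gammaMeasure a r C = ∫⁻ u in Ioi 0, C.indicator 1 u *
      ENNReal.ofReal (r ^ a / Real.Gamma a * u ^ (a - 1) * Real.exp (-(r * u))) := by
  rw [gammaMeasure, withDensity_apply _ hC, ← lintegral_indicator hC,
    ← lintegral_add_compl _ measurableSet_Ici (A := Ici (0 : ℝ)), compl_Ici,
    setLIntegral_congr_fun (g := fun _ => 0) measurableSet_Iio, lintegral_zero, add_zero,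
    setLIntegral_congr Ioi_ae_eq_Ici.symm]
  · refine setLIntegral_congr_fun measurableSet_Ioi fun u hu => ?_
    by_cases huC : u ∈ C
    · simp [huC, gammaPDF_of_nonneg (le_of_lt hu)]
    · simp [huC]
  · intro u hu
    by_cases huC : u ∈ C
    · simp [huC, gammaPDF_of_neg hu]
    · simp [huC]

section Joint
variable {𝕏 : Type*} [MeasurableSpace 𝕏]

theorem measurable_tilt (γ q : ℝ) : Measurable (tilt γ q) := by
  unfold tilt; fun_prop

theorem measurable_normalize_apply {B : Set 𝕏} (hB : MeasurableSet B) :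
    Measurable fun m : Measure 𝕏 => normalize m B := by
  simp only [normalize, Measure.smul_apply, smul_eq_mul]
  exact (Measure.measurable_coe MeasurableSet.univ).inv.mul (Measure.measurable_coe hB)

theorem measurable_expNeg_mul_prod_apply (c : ℝ≥0∞) {n : ℕ} {B : Fin n → Set 𝕏}
    (hB : ∀ i, MeasurableSet (B i)) :
    Measurable fun m : Measure 𝕏 => expNeg (c * m univ) * ∏ i, m (B i) :=
  (measurable_expNeg.comp ((Measure.measurable_coe MeasurableSet.univ).const_mul _)).mul
    (Finset.measurable_prod _ fun i _ => Measure.measurable_coe (hB i))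

/-- The gamma augmentation turns the normalization of the random measure into an exponential
weight. -/
theorem tilt_mul_prod_normalize_mul_gammaMeasure {γ q : ℝ} {n : ℕ} (ha : 0 < (n : ℝ) + q)
    (hγ : 0 ≤ γ) {m : Measure 𝕏} (h0 : m univ ≠ 0) (htop : m univ ≠ ∞) (B : Fin n → Set 𝕏)
    {C : Set ℝ} (hC : MeasurableSet C) :
    ENNReal.ofReal (tilt γ q (m univ).toReal) * ((∏ i, normalize m (B i)) *
        gammaMeasure (n + q) (m univ).toReal C) =
      ENNReal.ofReal (Real.Gamma (n + q))⁻¹ * ∫⁻ u in Ioi 0, C.indicator 1 u *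
        ENNReal.ofReal (u ^ ((n : ℝ) + q - 1)) *
          (expNeg (ENNReal.ofReal (γ + u) * m univ) * ∏ i, m (B i)) := by
  obtain ⟨T, hT⟩ : ∃ T : ℝ, T = (m univ).toReal := ⟨_, rfl⟩
  have hTpos : 0 < T := hT ▸ ENNReal.toReal_pos h0 htop
  have hmT : m univ = ENNReal.ofReal T := by rw [hT, ENNReal.ofReal_toReal htop]
  have hnorm : ∏ i, normalize m (B i) = ENNReal.ofReal (T ^ (-(n : ℝ))) * ∏ i, m (B i) := by
    simp only [normalize, Measure.smul_apply, smul_eq_mul, Finset.prod_mul_distrib]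
    rw [hmT, ← ENNReal.ofReal_inv_of_pos hTpos]
    congr 1
    rw [Finset.prod_const, Finset.card_univ, Fintype.card_fin,
      ← ENNReal.ofReal_pow (inv_nonneg.2 hTpos.le), Real.rpow_neg hTpos.le, Real.rpow_natCast,
      inv_pow]
  have hGm : Measurable fun u : ℝ => C.indicator (1 : ℝ → ℝ≥0∞) u := measurable_one.indicator hC
  rw [← hT, hnorm, gammaMeasure_apply _ _ hC, hmT, ← mul_assoc,
    ← lintegral_const_mul _ (by fun_prop), ← lintegral_const_mul _ (by fun_prop)]
  refine setLIntegral_congr_fun measurableSet_Ioi fun u hu => ?_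
  have hu : 0 < u := hu
  have hΓ := Real.Gamma_pos_of_pos ha
  have key : ENNReal.ofReal (tilt γ q T) * ENNReal.ofReal (T ^ (-(n : ℝ))) * ENNReal.ofReal
      (T ^ ((n : ℝ) + q) / Real.Gamma (n + q) * u ^ ((n : ℝ) + q - 1) * Real.exp (-(T * u))) =
      ENNReal.ofReal (Real.Gamma (n + q))⁻¹ * ENNReal.ofReal (u ^ ((n : ℝ) + q - 1)) *
        expNeg (ENNReal.ofReal (γ + u) * ENNReal.ofReal T) := by
    have ht : 0 ≤ tilt γ q T := by unfold tilt; positivity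
    rw [← ENNReal.ofReal_mul (p := γ + u) (by positivity), expNeg_ofReal (by positivity),
      ← ENNReal.ofReal_mul ht, ← ENNReal.ofReal_mul (by positivity),
      ← ENNReal.ofReal_mul (by positivity), ← ENNReal.ofReal_mul (by positivity)]
    congr 1
    -- The three powers come from the tilt, the n normalizations and the gamma density.
    have h1 : T ^ (-q) * T ^ (-(n : ℝ)) * T ^ ((n : ℝ) + q) = 1 := by
      rw [← Real.rpow_add hTpos, ← Real.rpow_add hTpos]
      ring_nf
      exact Real.rpow_zero T
    have h2 : Real.exp (-((γ + u) * T)) = Real.exp (-γ * T) * Real.exp (-(T * u)) := by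
      rw [← Real.exp_add]; ring_nf
    rw [tilt, h2]
    linear_combination (Real.exp (-γ * T) * Real.exp (-(T * u)) * (Real.Gamma (n + q))⁻¹ *
      u ^ ((n : ℝ) + q - 1)) * h1
  calc _ = (C.indicator 1 u * ∏ i, m (B i)) * (ENNReal.ofReal (tilt γ q T) *
        ENNReal.ofReal (T ^ (-(n : ℝ))) * ENNReal.ofReal (T ^ ((n : ℝ) + q) / Real.Gamma (n + q) *
          u ^ ((n : ℝ) + q - 1) * Real.exp (-(T * u)))) := by ring
    _ = _ := by rw [key]; ring

variable {Q : Measure (Measure 𝕏)} {Ω : Type*} [MeasurableSpace Ω] {P : Measure Ω}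
  {μt : Ω → Measure 𝕏} {γ q : ℝ}

theorem lintegral_of_hasLaw_tiltedLaw (h : HasLaw μt (tiltedLaw Q γ q) P)
    {G : Measure 𝕏 → ℝ≥0∞} (hG : Measurable G) :
    ∫⁻ ω, G (μt ω) ∂P = (tiltConst Q γ q)⁻¹ *
      ∫⁻ m, ENNReal.ofReal (tilt γ q (m univ).toReal) * G m ∂Q := by
  have ht : Measurable fun m : Measure 𝕏 => ENNReal.ofReal (tilt γ q (m univ).toReal) :=
    ENNReal.measurable_ofReal.comp ((measurable_tilt γ q).comp
      (Measure.measurable_coe MeasurableSet.univ).ennreal_toReal)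
  rw [h.lintegral_comp hG.aemeasurable, tiltedLaw, lintegral_smul_measure, smul_eq_mul,
    lintegral_withDensity_eq_lintegral_mul _ ht hG]
  rfl

/-- The normalization constant of the joint law of the first `n` observations and of the augmenting
variable. -/
noncomputable def augConst (Q : Measure (Measure 𝕏)) (γ q : ℝ) (n : ℕ) : ℝ≥0∞ :=
  (tiltConst Q γ q)⁻¹ * ENNReal.ofReal (Real.Gamma (n + q))⁻¹

theorem lintegral_prod_normalize_mul_gammaMeasure [SFinite Q]
    (hQ0 : ∀ᵐ m ∂Q, m univ ≠ 0) (hQtop : ∀ᵐ m ∂Q, m univ ≠ ∞)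
    (h : HasLaw μt (tiltedLaw Q γ q) P) {n : ℕ} (ha : 0 < (n : ℝ) + q) (hγ : 0 ≤ γ)
    {B : Fin n → Set 𝕏} (hB : ∀ i, MeasurableSet (B i)) {C : Set ℝ} (hC : MeasurableSet C) :
    ∫⁻ ω, (∏ i, normalize (μt ω) (B i)) * gammaMeasure (n + q) (μt ω univ).toReal C ∂P =
      augConst Q γ q n * ∫⁻ u in Ioi 0, C.indicator 1 u * (ENNReal.ofReal (u ^ ((n : ℝ) + q - 1)) *
        ∫⁻ m, expNeg (ENNReal.ofReal (γ + u) * m univ) * ∏ i, m (B i) ∂Q) := by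
  have hprod : Measurable fun m : Measure 𝕏 => ∏ i, m (B i) :=
    Finset.measurable_prod _ fun i _ => Measure.measurable_coe (hB i)
  have huniv : Measurable fun m : Measure 𝕏 => m univ := Measure.measurable_coe MeasurableSet.univ
  have hCm : Measurable fun u : ℝ => C.indicator (1 : ℝ → ℝ≥0∞) u := measurable_one.indicator hC
  have hG : Measurable fun m : Measure 𝕏 =>
      (∏ i, normalize m (B i)) * gammaMeasure (n + q) (m univ).toReal C :=
    (Finset.measurable_prod _ fun i _ => measurable_normalize_apply (hB i)).mul
      ((measurable_gammaMeasure_apply _ hC).comp huniv.ennreal_toReal)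
  rw [lintegral_of_hasLaw_tiltedLaw h hG, augConst, mul_assoc]
  congr 1
  have hJ : Measurable fun p : Measure 𝕏 × ℝ => C.indicator 1 p.2 *
      ENNReal.ofReal (p.2 ^ ((n : ℝ) + q - 1)) *
        (expNeg (ENNReal.ofReal (γ + p.2) * p.1 univ) * ∏ i, p.1 (B i)) := by
    have h1 : Measurable fun p : Measure 𝕏 × ℝ => ∏ i, p.1 (B i) := hprod.comp measurable_fst
    have h2 : Measurable fun p : Measure 𝕏 × ℝ => p.1 univ := huniv.comp measurable_fst
    fun_prop
  have hae : ∀ᵐ m ∂Q, ENNReal.ofReal (tilt γ q (m univ).toReal) *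
      ((∏ i, normalize m (B i)) * gammaMeasure (n + q) (m univ).toReal C) =
      ENNReal.ofReal (Real.Gamma (n + q))⁻¹ * ∫⁻ u in Ioi 0, C.indicator 1 u *
        ENNReal.ofReal (u ^ ((n : ℝ) + q - 1)) *
          (expNeg (ENNReal.ofReal (γ + u) * m univ) * ∏ i, m (B i)) := by
    filter_upwards [hQ0, hQtop] with m h0 htop
    exact tilt_mul_prod_normalize_mul_gammaMeasure ha hγ h0 htop B hC
  rw [lintegral_congr_ae hae, lintegral_const_mul _ hJ.lintegral_prod_right',
    lintegral_lintegral_swap hJ.aemeasurable]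
  congr 1
  refine lintegral_congr fun u => ?_
  simp only
  rw [lintegral_const_mul _ (measurable_expNeg_mul_prod_apply _ hB), mul_assoc]

end Joint

/-! ### Weighted moments of the law of the random measure in terms of `unnormDensityU` -/

section Laws
variable {𝕏 : Type*} [MeasurableSpace 𝕏] {η : Measure 𝕏} {ρ : Kernel 𝕏 ℝ} {Ω₀ : Type*}
  [MeasurableSpace Ω₀] {P₀ : Measure Ω₀} {N : Ω₀ → Measure (𝕏 × ℝ)} {γ q : ℝ}

theorem lintegral_map_toCRM (hN : IsPoissonProcess N (η ⊗ₘ ρ) P₀) {n : ℕ} {B : Fin n → Set 𝕏}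
    (hB : ∀ i, MeasurableSet (B i)) (a : ℝ) :
    ∫⁻ m, expNeg (ENNReal.ofReal a * m univ) * ∏ i, m (B i) ∂(P₀.map fun ω => toCRM (N ω)) =
      ∫⁻ ω, expNeg (∫⁻ _, ((a.toNNReal : ℝ≥0) : ℝ≥0∞) ∂(toCRM (N ω))) *
        ∏ i, toCRM (N ω) (B i) ∂P₀ := by
  have hm : Measurable fun ω => toCRM (N ω) := measurable_toCRM.comp hN.measurable
  rw [lintegral_map (measurable_expNeg_mul_prod_apply _ hB) hm]
  simp [ENNReal.ofReal]

theorem mul_clusterProd_eq_unnormDensityU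
    (hρ : ∫⁻ x, ∫⁻ y in Ioi 0, ENNReal.ofReal (min y 1) ∂(ρ x) ∂η < ∞) (hγ : 0 ≤ γ)
    {n : ℕ} (x : Fin n → 𝕏) {u : ℝ} (hu : 0 < u) :
    ENNReal.ofReal (u ^ ((n : ℝ) + q - 1)) * (expNeg (laplaceExp η ρ fun _ => (γ + u).toNNReal) *
      clusterProd ρ (fun _ => (γ + u).toNNReal) x) = unnormDensityU η ρ γ q x u := by
  have h0 : 0 ≤ γ + u := by positivity
  -- Finiteness of the exponent makes the `toReal` inside `unnormDensityU` harmless.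
  have hL := laplaceExp_const_ne_top hρ h0
  rw [unnormDensityU, psi_zero_eq h0, ← expNeg_of_ne_top hL, clusterProd]
  simp only [Real.coe_toNNReal _ h0]
  rw [mul_comm]
  rfl

variable [MeasurableEq 𝕏] [IsProbabilityMeasure η] [NullSingletonClass η] [IsSFiniteKernel ρ]
  [IsProbabilityMeasure P₀]

theorem moment_eq_unnormDensityU (hN : IsPoissonProcess N (η ⊗ₘ ρ) P₀)
    (hρ : ∫⁻ x, ∫⁻ y in Ioi 0, ENNReal.ofReal (min y 1) ∂(ρ x) ∂η < ∞) (hγ : 0 ≤ γ)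
    {n : ℕ} {B : Fin n → Set 𝕏} (hB : ∀ i, MeasurableSet (B i)) {u : ℝ} (hu : 0 < u) :
    ENNReal.ofReal (u ^ ((n : ℝ) + q - 1)) * ∫⁻ m, expNeg (ENNReal.ofReal (γ + u) * m univ) *
        ∏ i, m (B i) ∂(P₀.map fun ω => toCRM (N ω)) =
      ∫⁻ x in pi univ B, unnormDensityU η ρ γ q x u ∂(refMeasure η n) := by
  have hpos : 0 < (γ + u).toNNReal := Real.toNNReal_pos.2 (by positivity)
  rw [lintegral_map_toCRM hN hB, lintegral_expNeg_mul_prod_toCRM hN hρ hpos hB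
    (fun _ => (γ + u).toNNReal) measurable_const fun _ => le_rfl,
    ← lintegral_const_mul _ (measurable_clusterProd ρ measurable_const),
    ← lintegral_const_mul' _ _ ENNReal.ofReal_ne_top]
  exact lintegral_congr fun x => mul_clusterProd_eq_unnormDensityU hρ hγ x hu

theorem moment_succ_eq_unnormDensityU (hN : IsPoissonProcess N (η ⊗ₘ ρ) P₀)
    (hρ : ∫⁻ x, ∫⁻ y in Ioi 0, ENNReal.ofReal (min y 1) ∂(ρ x) ∂η < ∞) (hγ : 0 ≤ γ)
    {n : ℕ} {B : Fin (n + 1) → Set 𝕏} (hB : ∀ i, MeasurableSet (B i)) {u : ℝ} (hu : 0 < u) :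
    ENNReal.ofReal (u ^ (((n + 1 : ℕ) : ℝ) + q - 1)) *
      ∫⁻ m, expNeg (ENNReal.ofReal (γ + u) * m univ) *
        ∏ i, m (B i) ∂(P₀.map fun ω => toCRM (N ω)) =
      ∫⁻ x in pi univ fun i : Fin n => B i.castSucc,
        (∫⁻ z, condWeightNew ρ γ u z * (B (Fin.last n)).indicator 1 z ∂η +
          ∑ y ∈ values x, condWeightOld ρ γ x u y * (B (Fin.last n)).indicator 1 y) *
        unnormDensityU η ρ γ q x u ∂(refMeasure η n) := by
  have h0 : 0 ≤ γ + u := by positivity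
  have hpos : 0 < (γ + u).toNNReal := Real.toNNReal_pos.2 (by positivity)
  rw [lintegral_map_toCRM hN hB]
  simp_rw [Fin.prod_univ_castSucc, ← mul_assoc]
  rw [lintegral_expNeg_mul_prod_mul_toCRM hN hρ hpos (fun i => hB _)
    (fun _ => (γ + u).toNNReal) measurable_const (fun _ => le_rfl) (hB _),
    ← lintegral_const_mul' _ _ (expNeg_ne_top _), ← lintegral_const_mul' _ _ ENNReal.ofReal_ne_top]
  refine lintegral_congr fun x => ?_
  rw [← mul_clusterProd_eq_unnormDensityU hρ hγ x hu]
  -- The extra power of u is the factor u in the urn weights.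
  have hpow : u ^ (((n + 1 : ℕ) : ℝ) + q - 1) = u * u ^ ((n : ℝ) + q - 1) := by
    rw [← Real.rpow_one u, ← Real.rpow_mul hu.le, ← Real.rpow_mul hu.le, ← Real.rpow_add hu]
    push_cast
    ring_nf
  rw [hpow, ENNReal.ofReal_mul hu.le]
  simp only [condWeightNew, condWeightOld, Real.coe_toNNReal _ h0]
  simp_rw [mul_assoc (ENNReal.ofReal u)]
  rw [lintegral_const_mul' _ _ ENNReal.ofReal_ne_top, ← Finset.mul_sum, ← mul_add]
  simp_rw [mul_comm _ (Set.indicator _ _ _)]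
  ring

end Laws

/-! ### Measurability of the urn weights, and the kernels they define -/

/-- Normalizing the weights of a mixture. -/
theorem lintegral_mixture_div {𝕏 : Type*} [MeasurableSpace 𝕏] (η : Measure 𝕏) {n : ℕ} (x : Fin n → 𝕏) {a : 𝕏 → ℝ≥0∞} (b : 𝕏 → ℝ≥0∞) (c : ℝ≥0∞)
    (ha : Measurable a) {g : 𝕏 → ℝ≥0∞} (hg : Measurable g) :
    ∫⁻ z, g z ∂(mixture η x (fun z => a z / c) (fun y => b y / c)) =
      (∫⁻ z, a z * g z ∂η + ∑ y ∈ values x, b y * g y) * c⁻¹ := by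
  rw [lintegral_mixture _ _ _ (ha.div_const c) hg, add_mul, Finset.sum_mul,
    ← lintegral_mul_const _ (by fun_prop)]
  congr 1
  · exact lintegral_congr fun z => by rw [div_eq_mul_inv]; ring
  · exact Finset.sum_congr rfl fun y _ => by rw [div_eq_mul_inv]; ring

section UrnKernels
variable {𝕏 : Type*} [MeasurableSpace 𝕏] (η : Measure 𝕏) (ρ : Kernel 𝕏 ℝ) (γ q : ℝ)
  {n : ℕ} [IsSFiniteKernel ρ]

theorem measurable_condWeightNew : Measurable fun p : ℝ × 𝕏 => condWeightNew ρ γ p.1 p.2 := by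
  unfold condWeightNew
  exact (by fun_prop : Measurable fun p : ℝ × 𝕏 => ENNReal.ofReal p.1).mul
    (measurable_tau ρ measurable_const (by fun_prop) (by fun_prop))

theorem lintegral_condUrn (x : Fin n → 𝕏) (u : ℝ) {g : 𝕏 → ℝ≥0∞} (hg : Measurable g) :
    ∫⁻ z, g z ∂(condUrn η ρ γ x u) =
      (∫⁻ z, condWeightNew ρ γ u z * g z ∂η + ∑ y ∈ values x, condWeightOld ρ γ x u y * g y) *
        (condTotal η ρ γ u x)⁻¹ :=
  lintegral_mixture_div η x _ _ ((measurable_condWeightNew ρ γ).of_uncurry_left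
    (f := fun u z => condWeightNew ρ γ u z)) hg

variable [SFinite η]

theorem measurable_psi_zero : Measurable (psi η ρ 0) := by
  have h : Measurable fun p : ℝ × 𝕏 => ∫⁻ s in Ioi 0,
      ENNReal.ofReal ((1 - Real.exp (-p.1 * s)) * Real.exp (-0 * s)) ∂(ρ p.2) := by
    simp_rw [← lintegral_indicator measurableSet_Ioi]
    refine Measurable.lintegral_kernel_prod_right'
      (κ := ρ.comap Prod.snd measurable_snd) (f := fun p : (ℝ × 𝕏) × ℝ =>
        (Ioi 0).indicator (fun s => ENNReal.ofReal ((1 - Real.exp (-p.1.1 * s)) *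
          Real.exp (-0 * s))) p.2) ?_
    exact Measurable.ite (measurableSet_Ioi.preimage measurable_snd) (by fun_prop) measurable_const
  exact h.lintegral_prod_right'

variable [MeasurableEq 𝕏]

theorem measurable_unnormDensityU :
    Measurable fun p : (Fin n → 𝕏) × ℝ => unnormDensityU η ρ γ q p.1 p.2 := by
  have h1 : Measurable fun p : (Fin n → 𝕏) × ℝ => psi η ρ 0 (γ + p.2) :=
    (measurable_psi_zero η ρ).comp (by fun_prop)
  have h2 : Measurable fun p : (Fin n → 𝕏) × ℝ =>
      ∏ y ∈ values p.1, tau ρ (mult p.1 y) y (γ + p.2) :=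
    measurable_prod_values measurable_fst fun i => measurable_tau ρ
      (measurable_mult measurable_fst (by fun_prop)) (by fun_prop) (by fun_prop)
  unfold unnormDensityU
  fun_prop

theorem measurable_lintegral_unnormDensityU :
    Measurable fun x : Fin n → 𝕏 => ∫⁻ v in Ioi 0, unnormDensityU η ρ γ q x v :=
  (measurable_unnormDensityU η ρ γ q).lintegral_prod_right'

theorem measurable_densityU :
    Measurable fun p : (Fin n → 𝕏) × ℝ => densityU η ρ γ q p.1 p.2 :=
  (measurable_unnormDensityU η ρ γ q).div
    ((measurable_lintegral_unnormDensityU η ρ γ q).comp measurable_fst)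

theorem measurable_condWeightOld (i : Fin n) :
    Measurable fun p : (Fin n → 𝕏) × ℝ => condWeightOld ρ γ p.1 p.2 (p.1 i) := by
  have hm : Measurable fun p : (Fin n → 𝕏) × ℝ => mult p.1 (p.1 i) :=
    measurable_mult measurable_fst (by fun_prop)
  unfold condWeightOld
  exact (by fun_prop : Measurable fun p : (Fin n → 𝕏) × ℝ => ENNReal.ofReal p.2).mul
    ((measurable_tau ρ (hm.add_const 1) (by fun_prop) (by fun_prop)).div
      (measurable_tau ρ hm (by fun_prop) (by fun_prop)))

theorem measurable_condTotal :
    Measurable fun p : (Fin n → 𝕏) × ℝ => condTotal η ρ γ p.2 p.1 := by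
  refine Measurable.add ?_ (measurable_sum_values measurable_fst fun i =>
    measurable_condWeightOld ρ γ i)
  have h := (measurable_condWeightNew ρ γ).lintegral_prod_right' (ν := η)
  exact h.comp measurable_snd

theorem measurable_densityU_right (x : Fin n → 𝕏) : Measurable (densityU η ρ γ q x) :=
  (measurable_densityU η ρ γ q).of_uncurry_left (f := fun x u => densityU η ρ γ q x u)

theorem measurable_weightNew :
    Measurable fun p : (Fin n → 𝕏) × 𝕏 => weightNew η ρ γ q p.1 p.2 := by
  refine Measurable.lintegral_prod_right' (f := fun p : ((Fin n → 𝕏) × 𝕏) × ℝ =>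
    condWeightNew ρ γ p.2 p.1.2 * densityU η ρ γ q p.1.1 p.2) ?_
  have hW : Measurable fun p : ((Fin n → 𝕏) × 𝕏) × ℝ => condWeightNew ρ γ p.2 p.1.2 :=
    (measurable_condWeightNew ρ γ).comp (g := fun p : ℝ × 𝕏 => condWeightNew ρ γ p.1 p.2)
      (f := fun p : ((Fin n → 𝕏) × 𝕏) × ℝ => (p.2, p.1.2)) (by fun_prop)
  have hd : Measurable fun p : ((Fin n → 𝕏) × 𝕏) × ℝ => densityU η ρ γ q p.1.1 p.2 :=
    (measurable_densityU η ρ γ q).comp (g := fun p : (Fin n → 𝕏) × ℝ => densityU η ρ γ q p.1 p.2)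
      (f := fun p : ((Fin n → 𝕏) × 𝕏) × ℝ => (p.1.1, p.2)) (by fun_prop)
  exact hW.mul hd

theorem measurable_weightOld (i : Fin n) :
    Measurable fun x : Fin n → 𝕏 => weightOld η ρ γ q x (x i) :=
  Measurable.lintegral_prod_right' (f := fun p : (Fin n → 𝕏) × ℝ =>
    condWeightOld ρ γ p.1 p.2 (p.1 i) * densityU η ρ γ q p.1 p.2)
    ((measurable_condWeightOld ρ γ i).mul (measurable_densityU η ρ γ q))

theorem measurable_total : Measurable fun x : Fin n → 𝕏 => total η ρ γ q x :=
  (measurable_weightNew η ρ γ q).lintegral_prod_right'.add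
    (measurable_sum_values measurable_id fun i => measurable_weightOld η ρ γ q i)

/-- Averaging the conditional weights against the density of the augmenting variable gives the
unconditional weights. -/
theorem lintegral_condWeights_mul_densityU (x : Fin n → 𝕏) {g : 𝕏 → ℝ≥0∞} (hg : Measurable g) :
    ∫⁻ u in Ioi 0, (∫⁻ z, condWeightNew ρ γ u z * g z ∂η +
        ∑ y ∈ values x, condWeightOld ρ γ x u y * g y) * densityU η ρ γ q x u =
      ∫⁻ z, weightNew η ρ γ q x z * g z ∂η + ∑ y ∈ values x, weightOld η ρ γ q x y * g y := by
  have hd := measurable_densityU_right η ρ γ q x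
  have hN : Measurable fun p : ℝ × 𝕏 => condWeightNew ρ γ p.1 p.2 * g p.2 :=
    (measurable_condWeightNew ρ γ).mul (by fun_prop)
  have hN1 : Measurable fun u => ∫⁻ z, condWeightNew ρ γ u z * g z ∂η := hN.lintegral_prod_right'
  have hO : ∀ y ∈ values x, Measurable fun u => condWeightOld ρ γ x u y := by
    intro y hy
    obtain ⟨i, rfl⟩ := mem_values.1 hy
    exact (measurable_condWeightOld ρ γ i).comp
      (g := fun p : (Fin n → 𝕏) × ℝ => condWeightOld ρ γ p.1 p.2 (p.1 i))
      (f := fun u => (x, u)) (by fun_prop)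
  have hNz : ∀ z, Measurable fun u => condWeightNew ρ γ u z := fun z =>
    (measurable_condWeightNew ρ γ).of_uncurry_right (f := fun u z => condWeightNew ρ γ u z)
  simp_rw [add_mul, Finset.sum_mul]
  have hN2 : Measurable fun u =>
      (∫⁻ z, condWeightNew ρ γ u z * g z ∂η) * densityU η ρ γ q x u := hN1.mul hd
  rw [lintegral_add_left hN2, lintegral_finsetSum']
  swap; · exact fun y hy => (((hO y hy).mul_const _).mul hd).aemeasurable
  congr 1
  · have hNu : ∀ u, Measurable fun z => condWeightNew ρ γ u z * g z := fun u =>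
      hN.of_uncurry_left (f := fun u z => condWeightNew ρ γ u z * g z)
    simp_rw [← lintegral_mul_const _ (hNu _)]
    rw [lintegral_lintegral_swap (hN.mul (hd.comp measurable_fst)).aemeasurable]
    refine lintegral_congr fun z => ?_
    have hz : Measurable fun u => ENNReal.ofReal u * tau ρ 1 z (γ + u) * densityU η ρ γ q x u :=
      (hNz z).mul hd
    rw [weightNew, ← lintegral_mul_const _ hz]
    refine lintegral_congr fun u => ?_
    rw [condWeightNew]
    ring
  · refine Finset.sum_congr rfl fun y hy => ?_
    have hy : Measurable fun u => ENNReal.ofReal u *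
        (tau ρ (mult x y + 1) y (γ + u) / tau ρ (mult x y) y (γ + u)) * densityU η ρ γ q x u :=
      (hO y hy).mul hd
    rw [weightOld, ← lintegral_mul_const _ hy]
    refine lintegral_congr fun u => ?_
    rw [condWeightOld]
    ring

theorem lintegral_condTotal_mul_densityU (x : Fin n → 𝕏) :
    ∫⁻ u in Ioi 0, condTotal η ρ γ u x * densityU η ρ γ q x u = total η ρ γ q x := by
  have := lintegral_condWeights_mul_densityU η ρ γ q x (g := fun _ => 1) measurable_const
  simpa using! this

theorem measurable_densityUTilde :
    Measurable fun p : (Fin n → 𝕏) × ℝ => densityUTilde η ρ γ q p.1 p.2 := by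
  unfold densityUTilde
  simp_rw [lintegral_condTotal_mul_densityU]
  exact ((measurable_condTotal η ρ γ).div ((measurable_total η ρ γ q).comp measurable_fst)).mul
    (measurable_densityU η ρ γ q)

/-- The conditional law of `U` given the observations, as a kernel. -/
noncomputable def kernelU (n : ℕ) : Kernel (Fin n → 𝕏) ℝ :=
  (Kernel.const _ (volume.restrict (Ioi 0))).withDensity (densityU η ρ γ q)

theorem kernelU_apply (x : Fin n → 𝕏) :
    kernelU η ρ γ q n x = (volume.restrict (Ioi 0)).withDensity (densityU η ρ γ q x) := by
  rw [kernelU, Kernel.withDensity_apply _ (measurable_densityU η ρ γ q), Kernel.const_apply]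

/-- c/c ≤ 1 for every c in [0, ∞], so the mass is at most 1 even where the normalizing constant is 0
or ∞. The same bound serves for the other kernels below. -/
instance : IsFiniteKernel (kernelU η ρ γ q n) := by
  refine ⟨⟨1, ENNReal.one_lt_top, fun x => ?_⟩⟩
  have hu : Measurable (unnormDensityU η ρ γ q x) :=
    (measurable_unnormDensityU η ρ γ q).of_uncurry_left
      (f := fun x u => unnormDensityU η ρ γ q x u)
  rw [kernelU_apply, withDensity_apply _ MeasurableSet.univ, Measure.restrict_univ]
  simp only [densityU, div_eq_mul_inv]
  rw [lintegral_mul_const _ hu, ← div_eq_mul_inv]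
  exact ENNReal.div_self_le_one

/-- The conditional law of the tilted augmenting variable given the observations, as a kernel. -/
noncomputable def kernelUTilde (n : ℕ) : Kernel (Fin n → 𝕏) ℝ :=
  (Kernel.const _ (volume.restrict (Ioi 0))).withDensity (densityUTilde η ρ γ q)

theorem kernelUTilde_apply (x : Fin n → 𝕏) :
    kernelUTilde η ρ γ q n x =
      (volume.restrict (Ioi 0)).withDensity (densityUTilde η ρ γ q x) := by
  rw [kernelUTilde, Kernel.withDensity_apply _ (measurable_densityUTilde η ρ γ q),
    Kernel.const_apply]

theorem densityUTilde_eq (x : Fin n → 𝕏) (u : ℝ) : densityUTilde η ρ γ q x u =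
    condTotal η ρ γ u x * densityU η ρ γ q x u * (total η ρ γ q x)⁻¹ := by
  rw [densityUTilde, lintegral_condTotal_mul_densityU, div_eq_mul_inv]
  ring

instance : IsFiniteKernel (kernelUTilde η ρ γ q n) := by
  refine ⟨⟨1, ENNReal.one_lt_top, fun x => ?_⟩⟩
  have h : Measurable fun u => condTotal η ρ γ u x * densityU η ρ γ q x u :=
    ((measurable_condTotal η ρ γ).mul (measurable_densityU η ρ γ q)).of_uncurry_left
      (f := fun x u => condTotal η ρ γ u x * densityU η ρ γ q x u)
  rw [kernelUTilde_apply, withDensity_apply _ MeasurableSet.univ, Measure.restrict_univ]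
  simp only [densityUTilde_eq]
  rw [lintegral_mul_const _ h, lintegral_condTotal_mul_densityU, ← div_eq_mul_inv]
  exact ENNReal.div_self_le_one

/-- The unconditional urn, as a kernel. -/
noncomputable def urnKernel (n : ℕ) : Kernel (Fin n → 𝕏) 𝕏 :=
  ⟨fun x => urn η ρ γ q x, measurable_mixture η measurable_id
    ((measurable_weightNew η ρ γ q).div ((measurable_total η ρ γ q).comp measurable_fst))
    fun i => (measurable_weightOld η ρ γ q i).div (measurable_total η ρ γ q)⟩

theorem lintegral_urn (x : Fin n → 𝕏) {g : 𝕏 → ℝ≥0∞} (hg : Measurable g) :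
    ∫⁻ z, g z ∂(urn η ρ γ q x) =
      (∫⁻ z, weightNew η ρ γ q x z * g z ∂η + ∑ y ∈ values x, weightOld η ρ γ q x y * g y) *
        (total η ρ γ q x)⁻¹ :=
  lintegral_mixture_div η x _ _ ((measurable_weightNew η ρ γ q).of_uncurry_left
    (f := fun x z => weightNew η ρ γ q x z)) hg

instance : IsFiniteKernel (urnKernel η ρ γ q n) := by
  refine ⟨⟨1, ENNReal.one_lt_top, fun x => ?_⟩⟩
  have h := lintegral_urn η ρ γ q x (g := fun _ => 1) measurable_const
  simp only [lintegral_const, one_mul, mul_one] at h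
  change urn η ρ γ q x univ ≤ 1
  rw [h, ← div_eq_mul_inv]
  exact ENNReal.div_self_le_one

/-- The conditional urn, as a kernel. -/
noncomputable def condUrnKernel (n : ℕ) : Kernel ((Fin n → 𝕏) × ℝ) 𝕏 :=
  ⟨fun p => condUrn η ρ γ p.1 p.2, measurable_mixture η measurable_fst
    (((measurable_condWeightNew ρ γ).comp (g := fun p : ℝ × 𝕏 => condWeightNew ρ γ p.1 p.2)
      (f := fun p : ((Fin n → 𝕏) × ℝ) × 𝕏 => (p.1.2, p.2)) (by fun_prop)).div
        ((measurable_condTotal η ρ γ).comp measurable_fst))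
    fun i => (measurable_condWeightOld ρ γ i).div (measurable_condTotal η ρ γ)⟩

instance : IsFiniteKernel (condUrnKernel η ρ γ n) := by
  refine ⟨⟨1, ENNReal.one_lt_top, fun p => ?_⟩⟩
  have h := lintegral_condUrn η ρ γ p.1 p.2 (g := fun _ => 1) measurable_const
  simp only [lintegral_const, one_mul, mul_one] at h
  change condUrn η ρ γ p.1 p.2 univ ≤ 1
  rw [h, ← div_eq_mul_inv]
  exact ENNReal.div_self_le_one

end UrnKernels

/-! ### Joint laws of the observations and of the augmenting variable -/

theorem ext_of_pi {𝕏 : Type*} [MeasurableSpace 𝕏] {n : ℕ} {μ ν : Measure (Fin n → 𝕏)}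
    [IsFiniteMeasure μ]
    (h : ∀ B : Fin n → Set 𝕏, (∀ i, MeasurableSet (B i)) → μ (pi univ B) = ν (pi univ B)) :
    μ = ν := by
  refine ext_of_generate_finite _ generateFrom_pi.symm isPiSystem_pi ?_ ?_
  · rintro _ ⟨B, hB, rfl⟩
    exact h B fun i => hB i (mem_univ i)
  · simpa using h (fun _ => univ) fun _ => MeasurableSet.univ

theorem ext_of_pi_prod {𝕏 E : Type*} [MeasurableSpace 𝕏] [MeasurableSpace E] {n : ℕ}
    {μ ν : Measure ((Fin n → 𝕏) × E)} [IsFiniteMeasure μ]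
    (h : ∀ (B : Fin n → Set 𝕏) (C : Set E), (∀ i, MeasurableSet (B i)) → MeasurableSet C →
      μ (pi univ B ×ˢ C) = ν (pi univ B ×ˢ C)) : μ = ν := by
  refine Measure.ext_prod fun {s C} hs hC => ?_
  have hap : ∀ (m : Measure ((Fin n → 𝕏) × E)) (t : Set (Fin n → 𝕏)), MeasurableSet t →
      (m.restrict (univ ×ˢ C)).map Prod.fst t = m (t ×ˢ C) := fun m t ht => by
    rw [Measure.map_apply measurable_fst ht, Measure.restrict_apply (measurable_fst ht)]
    congr 1
    ext p
    simp
  have key : (μ.restrict (univ ×ˢ C)).map Prod.fst = (ν.restrict (univ ×ˢ C)).map Prod.fst := by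
    refine ext_of_pi fun B hB => ?_
    have hBm : MeasurableSet (pi univ B) := MeasurableSet.univ_pi hB
    rw [hap _ _ hBm, hap _ _ hBm, h B C hB hC]
  rw [← hap μ s hs, ← hap ν s hs, key]

section Laws
variable {𝕏 : Type*} [MeasurableSpace 𝕏] {Ω : Type*} [MeasurableSpace Ω] {P : Measure Ω}
  {μt : Ω → Measure 𝕏} {γ q : ℝ} {X : ℕ → Ω → 𝕏} {n : ℕ} {U : Ω → ℝ}

theorem ae_of_hasLaw_tiltedLaw {Q : Measure (Measure 𝕏)} (h : HasLaw μt (tiltedLaw Q γ q) P)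
    {p : Measure 𝕏 → Prop} (hp : ∀ᵐ m ∂Q, p m) : ∀ᵐ ω ∂P, p (μt ω) := by
  refine ae_of_ae_map h.aemeasurable ?_
  rw [h.map_eq, tiltedLaw]
  exact Measure.ae_smul_measure ((withDensity_absolutelyContinuous _ _).ae_le hp) _

theorem measurable_firstObs (hX : ∀ i, Measurable (X i)) : Measurable (firstObs X n) :=
  measurable_pi_lambda _ fun i => hX i

theorem map_firstObs_prod_gamma (hX_meas : ∀ i, Measurable (X i)) (hU_meas : Measurable U)
    (hU : IsGammaAugmentation U n q X μt P) {B : Fin n → Set 𝕏} {C : Set ℝ}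
    (hB : ∀ i, MeasurableSet (B i)) (hC : MeasurableSet C) :
    P.map (fun ω => (firstObs X n ω, U ω)) (pi univ B ×ˢ C) =
      ∫⁻ ω, (∏ i, normalize (μt ω) (B i)) * gammaMeasure (n + q) (μt ω univ).toReal C ∂P := by
  have h := hU univ B C MeasurableSet.univ hB hC
  simp only [mem_univ, ofPred_true, Measure.restrict_univ, true_and] at h
  rw [← h, Measure.map_apply ((measurable_firstObs hX_meas).prodMk hU_meas)
    ((MeasurableSet.univ_pi hB).prod hC)]
  congr 1
  ext ω
  simp [firstObs]

theorem map_firstObs_prod_sample (hX_meas : ∀ i, Measurable (X i)) (hX : IsSampleFrom X μt P)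
    {B : Fin (n + 1) → Set 𝕏} (hB : ∀ i, MeasurableSet (B i)) :
    P.map (fun ω => (firstObs X n ω, X n ω))
        (pi univ (fun i : Fin n => B i.castSucc) ×ˢ B (Fin.last n)) =
      ∫⁻ ω, ∏ i, normalize (μt ω) (B i) ∂P := by
  have h := hX (n + 1) univ B MeasurableSet.univ hB
  simp only [mem_univ, ofPred_true, Measure.restrict_univ, true_and] at h
  rw [← h, Measure.map_apply ((measurable_firstObs hX_meas).prodMk (hX_meas n))
    ((MeasurableSet.univ_pi fun i => hB _).prod (hB _))]
  congr 1
  ext ω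
  simp [firstObs, Fin.forall_fin_succ']

/-- The functional equation of Γ; this is the origin of the value n + q of φ. -/
theorem augConst_succ (Q : Measure (Measure 𝕏)) (γ : ℝ) (hn : 0 < (n : ℝ) + q) :
    augConst Q γ q (n + 1) = (ENNReal.ofReal (n + q))⁻¹ * augConst Q γ q n := by
  rw [augConst, augConst]
  have h1 : ((n + 1 : ℕ) : ℝ) + q = (n + q) + 1 := by push_cast; ring
  rw [h1, Real.Gamma_add_one hn.ne', mul_inv, ENNReal.ofReal_mul (inv_nonneg.2 hn.le),
    ENNReal.ofReal_inv_of_pos hn]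
  ring

variable {η : Measure 𝕏} {ρ : Kernel 𝕏 ℝ} {Ω₀ : Type*} [MeasurableSpace Ω₀] {P₀ : Measure Ω₀}
  {N : Ω₀ → Measure (𝕏 × ℝ)} [IsProbabilityMeasure η] [IsSFiniteKernel ρ] [IsProbabilityMeasure P₀]

theorem ae_map_toCRM (hN : IsPoissonProcess N (η ⊗ₘ ρ) P₀)
    (hρ : ∫⁻ x, ∫⁻ y in Ioi 0, ENNReal.ofReal (min y 1) ∂(ρ x) ∂η < ∞)
    (hρ_pos : ∀ x, ρ x (Iic 0) = 0) (hρ_inf : (η ⊗ₘ ρ) univ = ∞) :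
    (∀ᵐ m ∂(P₀.map fun ω => toCRM (N ω)), m univ ≠ 0) ∧
      ∀ᵐ m ∂(P₀.map fun ω => toCRM (N ω)), m univ ≠ ∞ := by
  have hm : Measurable fun ω => toCRM (N ω) := measurable_toCRM.comp hN.measurable
  have huniv : Measurable fun m : Measure 𝕏 => m univ := Measure.measurable_coe MeasurableSet.univ
  constructor
  · exact (ae_map_iff hm.aemeasurable (huniv (measurableSet_singleton 0).compl)).2
      (ae_toCRM_univ_ne_zero hN hρ_pos hρ_inf)
  · exact (ae_map_iff hm.aemeasurable (huniv (measurableSet_singleton ∞).compl)).2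
      (ae_toCRM_univ_ne_top hN hρ)

variable [MeasurableEq 𝕏] [NullSingletonClass η]

theorem map_firstObs_prod_gamma_eq (hN : IsPoissonProcess N (η ⊗ₘ ρ) P₀)
    (hρ : ∫⁻ x, ∫⁻ y in Ioi 0, ENNReal.ofReal (min y 1) ∂(ρ x) ∂η < ∞)
    (hρ_pos : ∀ x, ρ x (Iic 0) = 0) (hρ_inf : (η ⊗ₘ ρ) univ = ∞) (hγ : 0 ≤ γ)
    (hnq : 0 < (n : ℝ) + q)
    (hμt : HasLaw μt (tiltedLaw (P₀.map fun ω => toCRM (N ω)) γ q) P)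
    (hX_meas : ∀ i, Measurable (X i)) (hU_meas : Measurable U)
    (hU : IsGammaAugmentation U n q X μt P) {B : Fin n → Set 𝕏} {C : Set ℝ}
    (hB : ∀ i, MeasurableSet (B i)) (hC : MeasurableSet C) :
    P.map (fun ω => (firstObs X n ω, U ω)) (pi univ B ×ˢ C) =
      augConst (P₀.map fun ω => toCRM (N ω)) γ q n * ∫⁻ u in Ioi 0, ∫⁻ x in pi univ B,
        C.indicator 1 u * unnormDensityU η ρ γ q x u ∂(refMeasure η n) := by
  obtain ⟨h0, htop⟩ := ae_map_toCRM hN hρ hρ_pos hρ_inf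
  have hm : Measurable fun ω => toCRM (N ω) := measurable_toCRM.comp hN.measurable
  rw [map_firstObs_prod_gamma hX_meas hU_meas hU hB hC,
    lintegral_prod_normalize_mul_gammaMeasure h0 htop hμt hnq hγ hB hC]
  congr 1
  refine setLIntegral_congr_fun measurableSet_Ioi fun u hu => ?_
  rw [moment_eq_unnormDensityU hN hρ hγ hB hu, lintegral_const_mul']
  by_cases huC : u ∈ C <;> simp [huC]

theorem map_firstObs_prod_sample_eq (hN : IsPoissonProcess N (η ⊗ₘ ρ) P₀)
    (hρ : ∫⁻ x, ∫⁻ y in Ioi 0, ENNReal.ofReal (min y 1) ∂(ρ x) ∂η < ∞)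
    (hρ_pos : ∀ x, ρ x (Iic 0) = 0) (hρ_inf : (η ⊗ₘ ρ) univ = ∞) (hγ : 0 ≤ γ)
    (hnq : 0 < (n : ℝ) + q)
    (hμt : HasLaw μt (tiltedLaw (P₀.map fun ω => toCRM (N ω)) γ q) P)
    (hX_meas : ∀ i, Measurable (X i)) (hX : IsSampleFrom X μt P) {B : Fin n → Set 𝕏} {B' : Set 𝕏}
    (hB : ∀ i, MeasurableSet (B i)) (hB' : MeasurableSet B') :
    P.map (fun ω => (firstObs X n ω, X n ω)) (pi univ B ×ˢ B') =
      (ENNReal.ofReal (n + q))⁻¹ * (augConst (P₀.map fun ω => toCRM (N ω)) γ q n *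
        ∫⁻ u in Ioi 0, ∫⁻ x in pi univ B,
          (∫⁻ z, condWeightNew ρ γ u z * B'.indicator 1 z ∂η +
            ∑ y ∈ values x, condWeightOld ρ γ x u y * B'.indicator 1 y) *
          unnormDensityU η ρ γ q x u ∂(refMeasure η n)) := by
  obtain ⟨h0, htop⟩ := ae_map_toCRM hN hρ hρ_pos hρ_inf
  have hm : Measurable fun ω => toCRM (N ω) := measurable_toCRM.comp hN.measurable
  have hsucc : 0 < ((n + 1 : ℕ) : ℝ) + q := by push_cast; linarith
  obtain ⟨D, hD⟩ : ∃ D : Fin (n + 1) → Set 𝕏, D = Fin.snoc (α := fun _ => Set 𝕏) B B' := ⟨_, rfl⟩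
  have hDc : (fun i : Fin n => D i.castSucc) = B := by simp [hD]
  have hDl : D (Fin.last n) = B' := by simp [hD]
  have hDm : ∀ i, MeasurableSet (D i) := by
    refine Fin.lastCases (by rwa [hDl]) fun i => ?_
    have := congrFun hDc i
    rw [this]
    exact hB i
  have h1 := map_firstObs_prod_sample hX_meas hX hDm
  -- Inserts a gamma law of shape n + 1 + q, of total mass 1 because the rate is a.s. positive and
  -- finite. The augmentation at order n + 1 is thus purely analytic.
  have h2 : ∫⁻ ω, ∏ i, normalize (μt ω) (D i) ∂P = ∫⁻ ω, (∏ i, normalize (μt ω) (D i)) *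
      gammaMeasure ((n + 1 : ℕ) + q) (μt ω univ).toReal univ ∂P := by
    refine lintegral_congr_ae ?_
    filter_upwards [ae_of_hasLaw_tiltedLaw hμt h0, ae_of_hasLaw_tiltedLaw hμt htop] with ω ha hb
    have := isProbabilityMeasure_gammaMeasure hsucc (ENNReal.toReal_pos ha hb)
    rw [measure_univ, mul_one]
  rw [h2, lintegral_prod_normalize_mul_gammaMeasure h0 htop hμt hsucc hγ hDm MeasurableSet.univ,
    augConst_succ _ _ hnq, hDc, hDl, mul_assoc] at h1
  rw [h1]
  congr 2
  refine setLIntegral_congr_fun measurableSet_Ioi fun u hu => ?_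
  have h3 := moment_succ_eq_unnormDensityU (γ := γ) (q := q) hN hρ hγ hDm hu
  rw [hDc, hDl] at h3
  simp only [indicator_univ, Pi.one_apply, one_mul]
  exact h3

end Laws

/-! ### Identification of the conditional laws -/

section Identification
variable {𝕏 : Type*} [MeasurableSpace 𝕏] [MeasurableEq 𝕏] (η : Measure 𝕏)
  [IsProbabilityMeasure η] (ρ : Kernel 𝕏 ℝ) [IsSFiniteKernel ρ] (γ q : ℝ) {n : ℕ}

theorem measurable_condWeights_mul {g : 𝕏 → ℝ≥0∞} (hg : Measurable g) :
    Measurable fun p : (Fin n → 𝕏) × ℝ => ∫⁻ z, condWeightNew ρ γ p.2 z * g z ∂η +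
      ∑ y ∈ values p.1, condWeightOld ρ γ p.1 p.2 y * g y := by
  have hN : Measurable fun p : ℝ × 𝕏 => condWeightNew ρ γ p.1 p.2 * g p.2 :=
    (measurable_condWeightNew ρ γ).mul (hg.comp measurable_snd)
  have hN1 : Measurable fun u => ∫⁻ z, condWeightNew ρ γ u z * g z ∂η := hN.lintegral_prod_right'
  exact (hN1.comp measurable_snd).add (measurable_sum_values measurable_fst fun i =>
    (measurable_condWeightOld ρ γ i).mul (hg.comp ((measurable_pi_apply i).comp measurable_fst)))

/-- Multiplying by the normalization undoes the division in `densityU`. -/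
theorem lintegral_unnormDensityU_mul_lintegral (x : Fin n → 𝕏)
    (hx : ∫⁻ v in Ioi 0, unnormDensityU η ρ γ q x v ≠ ∞) {F : ℝ → ℝ≥0∞} (hF : Measurable F) :
    (∫⁻ v in Ioi 0, unnormDensityU η ρ γ q x v) * ∫⁻ u in Ioi 0, F u * densityU η ρ γ q x u =
      ∫⁻ u in Ioi 0, F u * unnormDensityU η ρ γ q x u := by
  have hw : Measurable (unnormDensityU η ρ γ q x) :=
    (measurable_unnormDensityU η ρ γ q).of_uncurry_left
      (f := fun x u => unnormDensityU η ρ γ q x u)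
  have hd := measurable_densityU_right η ρ γ q x
  have hFd : Measurable fun u => F u * densityU η ρ γ q x u := hF.mul hd
  rw [← lintegral_const_mul _ hFd]
  -- A vanishing normalization forces the unnormalized density to vanish a.e., so both integrands
  -- are 0.
  by_cases h0 : ∫⁻ v in Ioi 0, unnormDensityU η ρ γ q x v = 0
  · refine lintegral_congr_ae ?_
    filter_upwards [(lintegral_eq_zero_iff hw).1 h0] with u hu
    simp only [Pi.zero_apply] at hu
    rw [h0, hu]
    simp
  · refine lintegral_congr fun u => ?_
    rw [densityU, mul_left_comm, ENNReal.mul_div_cancel h0 hx]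

/-- Integration against the law of the observations, whose density is the normalization of the
density of the augmenting variable. -/
theorem setLIntegral_densityU {ν : Measure (Fin n → 𝕏)} [SFinite ν] {K : ℝ≥0∞}
    (hR : ∀ᵐ x ∂ν, ∫⁻ v in Ioi 0, unnormDensityU η ρ γ q x v ≠ ∞)
    {F : (Fin n → 𝕏) → ℝ → ℝ≥0∞} (hF : Measurable fun p : (Fin n → 𝕏) × ℝ => F p.1 p.2)
    {A : Set (Fin n → 𝕏)} (hA : MeasurableSet A) :
    ∫⁻ x in A, (∫⁻ u in Ioi 0, F x u * densityU η ρ γ q x u)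
        ∂(K • ν.withDensity fun x => ∫⁻ v in Ioi 0, unnormDensityU η ρ γ q x v) =
      K * ∫⁻ u in Ioi 0, ∫⁻ x in A, F x u * unnormDensityU η ρ γ q x u ∂ν := by
  have hD := measurable_lintegral_unnormDensityU η ρ γ q (n := n)
  have hFd : Measurable fun x => ∫⁻ u in Ioi 0, F x u * densityU η ρ γ q x u :=
    (hF.mul (measurable_densityU η ρ γ q)).lintegral_prod_right'
  have hFw : Measurable fun p : (Fin n → 𝕏) × ℝ => F p.1 p.2 * unnormDensityU η ρ γ q p.1 p.2 :=
    hF.mul (measurable_unnormDensityU η ρ γ q)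
  rw [Measure.restrict_smul, lintegral_smul_measure, smul_eq_mul,
    setLIntegral_withDensity_eq_setLIntegral_mul _ hD hFd hA,
    lintegral_lintegral_swap (f := fun u x => F x u * unnormDensityU η ρ γ q x u)
      (hFw.comp measurable_swap).aemeasurable]
  congr 1
  refine lintegral_congr_ae (ae_restrict_of_ae ?_)
  filter_upwards [hR] with x hx
  exact lintegral_unnormDensityU_mul_lintegral η ρ γ q x hx
    (hF.of_uncurry_left (f := F))

end Identification

/-! ### Disintegration of the joint laws over the observations -/

section Conclusions
variable {𝕏 : Type*} [MeasurableSpace 𝕏] [MeasurableEq 𝕏] {η : Measure 𝕏}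
  [IsProbabilityMeasure η] {ρ : Kernel 𝕏 ℝ} [IsSFiniteKernel ρ] {γ q : ℝ} {n : ℕ}

/-- If the law `J` of the pair (observations, augmenting variable) has the unnormalized density
`unnormDensityU`, then its first marginal and its disintegration are explicit. -/
theorem eq_compProd_kernelU {J : Measure ((Fin n → 𝕏) × ℝ)} [IsProbabilityMeasure J]
    {ν : Measure (Fin n → 𝕏)} [SFinite ν] {K : ℝ≥0∞}
    (hJ : ∀ (B : Fin n → Set 𝕏) (C : Set ℝ), (∀ i, MeasurableSet (B i)) → MeasurableSet C →
      J (pi univ B ×ˢ C) = K * ∫⁻ u in Ioi 0, ∫⁻ x in pi univ B,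
        C.indicator 1 u * unnormDensityU η ρ γ q x u ∂ν) :
    (∀ᵐ x ∂ν, ∫⁻ v in Ioi 0, unnormDensityU η ρ γ q x v ≠ ∞) ∧
      J.fst = K • (ν.withDensity fun x => ∫⁻ v in Ioi 0, unnormDensityU η ρ γ q x v) ∧
      J = J.fst ⊗ₘ kernelU η ρ γ q n := by
  have hw := measurable_unnormDensityU η ρ γ q (n := n)
  have hD := measurable_lintegral_unnormDensityU η ρ γ q (n := n)
  have h1 : ∀ B : Fin n → Set 𝕏, (∀ i, MeasurableSet (B i)) → J.fst (pi univ B) =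
      K * ∫⁻ x in pi univ B, (∫⁻ v in Ioi 0, unnormDensityU η ρ γ q x v) ∂ν := by
    intro B hB
    rw [Measure.fst_apply (MeasurableSet.univ_pi hB), ← prod_univ, hJ B univ hB .univ]
    simp only [indicator_univ, Pi.one_apply, one_mul]
    rw [lintegral_lintegral_swap (f := fun u x => unnormDensityU η ρ γ q x u)
      (hw.comp measurable_swap).aemeasurable]
  have hfst : J.fst = K • (ν.withDensity fun x => ∫⁻ v in Ioi 0, unnormDensityU η ρ γ q x v) := by
    refine ext_of_pi fun B hB => ?_
    rw [h1 B hB, Measure.smul_apply, withDensity_apply _ (MeasurableSet.univ_pi hB), smul_eq_mul]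
  have hfin : ∀ᵐ x ∂ν, ∫⁻ v in Ioi 0, unnormDensityU η ρ γ q x v ≠ ∞ := by
    have h2 := h1 (fun _ => univ) fun _ => .univ
    rw [pi_univ, measure_univ, Measure.restrict_univ] at h2
    -- J has total mass 1, so K ≠ 0 and the integral of the normalizing constant cannot be infinite.
    have hK : K ≠ 0 := by
      rintro rfl
      simp at h2
    have h3 : ∫⁻ x, (∫⁻ v in Ioi 0, unnormDensityU η ρ γ q x v) ∂ν ≠ ∞ := by
      intro h
      rw [h, ENNReal.mul_top hK] at h2
      exact ENNReal.one_ne_top h2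
    filter_upwards [ae_lt_top hD h3] with x hx using hx.ne
  refine ⟨hfin, hfst, ext_of_pi_prod fun B C hB hC => ?_⟩
  have hBm := MeasurableSet.univ_pi hB
  have hCm : Measurable fun p : (Fin n → 𝕏) × ℝ => C.indicator (1 : ℝ → ℝ≥0∞) p.2 :=
    (measurable_one.indicator hC).comp measurable_snd
  rw [Measure.compProd_apply_prod hBm hC, hJ B C hB hC, hfst,
    ← setLIntegral_densityU η ρ γ q hfin (F := fun _ u => C.indicator 1 u) hCm hBm]
  refine lintegral_congr fun x => ?_
  rw [kernelU_apply, withDensity_apply _ hC, ← lintegral_indicator hC]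
  refine lintegral_congr fun u => ?_
  by_cases hu : u ∈ C <;> simp [hu]

/-- On boxes, J is the integral of the averaged urn weights against l, divided by n + q. The whole
space in the last coordinate gives l back, so φ/(n + q) is a density of l with respect to itself and
equals 1 a.e.; the divisor n + q may then be read as φ. -/
theorem total_eq_and_eq_compProd_urnKernel {J : Measure ((Fin n → 𝕏) × 𝕏)}
    [IsProbabilityMeasure J] {l : Measure (Fin n → 𝕏)} (hl : J.fst = l)
    {ν : Measure (Fin n → 𝕏)} [SFinite ν] {K : ℝ≥0∞}
    (hR : ∀ᵐ x ∂ν, ∫⁻ v in Ioi 0, unnormDensityU η ρ γ q x v ≠ ∞)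
    (hlR : l = K • (ν.withDensity fun x => ∫⁻ v in Ioi 0, unnormDensityU η ρ γ q x v))
    (hnq : 0 < (n : ℝ) + q)
    (hJ : ∀ (B : Fin n → Set 𝕏) (B' : Set 𝕏), (∀ i, MeasurableSet (B i)) → MeasurableSet B' →
      J (pi univ B ×ˢ B') = (ENNReal.ofReal (n + q))⁻¹ * (K *
        ∫⁻ u in Ioi 0, ∫⁻ x in pi univ B,
          (∫⁻ z, condWeightNew ρ γ u z * B'.indicator 1 z ∂η +
            ∑ y ∈ values x, condWeightOld ρ γ x u y * B'.indicator 1 y) *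
          unnormDensityU η ρ γ q x u ∂ν)) :
    (∀ᵐ x ∂l, total η ρ γ q x = ENNReal.ofReal (n + q)) ∧ J = l ⊗ₘ urnKernel η ρ γ q n := by
  have : IsProbabilityMeasure l := hl ▸ inferInstance
  have hc0 : ENNReal.ofReal (n + q) ≠ 0 := (ENNReal.ofReal_pos.2 hnq).ne'
  have hct : ENNReal.ofReal (n + q) ≠ ∞ := ENNReal.ofReal_ne_top
  have hbox : ∀ (B : Fin n → Set 𝕏) (B' : Set 𝕏), (∀ i, MeasurableSet (B i)) → MeasurableSet B' →
      J (pi univ B ×ˢ B') = (ENNReal.ofReal (n + q))⁻¹ * ∫⁻ x in pi univ B,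
        (∫⁻ z, weightNew η ρ γ q x z * B'.indicator 1 z ∂η +
          ∑ y ∈ values x, weightOld η ρ γ q x y * B'.indicator 1 y) ∂l := by
    intro B B' hB hB'
    have hI : Measurable (B'.indicator (1 : 𝕏 → ℝ≥0∞)) := measurable_one.indicator hB'
    rw [hJ B B' hB hB', hlR, ← setLIntegral_densityU η ρ γ q hR
      (F := fun x u => ∫⁻ z, condWeightNew ρ γ u z * B'.indicator 1 z ∂η +
        ∑ y ∈ values x, condWeightOld ρ γ x u y * B'.indicator 1 y)
      (measurable_condWeights_mul η ρ γ hI) (MeasurableSet.univ_pi hB)]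
    congr 1
    exact lintegral_congr fun x => lintegral_condWeights_mul_densityU η ρ γ q x hI
  have htot : ∀ᵐ x ∂l, total η ρ γ q x = ENNReal.ofReal (n + q) := by
    have hT := measurable_total η ρ γ q (n := n)
    have h1 : l = l.withDensity fun x => (ENNReal.ofReal (n + q))⁻¹ * total η ρ γ q x := by
      refine ext_of_pi fun B hB => ?_
      have hBm := MeasurableSet.univ_pi hB
      rw [withDensity_apply _ hBm, lintegral_const_mul _ hT]
      nth_rewrite 1 [← hl]
      rw [Measure.fst_apply hBm, ← prod_univ, hbox B univ hB .univ]
      simp only [indicator_univ, Pi.one_apply, mul_one]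
      rfl
    nth_rewrite 1 [← withDensity_one (μ := l)] at h1
    have h2 := (withDensity_eq_iff_of_sigmaFinite (by fun_prop)
      (hT.const_mul _).aemeasurable).1 h1
    filter_upwards [h2] with x hx
    rw [Pi.one_apply] at hx
    rw [← one_mul (total η ρ γ q x), ← ENNReal.mul_inv_cancel hc0 hct, mul_assoc, ← hx, mul_one]
  refine ⟨htot, ext_of_pi_prod fun B B' hB hB' => ?_⟩
  have hI : Measurable (B'.indicator (1 : 𝕏 → ℝ≥0∞)) := measurable_one.indicator hB'
  rw [Measure.compProd_apply_prod (MeasurableSet.univ_pi hB) hB', hbox B B' hB hB',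
    ← lintegral_const_mul' _ _ (ENNReal.inv_ne_top.2 hc0)]
  refine lintegral_congr_ae (ae_restrict_of_ae ?_)
  filter_upwards [htot] with x hx
  change _ = urn η ρ γ q x B'
  rw [← lintegral_indicator_one hB', lintegral_urn η ρ γ q x hI, hx, mul_comm]

end Conclusions

/-! ### The augmented predictive law -/

/-- A law on `F × ℝ` whose first marginal is the law of `Φ` is realized on `Ω × ℝ`. -/
theorem exists_extension {Ω F : Type*} [MeasurableSpace Ω] [MeasurableSpace F] {P : Measure Ω}
    [IsProbabilityMeasure P] {Φ : Ω → F} (hΦ : Measurable Φ) {J : Measure (F × ℝ)}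
    [IsFiniteMeasure J] (hJ : J.fst = P.map Φ) :
    ∃ (P' : Measure (Ω × ℝ)) (_ : IsProbabilityMeasure P'), P'.map Prod.fst = P ∧
      P'.map (fun w => (Φ w.1, w.2)) = J := by
  -- The extra real coordinate is drawn from the conditional law under J, given the value of Φ.
  refine ⟨P ⊗ₘ (J.condKernel.comap Φ hΦ), inferInstance, Measure.fst_compProd _ _, ?_⟩
  have hm : Measurable fun w : Ω × ℝ => (Φ w.1, w.2) := by fun_prop
  refine Measure.ext_prod fun {S C} hS hC => ?_
  have hpre : (fun w : Ω × ℝ => (Φ w.1, w.2)) ⁻¹' S ×ˢ C = (Φ ⁻¹' S) ×ˢ C := by ext w; simp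
  rw [Measure.map_apply hm (hS.prod hC), hpre, Measure.compProd_apply_prod (hΦ hS) hC]
  nth_rewrite 2 [← J.disintegrate J.condKernel]
  rw [Measure.compProd_apply_prod hS hC, hJ,
    setLIntegral_map hS (Kernel.measurable_coe _ hC) hΦ]
  rfl

section Augmented
variable {𝕏 : Type*} [MeasurableSpace 𝕏] [MeasurableEq 𝕏] (η : Measure 𝕏)
  [IsProbabilityMeasure η] (ρ : Kernel 𝕏 ℝ) [IsSFiniteKernel ρ] (γ q : ℝ) {n : ℕ}

theorem ae_condTotal_mul_densityU_ne_top (x : Fin n → 𝕏) (hx : total η ρ γ q x ≠ ∞) :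
    ∀ᵐ u ∂(volume.restrict (Ioi 0)), condTotal η ρ γ u x * densityU η ρ γ q x u ≠ ∞ := by
  have h : Measurable fun u => condTotal η ρ γ u x * densityU η ρ γ q x u :=
    ((measurable_condTotal η ρ γ).mul (measurable_densityU η ρ γ q)).of_uncurry_left
      (f := fun x u => condTotal η ρ γ u x * densityU η ρ γ q x u)
  rw [← lintegral_condTotal_mul_densityU] at hx
  filter_upwards [ae_lt_top h hx] with u hu using hu.ne

theorem measurable_densityUTilde_right (x : Fin n → 𝕏) :
    Measurable (densityUTilde η ρ γ q x) :=
  (measurable_densityUTilde η ρ γ q).of_uncurry_left (f := fun x u => densityUTilde η ρ γ q x u)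

/-- The unconditional urn is the mixture of the conditional urns. -/
theorem lintegral_condUrn_kernelUTilde (x : Fin n → 𝕏) (hx : total η ρ γ q x ≠ ∞) {B : Set 𝕏}
    (hB : MeasurableSet B) :
    ∫⁻ u, condUrn η ρ γ x u B ∂(kernelUTilde η ρ γ q n x) = urn η ρ γ q x B := by
  have hI : Measurable (B.indicator (1 : 𝕏 → ℝ≥0∞)) := measurable_one.indicator hB
  have hc0 : Measurable fun p : (Fin n → 𝕏) × ℝ => condUrn η ρ γ p.1 p.2 B :=
    Kernel.measurable_coe (condUrnKernel η ρ γ n) hB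
  have hc : Measurable fun u => condUrn η ρ γ x u B :=
    hc0.of_uncurry_left (f := fun x u => condUrn η ρ γ x u B)
  have hle : ∀ u, ∫⁻ z, condWeightNew ρ γ u z * B.indicator 1 z ∂η +
      ∑ y ∈ values x, condWeightOld ρ γ x u y * B.indicator 1 y ≤ condTotal η ρ γ u x := by
    intro u
    have hind : ∀ z, B.indicator (1 : 𝕏 → ℝ≥0∞) z ≤ 1 := fun z =>
      indicator_le_self' (fun _ _ => zero_le) z
    exact add_le_add (lintegral_mono fun z => mul_le_of_le_one_right' (hind z))
      (Finset.sum_le_sum fun y _ => mul_le_of_le_one_right' (hind y))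
  have hA : Measurable fun u => (∫⁻ z, condWeightNew ρ γ u z * B.indicator 1 z ∂η +
      ∑ y ∈ values x, condWeightOld ρ γ x u y * B.indicator 1 y) * densityU η ρ γ q x u :=
    ((measurable_condWeights_mul η ρ γ hI).of_uncurry_left
      (f := fun x u => ∫⁻ z, condWeightNew ρ γ u z * B.indicator 1 z ∂η +
        ∑ y ∈ values x, condWeightOld ρ γ x u y * B.indicator 1 y)).mul
      (measurable_densityU_right η ρ γ q x)
  have hcond : ∀ u, condUrn η ρ γ x u B = (∫⁻ z, condWeightNew ρ γ u z * B.indicator 1 z ∂η +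
      ∑ y ∈ values x, condWeightOld ρ γ x u y * B.indicator 1 y) *
        (condTotal η ρ γ u x)⁻¹ := fun u => by
    rw [← lintegral_indicator_one hB, lintegral_condUrn η ρ γ x u hI]
  rw [kernelUTilde_apply, lintegral_withDensity_eq_lintegral_mul _
    (measurable_densityUTilde_right η ρ γ q x) hc, ← lintegral_indicator_one hB,
    lintegral_urn η ρ γ q x hI, ← lintegral_condWeights_mul_densityU η ρ γ q x hI,
    ← lintegral_mul_const _ hA]
  refine lintegral_congr_ae ?_
  filter_upwards [ae_condTotal_mul_densityU_ne_top η ρ γ q x hx] with u hu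
  have hle := hle u
  rw [Pi.mul_apply, hcond, densityUTilde_eq]
  generalize ∫⁻ z, condWeightNew ρ γ u z * B.indicator 1 z ∂η +
      ∑ y ∈ values x, condWeightOld ρ γ x u y * B.indicator 1 y = a at *
  -- The factor φ(u) of the tilted density must cancel the divisor of the conditional urn. Where the
  -- density is nonzero, φ(u) is finite for a.e. u; where φ(u) = 0, the numerator a ≤ φ(u) vanishes
  -- too.
  by_cases hf : densityU η ρ γ q x u = 0
  · simp [hf]
  have hφt : condTotal η ρ γ u x ≠ ∞ := fun h => hu (by rw [h, ENNReal.top_mul hf])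
  by_cases hφ : condTotal η ρ γ u x = 0
  · have ha : a = 0 := by simpa [hφ] using hle
    simp [ha]
  · calc _ = (condTotal η ρ γ u x * (condTotal η ρ γ u x)⁻¹) *
          (a * densityU η ρ γ q x u * (total η ρ γ q x)⁻¹) := by ring
      _ = _ := by rw [ENNReal.mul_inv_cancel hφ hφt, one_mul]

/-- The conditional urn may fail to have mass 1 where φ(u) is 0 or ∞. The density of Ũ has the
factor φ(u), so the first case is not charged; finiteness of the averaged φ excludes the second. -/
theorem ae_condUrn_univ (x : Fin n → 𝕏) (hx : total η ρ γ q x ≠ ∞) :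
    ∀ᵐ u ∂(kernelUTilde η ρ γ q n x), condUrn η ρ γ x u univ = 1 := by
  rw [kernelUTilde_apply, ae_withDensity_iff (measurable_densityUTilde_right η ρ γ q x)]
  filter_upwards [ae_condTotal_mul_densityU_ne_top η ρ γ q x hx] with u hu h0
  rw [densityUTilde_eq] at h0
  have hφ : condTotal η ρ γ u x ≠ 0 := fun h => h0 (by simp [h])
  have hf : densityU η ρ γ q x u ≠ 0 := fun h => h0 (by simp [h])
  have hφt : condTotal η ρ γ u x ≠ ∞ := fun h => hu (by rw [h, ENNReal.top_mul hf])
  have h := lintegral_condUrn η ρ γ x u (g := fun _ => 1) measurable_const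
  simp only [lintegral_const, one_mul, mul_one] at h
  rw [h]
  exact ENNReal.mul_inv_cancel hφ hφt

/-- The joint law of the observations, of the tilted augmenting variable and of the next
observation. -/
noncomputable def augJoint (l : Measure (Fin n → 𝕏)) : Measure (((Fin n → 𝕏) × ℝ) × 𝕏) :=
  (l ⊗ₘ kernelUTilde η ρ γ q n) ⊗ₘ condUrnKernel η ρ γ n

variable {η ρ γ q} {l : Measure (Fin n → 𝕏)} [IsFiniteMeasure l]

instance : IsFiniteMeasure (augJoint η ρ γ q l) := by
  unfold augJoint; infer_instance

theorem fst_augJoint (hl : ∀ᵐ x ∂l, total η ρ γ q x ≠ ∞) :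
    (augJoint η ρ γ q l).fst = l ⊗ₘ kernelUTilde η ρ γ q n := by
  have hm : Measurable fun p : (Fin n → 𝕏) × ℝ => condUrn η ρ γ p.1 p.2 univ :=
    Kernel.measurable_coe (condUrnKernel η ρ γ n) .univ
  ext S hS
  rw [Measure.fst_apply hS, ← prod_univ, augJoint, Measure.compProd_apply_prod hS .univ]
  have hae : ∀ᵐ p ∂(l ⊗ₘ kernelUTilde η ρ γ q n), condUrnKernel η ρ γ n p univ = 1 := by
    refine (Measure.ae_compProd_iff (hm (measurableSet_singleton 1))).2 ?_
    filter_upwards [hl] with x hx using ae_condUrn_univ η ρ γ q x hx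
  rw [lintegral_congr_ae (ae_restrict_of_ae hae), setLIntegral_one]

theorem map_augJoint (hl : ∀ᵐ x ∂l, total η ρ γ q x ≠ ∞) :
    (augJoint η ρ γ q l).map (fun p => (p.1.1, p.2)) = l ⊗ₘ urnKernel η ρ γ q n := by
  have hm : Measurable fun p : ((Fin n → 𝕏) × ℝ) × 𝕏 => (p.1.1, p.2) := by fun_prop
  refine Measure.ext_prod fun {A B} hA hB => ?_
  have hpre : (fun p : ((Fin n → 𝕏) × ℝ) × 𝕏 => (p.1.1, p.2)) ⁻¹' A ×ˢ B =
      (A ×ˢ univ) ×ˢ B := by ext; simp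
  rw [Measure.map_apply hm (hA.prod hB), hpre, augJoint,
    Measure.compProd_apply_prod (hA.prod .univ) hB, Measure.compProd_apply_prod hA hB,
    Measure.setLIntegral_compProd (Kernel.measurable_coe _ hB) hA .univ]
  refine lintegral_congr_ae (ae_restrict_of_ae ?_)
  filter_upwards [hl] with x hx
  rw [Measure.restrict_univ]
  exact lintegral_condUrn_kernelUTilde η ρ γ q x hx hB

/-- On an enlargement of the probability space there is a variable `Ũ` such that the observations,
`Ũ` and the next observation have the law `augJoint`. -/
theorem exists_augmented {Ω : Type*} [MeasurableSpace Ω] {P : Measure Ω} [IsProbabilityMeasure P]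
    {ξ : Ω → Fin n → 𝕏} (hξ : Measurable ξ) {z : Ω → 𝕏} (hz : Measurable z)
    (htot : ∀ᵐ x ∂(P.map ξ), total η ρ γ q x ≠ ∞)
    (h : P.map (fun ω => (ξ ω, z ω)) = P.map ξ ⊗ₘ urnKernel η ρ γ q n) :
    ∃ (P' : Measure (Ω × ℝ)) (_ : IsProbabilityMeasure P'), P'.map Prod.fst = P ∧
      P'.map (fun w => ((ξ w.1, w.2), z w.1)) = augJoint η ρ γ q (P.map ξ) := by
  -- The added coordinate must come last for `exists_extension`; the inverse permutation is applied
  -- afterwards.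
  have hm : Measurable fun p : ((Fin n → 𝕏) × ℝ) × 𝕏 => ((p.1.1, p.2), p.1.2) := by fun_prop
  obtain ⟨P', hP', hfst, hP'J⟩ := exists_extension (P := P) (hξ.prodMk hz)
    (J := (augJoint η ρ γ q (P.map ξ)).map fun p => ((p.1.1, p.2), p.1.2)) (by
      rw [h, ← map_augJoint htot, Measure.fst, Measure.map_map measurable_fst hm]
      rfl)
  refine ⟨P', hP', hfst, ?_⟩
  have hm' : Measurable fun p : ((Fin n → 𝕏) × 𝕏) × ℝ => ((p.1.1, p.2), p.1.2) := by fun_prop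
  have hw : Measurable fun w : Ω × ℝ => ((ξ w.1, z w.1), w.2) := by fun_prop
  have h2 := congrArg (Measure.map fun p : ((Fin n → 𝕏) × 𝕏) × ℝ => ((p.1.1, p.2), p.1.2)) hP'J
  rw [Measure.map_map hm' hw, Measure.map_map hm' hm] at h2
  refine h2.trans ?_
  exact Measure.map_id

end Augmented

end TiltedCRM

/-! ### The urn scheme for the normalized tilted random measure -/

theorem proposition3p1
    {𝕏 : Type*} [TopologicalSpace 𝕏] [PolishSpace 𝕏] [MeasurableSpace 𝕏] [BorelSpace 𝕏]
    [Nonempty 𝕏]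
    -- the intensity `ν(dx, ds) = η(dx) ρ_x(ds)` on `𝕏 × (0, ∞)`
    (η : Measure 𝕏) [IsProbabilityMeasure η] [NullSingletonClass η]
    (ρ : Kernel 𝕏 ℝ) [IsSFiniteKernel ρ]
    (hρ_pos : ∀ x, ρ x (Iic 0) = 0)
    (hρ_int : ∀ s : ℝ, 0 < s → ∫⁻ x, ∫⁻ y in Ioi 0, ENNReal.ofReal (min y s) ∂(ρ x) ∂η < ∞)
    (hρ_inf : (η ⊗ₘ ρ) univ = ∞)
    -- the Poisson process, the completely random measure, and the tilt
    {Ω₀ : Type*} [MeasurableSpace Ω₀] (P₀ : Measure Ω₀) [IsProbabilityMeasure P₀]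
    (N : Ω₀ → Measure (𝕏 × ℝ)) (hN : TiltedCRM.IsPoissonProcess N (η ⊗ₘ ρ) P₀)
    (γ q : ℝ) (hγ : 0 ≤ γ) (hq : 0 ≤ q)
    (h_tilt : TiltedCRM.tiltConst (P₀.map fun ω => TiltedCRM.toCRM (N ω)) γ q < ∞)
    -- the tilted random measure, the sample, and the augmenting variable
    {Ω : Type*} [MeasurableSpace Ω] (P : Measure Ω) [IsProbabilityMeasure P]
    (μt : Ω → Measure 𝕏) (hμt_meas : Measurable μt)
    (hμt : HasLaw μt
      (TiltedCRM.tiltedLaw (P₀.map fun ω => TiltedCRM.toCRM (N ω)) γ q) P)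
    (X : ℕ → Ω → 𝕏) (hX_meas : ∀ i, Measurable (X i)) (hX : TiltedCRM.IsSampleFrom X μt P)
    (n : ℕ) (hn : 1 ≤ n)
    (U : Ω → ℝ) (hU_meas : Measurable U)
    (hU : TiltedCRM.IsGammaAugmentation U n q X μt P) :
    -- the conditional density of `U` given the first `n` observations
    (∀ᵐ ω ∂P, condDistrib U (TiltedCRM.firstObs X n) P (TiltedCRM.firstObs X n ω) =
      (volume.restrict (Ioi 0)).withDensity
        (TiltedCRM.densityU η ρ γ q (TiltedCRM.firstObs X n ω))) ∧
    -- 1. the predictive law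
    (∀ᵐ ω ∂P, condDistrib (X n) (TiltedCRM.firstObs X n) P (TiltedCRM.firstObs X n ω) =
      TiltedCRM.urn η ρ γ q (TiltedCRM.firstObs X n ω)) ∧
    -- 2. the augmented predictive law, on an enlargement `Ω × ℝ` of the probability space
    (∃ (P' : Measure (Ω × ℝ)) (_ : IsProbabilityMeasure P'),
      P'.map Prod.fst = P ∧
      (∀ᵐ w ∂P', condDistrib Prod.snd (fun w => TiltedCRM.firstObs X n w.1) P'
          (TiltedCRM.firstObs X n w.1) =
        (volume.restrict (Ioi 0)).withDensity
          (TiltedCRM.densityUTilde η ρ γ q (TiltedCRM.firstObs X n w.1))) ∧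
      (∀ᵐ w ∂P', condDistrib (fun w => X n w.1) (fun w => (TiltedCRM.firstObs X n w.1, w.2)) P'
          (TiltedCRM.firstObs X n w.1, w.2) =
        TiltedCRM.condUrn η ρ γ (TiltedCRM.firstObs X n w.1) w.2)) ∧
    -- 3. the normalization, and the weights as conditional expectations
    (∀ᵐ ω ∂P,
      TiltedCRM.total η ρ γ q (TiltedCRM.firstObs X n ω) =
        ∫⁻ u, TiltedCRM.condTotal η ρ γ u (TiltedCRM.firstObs X n ω)
          ∂(condDistrib U (TiltedCRM.firstObs X n) P (TiltedCRM.firstObs X n ω)) ∧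
      TiltedCRM.total η ρ γ q (TiltedCRM.firstObs X n ω) = ENNReal.ofReal (n + q) ∧
      (∀ z : 𝕏, TiltedCRM.weightNew η ρ γ q (TiltedCRM.firstObs X n ω) z =
        ∫⁻ u, TiltedCRM.condWeightNew ρ γ u z
          ∂(condDistrib U (TiltedCRM.firstObs X n) P (TiltedCRM.firstObs X n ω))) ∧
      (∀ y ∈ TiltedCRM.values (TiltedCRM.firstObs X n ω),
        TiltedCRM.weightOld η ρ γ q (TiltedCRM.firstObs X n ω) y =
          ∫⁻ u, TiltedCRM.condWeightOld ρ γ (TiltedCRM.firstObs X n ω) u y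
            ∂(condDistrib U (TiltedCRM.firstObs X n) P (TiltedCRM.firstObs X n ω)))) := by
  have hnq : 0 < (n : ℝ) + q := by
    have : (1 : ℝ) ≤ n := by exact_mod_cast hn
    linarith
  have hρ := hρ_int 1 one_pos
  have hξ := TiltedCRM.measurable_firstObs (n := n) hX_meas
  have hξU : Measurable fun ω => (TiltedCRM.firstObs X n ω, U ω) := hξ.prodMk hU_meas
  have hξX : Measurable fun ω => (TiltedCRM.firstObs X n ω, X n ω) := hξ.prodMk (hX_meas n)
  have := Measure.isProbabilityMeasure_map (μ := P) hξU.aemeasurable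
  have := Measure.isProbabilityMeasure_map (μ := P) hξX.aemeasurable
  have := Measure.isProbabilityMeasure_map (μ := P) hξ.aemeasurable
  -- The resulting expression for the law of the observations, with constant `augConst` and base
  -- measure `refMeasure`, is the input for identifying the next observation.
  obtain ⟨hfin, hfst, hlawU⟩ := TiltedCRM.eq_compProd_kernelU (η := η) (ρ := ρ) (γ := γ) (q := q)
    fun B C hB hC => TiltedCRM.map_firstObs_prod_gamma_eq hN hρ hρ_pos hρ_inf hγ hnq hμt hX_meas
      hU_meas hU hB hC
  rw [Measure.fst_map_prodMk hU_meas] at hfst hlawU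
  obtain ⟨htot, hlawX⟩ := TiltedCRM.total_eq_and_eq_compProd_urnKernel (η := η) (ρ := ρ) (γ := γ)
    (q := q) (Measure.fst_map_prodMk (hX_meas n)) hfin hfst hnq fun B B' hB hB' =>
      TiltedCRM.map_firstObs_prod_sample_eq hN hρ hρ_pos hρ_inf hγ hnq hμt hX_meas hX hB hB'
  have htot0 : ∀ᵐ x ∂(P.map (TiltedCRM.firstObs X n)), TiltedCRM.total η ρ γ q x ≠ ∞ := by
    filter_upwards [htot] with x hx using hx ▸ ENNReal.ofReal_ne_top
  have hcondU : ∀ᵐ ω ∂P, condDistrib U (TiltedCRM.firstObs X n) P (TiltedCRM.firstObs X n ω) =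
      (volume.restrict (Ioi 0)).withDensity
        (TiltedCRM.densityU η ρ γ q (TiltedCRM.firstObs X n ω)) := by
    filter_upwards [ae_of_ae_map hξ.aemeasurable
      (condDistrib_ae_eq_of_measure_eq_compProd _ hU_meas.aemeasurable hlawU)] with ω hω
    rw [hω, TiltedCRM.kernelU_apply]
  refine ⟨hcondU, ae_of_ae_map hξ.aemeasurable
    (condDistrib_ae_eq_of_measure_eq_compProd _ (hX_meas n).aemeasurable hlawX), ?_, ?_⟩
  · obtain ⟨P', hP', hP'fst, hJ⟩ := TiltedCRM.exists_augmented hξ (hX_meas n) htot0 hlawX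
    have hξ' : Measurable fun w : Ω × ℝ => TiltedCRM.firstObs X n w.1 := hξ.comp measurable_fst
    have hX' : Measurable fun w : Ω × ℝ => X n w.1 := (hX_meas n).comp measurable_fst
    have hξ2 : Measurable fun w : Ω × ℝ => (TiltedCRM.firstObs X n w.1, w.2) :=
      hξ'.prodMk measurable_snd
    have hmap : P'.map (fun w => TiltedCRM.firstObs X n w.1) = P.map (TiltedCRM.firstObs X n) := by
      rw [← hP'fst, Measure.map_map hξ measurable_fst]
      rfl
    have hJ1 : P'.map (fun w => (TiltedCRM.firstObs X n w.1, w.2)) =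
        P.map (TiltedCRM.firstObs X n) ⊗ₘ TiltedCRM.kernelUTilde η ρ γ q n := by
      rw [← TiltedCRM.fst_augJoint htot0, ← hJ, Measure.fst_map_prodMk hX']
    refine ⟨P', hP', hP'fst, ?_, ?_⟩
    · filter_upwards [ae_of_ae_map hξ'.aemeasurable (condDistrib_ae_eq_of_measure_eq_compProd _
        measurable_snd.aemeasurable (hJ1.trans (by rw [hmap])))] with w hw
      rw [hw, TiltedCRM.kernelUTilde_apply]
    · exact ae_of_ae_map hξ2.aemeasurable (condDistrib_ae_eq_of_measure_eq_compProd _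
        hX'.aemeasurable (κ := TiltedCRM.condUrnKernel η ρ γ n)
          (hJ.trans (by rw [hJ1, TiltedCRM.augJoint])))
  · filter_upwards [hcondU, ae_of_ae_map hξ.aemeasurable htot] with ω hω hω_tot
    generalize TiltedCRM.firstObs X n ω = x at *
    have hd := TiltedCRM.measurable_densityU_right η ρ γ q x
    -- At a fixed x where the conditional law is explicit, the formula holds for all g at once. The
    -- exceptional null set therefore does not depend on z.
    have hint : ∀ g : ℝ → ℝ≥0∞, Measurable g → ∫⁻ u, g u ∂(condDistrib U
        (TiltedCRM.firstObs X n) P x) = ∫⁻ u in Ioi 0, g u * TiltedCRM.densityU η ρ γ q x u := by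
      intro g hg
      rw [hω, lintegral_withDensity_eq_lintegral_mul _ hd hg]
      exact lintegral_congr fun u => mul_comm _ _
    refine ⟨?_, hω_tot, fun z => ?_, fun y hy => ?_⟩
    · rw [hint _ ((TiltedCRM.measurable_condTotal η ρ γ).of_uncurry_left
        (f := fun x u => TiltedCRM.condTotal η ρ γ u x)),
        TiltedCRM.lintegral_condTotal_mul_densityU]
    · rw [hint _ ((TiltedCRM.measurable_condWeightNew ρ γ).of_uncurry_right
        (f := fun u z => TiltedCRM.condWeightNew ρ γ u z))]
      rfl
    · obtain ⟨i, rfl⟩ := TiltedCRM.mem_values.1 hy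
      rw [hint _ ((TiltedCRM.measurable_condWeightOld ρ γ i).of_uncurry_left
        (f := fun x u => TiltedCRM.condWeightOld ρ γ x u (x i)))]
      rfl
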